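/- Fix an integer $n\ge 1$, a real number $0<q<1$, pairwise coprime positive integers $p_0,\dots,p_n$, and integers $r_0,\dots,r_{n-1}$ with $0\le r_i<p_i$. Let $\underline\ell=(\ell_0,\dots,\ell_n)$ with $\ell_i=\prod_{j\ne i}p_j$ and $p=p_0p_1\cdots p_n$. Let $\mathcal O(S^{2n+1}_q)$ be the complex unital $*$-algebra generated by $z_0,\dots,z_n$ with relations $z_iz_j=q^{-1}z_jz_i$ for $i<j$, $z_i^*z_j=qz_jz_i^*$ for $i\neq j$, $[z_i^*,z_i]=(1-q^2)\sum_{j>i}z_jz_j^*$ for all $i$, and $\sum_i z_iz_i^*=1$. Let $t\in U(1)$ act by the $*$-automorphism $z_i\mapsto t^{\ell_i}z_i$; let $\mathcal O(\mathbb P_q(\underline\ell))$ be the subalgebra of elements fixed by $U(1)$, and $\mathcal O(L_q(p;\underline\ell))$ the subalgebra of elements fixed by the $p$-th roots of unity. For $0\le k\le n$ let $\mathcal V^n_k\subset\ell^2(\mathbb N^n)$ be the closed span of the basis vectors $|\vec m\rangle$, $\vec m=(m_1,\dots,m_n)$, with $0\le m_1\le\dots\le m_k$ and $m_{k+1}>\dots>m_n\ge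 0$. For such $\vec m$ put $m_0=0$, $k_i=p_{i-1}(m_i-m_{i-1})+r_{i-1}$ for $1\le i\le k$, and $s_i=k_1+\dots+k_i$. Let $\pi_k$ be the (possibly non-unital) $*$-representation of $\mathcal O(L_q(p;\underline\ell))$ on $\ell^2(\mathbb N^n)$ which vanishes on $(\mathcal V^n_k)^\perp$ and for which, with $x_i=z_iz_i^*$ and $\zeta_i=z_i^{p_i}$, one has on $\mathcal V^n_k$ $$\pi_k(x_i)|\vec m\rangle=q^{2s_i}(1-q^{2k_{i+1}})|\vec m\rangle,\qquad \pi_k(\zeta_i)|\vec m\rangle=q^{p_is_i}\Big(\prod_{t=1}^{p_i}\big(1-q^{2(k_{i+1}+t)}\big)\Big)^{1/2}|\vec m+\vec e_{ik}\rangle\qquad(i<k),$$ $$\pi_k(x_k)|\vec m\rangle=q^{2s_k}|\vec m\rangle,\qquad \pi_k(\zeta_k)|\vec m\rangle=q^{p_ks_k}|\vec m\rangle,\qquad \pi_k(x_i)=\pi_k(\zeta_i)=0\quad(i>k),$$ where $\vec e_{ik}$ has entry $1$ in the places $i+1,\dots,k$ and $0$ elsewhere. Put $\pi_+=\sum_{k\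 \mathrm{even}}\pi_k$, $\pi_-=\sum_{k\ \mathrm{odd}}\pi_k$, and on $\mathcal H=\ell^2(\mathbb N^n)\oplus\ell^2(\mathbb N^n)$ let $\pi=\pi_+\oplus\pi_-$ restricted to $\mathcal O(\mathbb P_q(\underline\ell))$, $F(v\oplus w)=w\oplus v$ and $\gamma(v\oplus w)=v\oplus(-w)$. For a function $\lambda:\mathbb R_{\ge0}\to\mathbb R_{\ge0}$ let $|D^\lambda|$ be the selfadjoint operator $|\vec m\rangle\mapsto\lambda(m_1+\dots+m_n)|\vec m\rangle$ on $\ell^2(\mathbb N^n)$ with its maximal domain, and $D^\lambda=(|D^\lambda|\oplus|D^\lambda|)F$. (1) If $\lambda$ is increasing, Lipschitz continuous and unbounded, then $(\mathcal O(\mathbb P_q(\underline\ell)),\mathcal H,\pi,D^\lambda,\gamma)$ is an even spectral triple. That is, $D^\lambda$ is selfadjoint with compact resolvent; every $\pi(a)$ preserves the domain of $D^\lambda$ and $[D^\lambda,\pi(a)]$ is bounded; $\gamma=\gamma^*$, $\gamma^2=1$, and $\gamma$ commutes with every $\pi(a)$, preserves the domain of $D^\lambda$ and anticommutes with $D^\lambda$.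 (2) For every real $d\ge n$ and $\lambda(t)=t^{n/d}$, the datum $(\mathcal O(\mathbb P_q(\underline\ell)),\mathcal H,\pi,D^\lambda,\gamma)$ is an even spectral triple of metric dimension $d$. That is, $d$ is the infimum of the $s>0$ for which $|D^\lambda|^{-s}$ is of trace class on the orthogonal complement of the kernel of $D^\lambda$. -/

import Mathlib

noncomputable section

namespace QWProj

/-- Generators of the free algebra: `(i, false)` stands for `z_i`, `(i, true)` for `z_i^*`. -/
abbrev FreeSphere (n : ℕ) : Type := FreeAlgebra ℂ (Fin (n + 1) × Bool)

/-- The free generator `z_i`. -/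
abbrev fz {n : ℕ} (i : Fin (n + 1)) : FreeSphere n := FreeAlgebra.ι ℂ (i, false)

/-- The free generator `z_i^*`. -/
abbrev fzs {n : ℕ} (i : Fin (n + 1)) : FreeSphere n := FreeAlgebra.ι ℂ (i, true)

/-- The defining relations of the coordinate `*`-algebra of the quantum sphere `S^{2n+1}_q`.
The adjoint `commStar` of the first relation is listed, the adjoints of the others being again among
them; the sum in `selfComm` is empty for `i = n`. -/
inductive SphereRel (q : ℝ) (n : ℕ) : FreeSphere n → FreeSphere n → Prop
  | comm (i j : Fin (n + 1)) (h : i < j) :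
      SphereRel q n (fz i * fz j) ((q : ℂ)⁻¹ • (fz j * fz i))
  | commStar (i j : Fin (n + 1)) (h : i < j) :
      SphereRel q n (fzs j * fzs i) ((q : ℂ)⁻¹ • (fzs i * fzs j))
  | mixed (i j : Fin (n + 1)) (h : i ≠ j) :
      SphereRel q n (fzs i * fz j) ((q : ℂ) • (fz j * fzs i))
  | selfComm (i : Fin (n + 1)) :
      SphereRel q n (fzs i * fz i - fz i * fzs i)
        ((1 - (q : ℂ) ^ 2) • ∑ j ∈ Finset.Ioi i, fz j * fzs j)
  | sphere : SphereRel q n (∑ i, fz i * fzs i) 1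

/-- The coordinate `*`-algebra `O(S^{2n+1}_q)`, given by generators and relations. -/
def Sphere (q : ℝ) (n : ℕ) : Type := RingQuot (SphereRel q n)

variable {q : ℝ} {n : ℕ}

instance : Ring (Sphere q n) := inferInstanceAs (Ring (RingQuot (SphereRel q n)))

instance : Algebra ℂ (Sphere q n) := inferInstanceAs (Algebra ℂ (RingQuot (SphereRel q n)))

namespace Sphere

/-- The quotient map from the free algebra. -/
def mk : FreeSphere n →ₐ[ℂ] Sphere q n := RingQuot.mkAlgHom ℂ (SphereRel q n)

theorem mk_surjective : Function.Surjective (mk : FreeSphere n → Sphere q n) :=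
  RingQuot.mkAlgHom_surjective ℂ (SphereRel q n)

theorem mk_rel {x y : FreeSphere n} (h : SphereRel q n x y) : (mk x : Sphere q n) = mk y :=
  RingQuot.mkAlgHom_rel ℂ h

/-- The classes of the generators. -/
def gen (x : Fin (n + 1) × Bool) : Sphere q n := mk (FreeAlgebra.ι ℂ x)

/-- The generators `z_i` of `O(S^{2n+1}_q)`. -/
def z (i : Fin (n + 1)) : Sphere q n := gen (i, false)

theorem induct {P : Sphere q n → Prop} (halg : ∀ c : ℂ, P (algebraMap ℂ _ c))
    (hgen : ∀ x, P (gen x)) (hadd : ∀ a b, P a → P b → P (a + b))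
    (hmul : ∀ a b, P a → P b → P (a * b)) (a : Sphere q n) : P a := by
  obtain ⟨f, rfl⟩ := mk_surjective a
  induction f using FreeAlgebra.induction with
  | grade0 c => rw [AlgHom.commutes]; exact halg c
  | grade1 x => exact hgen x
  | mul a b ha hb => rw [map_mul]; exact hmul _ _ ha hb
  | add a b ha hb => rw [map_add]; exact hadd _ _ ha hb

/-- The opposite algebra of `O(S^{2n+1}_q)`, with the conjugate action of the scalars. -/
def ConjOp (q : ℝ) (n : ℕ) : Type := (Sphere q n)ᵐᵒᵖ

instance : Ring (ConjOp q n) := inferInstanceAs (Ring (Sphere q n)ᵐᵒᵖ)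

instance : Algebra ℂ (ConjOp q n) :=
  letI : Algebra ℂ (ConjOp q n) := inferInstanceAs (Algebra ℂ (Sphere q n)ᵐᵒᵖ)
  Algebra.compHom (ConjOp q n) (starRingEnd ℂ)

/-- The conjugate-linear, multiplication reversing map `z_i ↦ z_i^*`, `z_i^* ↦ z_i` on the free
algebra. -/
def starLift : FreeSphere n →ₐ[ℂ] ConjOp q n :=
  FreeAlgebra.lift ℂ (fun x => (MulOpposite.op (gen (x.1, !x.2)) : (Sphere q n)ᵐᵒᵖ))

/-- The same map, with values in the opposite algebra. -/
def starFree : FreeSphere n →+* (Sphere q n)ᵐᵒᵖ := (starLift (q := q) (n := n)).toRingHom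

theorem starFree_ι (x : Fin (n + 1) × Bool) :
    (starFree (FreeAlgebra.ι ℂ x) : (Sphere q n)ᵐᵒᵖ) = MulOpposite.op (gen (x.1, !x.2)) :=
  FreeAlgebra.lift_ι_apply (A := ConjOp q n) _ x

theorem starFree_algebraMap (c : ℂ) :
    (starFree (algebraMap ℂ (FreeSphere n) c) : (Sphere q n)ᵐᵒᵖ) =
      MulOpposite.op (algebraMap ℂ _ (starRingEnd ℂ c)) :=
  AlgHom.commutes (starLift (q := q) (n := n)) c

theorem starFree_smul (c : ℂ) (a : FreeSphere n) :
    (starFree (c • a) : (Sphere q n)ᵐᵒᵖ) = (starRingEnd ℂ c) • starFree a := by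
  rw [Algebra.smul_def, map_mul, starFree_algebraMap, Algebra.smul_def]
  rfl

theorem rel_comm {i j : Fin (n + 1)} (h : i < j) :
    (gen (i, false) * gen (j, false) : Sphere q n) =
      (q : ℂ)⁻¹ • (gen (j, false) * gen (i, false)) := by
  have := mk_rel (SphereRel.comm (q := q) i j h)
  simp only [map_smul, map_mul] at this
  exact this

theorem rel_commStar {i j : Fin (n + 1)} (h : i < j) :
    (gen (j, true) * gen (i, true) : Sphere q n) =
      (q : ℂ)⁻¹ • (gen (i, true) * gen (j, true)) := by
  have := mk_rel (SphereRel.commStar (q := q) i j h)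
  simp only [map_smul, map_mul] at this
  exact this

theorem rel_mixed {i j : Fin (n + 1)} (h : i ≠ j) :
    (gen (i, true) * gen (j, false) : Sphere q n) =
      (q : ℂ) • (gen (j, false) * gen (i, true)) := by
  have := mk_rel (SphereRel.mixed (q := q) i j h)
  simp only [map_smul, map_mul] at this
  exact this

theorem rel_self (i : Fin (n + 1)) :
    (gen (i, true) * gen (i, false) - gen (i, false) * gen (i, true) : Sphere q n) =
      (1 - (q : ℂ) ^ 2) • ∑ j ∈ Finset.Ioi i, gen (j, false) * gen (j, true) := by
  have := mk_rel (SphereRel.selfComm (q := q) i)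
  simp only [map_smul, map_mul, map_sub, map_sum] at this
  exact this

theorem rel_sphere : (∑ i, gen (i, false) * gen (i, true) : Sphere q n) = 1 := by
  have := mk_rel (SphereRel.sphere (q := q) (n := n))
  simp only [map_mul, map_sum, map_one] at this
  exact this

theorem starFree_rel {x y : FreeSphere n} (h : SphereRel q n x y) :
    (starFree x : (Sphere q n)ᵐᵒᵖ) = starFree y := by
  apply MulOpposite.unop_injective
  induction h with
  | comm i j h =>
    simpa [starFree_smul, starFree_ι] using rel_commStar h
  | commStar i j h =>
    simpa [starFree_smul, starFree_ι] using rel_comm h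
  | mixed i j h =>
    simpa [starFree_smul, starFree_ι, -Complex.coe_smul] using rel_mixed (q := q) h.symm
  | selfComm i =>
    simpa [starFree_smul, starFree_ι] using rel_self i
  | sphere =>
    simpa [starFree_smul, starFree_ι] using rel_sphere

/-- The involution as a ring homomorphism to the opposite algebra. -/
def starHom : Sphere q n →+* (Sphere q n)ᵐᵒᵖ :=
  RingQuot.lift ⟨starFree, fun _ _ h => starFree_rel h⟩

theorem starHom_mk (a : FreeSphere n) : starHom (mk a : Sphere q n) = starFree a := by
  have h := RingQuot.lift_mkRingHom_apply (r := SphereRel q n) (starFree (q := q))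
    (fun _ _ h => starFree_rel h) a
  rw [← RingQuot.mkAlgHom_coe ℂ] at h
  exact h

/-- The involution of `O(S^{2n+1}_q)`: conjugate-linear, multiplication reversing, exchanging the
classes of `z_i` and `z_i^*`. -/
instance : Star (Sphere q n) := ⟨fun a => (starHom a).unop⟩

theorem star_eq (a : Sphere q n) : star a = (starHom a).unop := rfl

theorem star_gen (x : Fin (n + 1) × Bool) : star (gen x : Sphere q n) = gen (x.1, !x.2) := by
  rw [star_eq, gen, starHom_mk, starFree_ι]; rfl

theorem star_algebraMap' (c : ℂ) :
    star (algebraMap ℂ (Sphere q n) c) = algebraMap ℂ _ (starRingEnd ℂ c) := by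
  rw [← AlgHom.commutes mk, star_eq, starHom_mk, starFree_algebraMap]; rfl

theorem star_mul' (a b : Sphere q n) : star (a * b) = star b * star a := by
  simp only [star_eq, map_mul, MulOpposite.unop_mul]

theorem star_add' (a b : Sphere q n) : star (a + b) = star a + star b := by
  simp only [star_eq, map_add, MulOpposite.unop_add]

instance : StarRing (Sphere q n) where
  star_involutive a := by
    induction a using induct with
    | halg c => simp [star_algebraMap']
    | hgen x => simp [star_gen]
    | hadd a b ha hb => simp only [star_add', ha, hb]
    | hmul a b ha hb => simp only [star_mul', ha, hb]
  star_mul := star_mul'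
  star_add := star_add'

instance : StarModule ℂ (Sphere q n) where
  star_smul c a := by
    rw [Algebra.smul_def, star_mul', star_algebraMap', Algebra.smul_def]
    exact (Algebra.commutes _ _).symm

theorem star_z (i : Fin (n + 1)) : star (z i : Sphere q n) = gen (i, true) := star_gen _

/-- The relations of the quantum sphere for a tuple in a `*`-algebra. -/
structure Relations (q : ℝ) {B : Type*} [Ring B] [StarRing B] [Algebra ℂ B]
    (Z : Fin (n + 1) → B) : Prop where
  comm : ∀ i j, i < j → Z i * Z j = (q : ℂ)⁻¹ • (Z j * Z i)
  mixed : ∀ i j, i ≠ j → star (Z i) * Z j = (q : ℂ) • (Z j * star (Z i))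
  self : ∀ i, star (Z i) * Z i - Z i * star (Z i) =
    (1 - (q : ℂ) ^ 2) • ∑ j ∈ Finset.Ioi i, Z j * star (Z j)
  sphere : ∑ i, Z i * star (Z i) = 1

section lift

variable {B : Type*} [Ring B] [StarRing B] [Algebra ℂ B] [StarModule ℂ B]

/-- The value of a free generator under the homomorphism determined by `Z`. -/
def genVal (Z : Fin (n + 1) → B) (x : Fin (n + 1) × Bool) : B := bif x.2 then star (Z x.1) else Z x.1

/-- Universal property, as a homomorphism of algebras. -/
def liftAlg {Z : Fin (n + 1) → B} (h : Relations q Z) : Sphere q n →ₐ[ℂ] B :=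
  RingQuot.liftAlgHom ℂ ⟨FreeAlgebra.lift ℂ (genVal Z), by
    intro x y hxy
    induction hxy with
    | comm i j hij => simpa [genVal] using h.comm i j hij
    | commStar i j hij =>
      have := congrArg star (h.comm i j hij)
      simpa [genVal] using this
    | mixed i j hij => simpa [genVal, -Complex.coe_smul] using h.mixed i j hij
    | selfComm i => simpa [genVal] using h.self i
    | sphere => simpa [genVal] using h.sphere⟩

theorem liftAlg_gen {Z : Fin (n + 1) → B} (h : Relations q Z) (x : Fin (n + 1) × Bool) :
    liftAlg h (gen x) = genVal Z x := by
  refine (RingQuot.liftAlgHom_mkAlgHom_apply ℂ _ _ _).trans ?_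
  simp

/-- Universal property of the `*`-algebra `O(S^{2n+1}_q)`. -/
def lift {Z : Fin (n + 1) → B} (h : Relations q Z) : Sphere q n →⋆ₐ[ℂ] B :=
  { liftAlg h with
    map_star' := by
      intro a
      change liftAlg h (star a) = star (liftAlg h a)
      induction a using induct with
      | halg c => 
        rw [star_algebraMap', AlgHom.commutes, AlgHom.commutes]; exact algebraMap_star_comm c
      | hgen x => 
        rw [star_gen, liftAlg_gen, liftAlg_gen]
        rcases x with ⟨i, b⟩
        cases b <;> simp [genVal]
      | hadd a b ha hb => simp only [star_add, map_add, ha, hb]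
      | hmul a b ha hb => simp only [star_mul, map_mul, ha, hb] }

theorem lift_z {Z : Fin (n + 1) → B} (h : Relations q Z) (i : Fin (n + 1)) :
    lift h (z i) = Z i := liftAlg_gen h _

end lift

theorem gen_relations : Relations q (z : Fin (n + 1) → Sphere q n) where
  comm _ _ h := rel_comm h
  mixed i j h := by rw [star_z]; exact rel_mixed h
  self i := by simp only [star_z]; exact rel_self i
  sphere := by simp only [star_z]; exact rel_sphere

theorem smul_star_smul {u : ℂ} (hu : star u * u = 1) (a b : Sphere q n) :
    (u • a) * star (u • b) = a * star b ∧ star (u • a) * (u • b) = star a * b := by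
  have hu' : u * star u = 1 := by rw [mul_comm]; exact hu
  constructor
  · rw [star_smul, smul_mul_smul_comm, hu', one_smul]
  · rw [star_smul, smul_mul_smul_comm, hu, one_smul]

theorem act_relations (u : Fin (n + 1) → ℂ) (hu : ∀ i, star (u i) * u i = 1) :
    Relations q (fun i => u i • (z i : Sphere q n)) where
  comm i j h := by
    simp only [smul_mul_smul_comm, gen_relations.comm i j h]
    rw [smul_comm, mul_comm]
  mixed i j h := by
    simp only [star_smul, smul_mul_smul_comm, gen_relations.mixed i j h]
    rw [smul_comm, mul_comm]
  self i := by
    simp only [(smul_star_smul (hu _) _ _).1, (smul_star_smul (hu _) _ _).2]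
    exact gen_relations.self i
  sphere := by
    simp only [(smul_star_smul (hu _) _ _).1]
    exact gen_relations.sphere

theorem circle_star_mul (t : Circle) (m : ℕ) :
    star ((t : ℂ) ^ m) * (t : ℂ) ^ m = 1 := by
  rw [star_pow, ← mul_pow]
  have : star (t : ℂ) * (t : ℂ) = 1 := by
    have h := Complex.normSq_eq_conj_mul_self (z := (t : ℂ))
    rw [Circle.normSq_coe] at h
    exact_mod_cast h.symm
  rw [this, one_pow]

/-- The weighted action of `U(1)` on `O(S^{2n+1}_q)` by `*`-automorphisms, `z_i ↦ t^{l_i} z_i`. -/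
def act (l : Fin (n + 1) → ℕ) (t : Circle) : Sphere q n →⋆ₐ[ℂ] Sphere q n :=
  lift (act_relations (fun i => (t : ℂ) ^ l i) (fun i => circle_star_mul t (l i)))

theorem act_z (l : Fin (n + 1) → ℕ) (t : Circle) (i : Fin (n + 1)) :
    act l t (z i : Sphere q n) = (t : ℂ) ^ l i • z i := lift_z _ i

end Sphere

/-- Elements of `O(S^{2n+1}_q)` fixed by `t` for all `t` in a set `G` of `U(1)`. -/
def fixedAlg (q : ℝ) {n : ℕ} (l : Fin (n + 1) → ℕ) (G : Set Circle) :
    StarSubalgebra ℂ (Sphere q n) where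
  carrier := {a | ∀ t ∈ G, Sphere.act l t a = a}
  mul_mem' ha hb t ht := by rw [map_mul, ha t ht, hb t ht]
  add_mem' ha hb t ht := by rw [map_add, ha t ht, hb t ht]
  algebraMap_mem' c t _ := AlgHomClass.commutes _ c
  star_mem' ha t ht := by rw [map_star, ha t ht]

/-- The coordinate algebra `O(P_q(l))` of the quantum weighted projective space: the fixed points of
the whole of `U(1)`. -/
def wproj (q : ℝ) {n : ℕ} (l : Fin (n + 1) → ℕ) : StarSubalgebra ℂ (Sphere q n) :=
  fixedAlg q l Set.univ

/-- The coordinate algebra `O(L_q(p; l))` of the quantum lens space: the fixed points of the `p`-th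
roots of unity. -/
def lens (q : ℝ) {n : ℕ} (p : ℕ) (l : Fin (n + 1) → ℕ) : StarSubalgebra ℂ (Sphere q n) :=
  fixedAlg q l {t | t ^ p = 1}

/-- The Hilbert space `ℓ²(ℕⁿ)`. -/
abbrev Hil (n : ℕ) : Type := lp (fun _ : Fin n → ℕ => ℂ) 2


/-- The orthonormal basis vector `|m⟩`. -/
def ket (m : Fin n → ℕ) : Hil n := lp.single 2 m 1

theorem ket_apply (m j : Fin n → ℕ) : ket m j = if j = m then 1 else 0 := by
  rw [ket, lp.single_apply, Pi.single_apply]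

theorem ext_ket {A B : Hil n →L[ℂ] Hil n} (h : ∀ m, A (ket m) = B (ket m)) : A = B := by
  apply lp.ext_continuousLinearMap (by norm_num)
  intro m
  ext
  simpa [ket] using congrFun (congrArg Subtype.val (h m)) _

/-- Data of a weighted shift `|m⟩ ↦ c(m) |s(m)⟩` which is a contraction. -/
structure WShift (n : ℕ) where
  map : (Fin n → ℕ) → (Fin n → ℕ)
  coef : (Fin n → ℕ) → ℂ
  inj : Set.InjOn map (Function.support coef)
  bdd : ∀ m, ‖coef m‖ ≤ 1

namespace WShift

variable (w : WShift n)

theorem sum_le (v : Hil n) (s : Finset (Fin n → ℕ)) :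
    ∑ m ∈ s, ‖w.coef m * v (w.map m)‖ ^ (2 : ENNReal).toReal ≤ ‖v‖ ^ (2 : ENNReal).toReal := by
  classical
  have h1 : ∑ m ∈ s, ‖w.coef m * v (w.map m)‖ ^ (2 : ENNReal).toReal =
      ∑ m ∈ s with w.coef m ≠ 0, ‖w.coef m * v (w.map m)‖ ^ (2 : ENNReal).toReal := by
    symm
    apply Finset.sum_filter_of_ne
    intro m _ h h0
    apply h
    simp [h0]
  have h2 : ∑ m ∈ s with w.coef m ≠ 0, ‖w.coef m * v (w.map m)‖ ^ (2 : ENNReal).toReal ≤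
      ∑ m ∈ s with w.coef m ≠ 0, ‖v (w.map m)‖ ^ (2 : ENNReal).toReal := by
    apply Finset.sum_le_sum
    intro m _
    apply Real.rpow_le_rpow (norm_nonneg _) _ (by simp)
    rw [norm_mul]
    exact mul_le_of_le_one_left (norm_nonneg _) (w.bdd m)
  have h3 : ∑ m ∈ s with w.coef m ≠ 0, ‖v (w.map m)‖ ^ (2 : ENNReal).toReal =
      ∑ j ∈ ({m ∈ s | w.coef m ≠ 0}).image w.map, ‖v j‖ ^ (2 : ENNReal).toReal := by
    rw [Finset.sum_image]
    intro a ha b hb hab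
    simp only [Finset.coe_filter, Set.mem_ofPred_eq] at ha hb
    exact w.inj ha.2 hb.2 hab
  rw [h1]
  refine h2.trans ?_
  rw [h3]
  exact lp.sum_rpow_le_norm_rpow (by simp) v _

/-- The operator `(co w v)(m) = c(m) v(s(m))`. -/
def co : Hil n →L[ℂ] Hil n :=
  LinearMap.mkContinuous
    { toFun := fun v => ⟨fun m => w.coef m * v (w.map m), memℓp_gen' (w.sum_le v)⟩
      map_add' := fun u v => by
        ext m; exact mul_add _ _ _
      map_smul' := fun c v => by
        ext m; simp [mul_left_comm] } 1
    (fun v => by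
      rw [one_mul]
      exact lp.norm_le_of_forall_sum_le (by simp) (norm_nonneg _) (w.sum_le v))

theorem co_apply (v : Hil n) (m : Fin n → ℕ) : w.co v m = w.coef m * v (w.map m) := rfl

/-- The operator `|m⟩ ↦ c(m) |s(m)⟩`, defined as the adjoint of
`v ↦ (m ↦ conj c(m) * v (s(m)))`. -/
def op : Hil n →L[ℂ] Hil n :=
  star (co { w with
    coef := fun m => star (w.coef m)
    inj := fun a ha b hb h => w.inj (by simpa using ha) (by simpa using hb) h
    bdd := fun m => by simpa using w.bdd m })

theorem star_op_apply (v : Hil n) (m : Fin n → ℕ) :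
    (star w.op) v m = star (w.coef m) * v (w.map m) := by
  rw [op, star_star]; rfl

theorem op_ket (m : Fin n → ℕ) : w.op (ket m) = w.coef m • ket (w.map m) := by
  have key : ∀ v : Hil n, inner ℂ (w.op (ket m)) v = inner ℂ (w.coef m • ket (w.map m)) v := by
    intro v
    have h : w.op = ContinuousLinearMap.adjoint (star w.op) := by
      rw [← ContinuousLinearMap.star_eq_adjoint, star_star]
    rw [h, ContinuousLinearMap.adjoint_inner_left, inner_smul_left, ket, ket,
      lp.inner_single_left, lp.inner_single_left, star_op_apply]
    simp [mul_comm]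
  exact ext_inner_right ℂ key

end WShift

/-- The sum `m_1 + ... + m_i` of the first `i` components of `m = (m_1, ..., m_n)`; the component
`m_{t+1}` is `m t` with `t : Fin n`. -/
def psum (m : Fin n → ℕ) (i : ℕ) : ℕ := ∑ t : Fin n with t.val < i, m t

theorem pow_mul_sqrt_le {q : ℝ} (h0 : 0 < q) (h1 : q < 1) (a b : ℕ) :
    ‖((q ^ a * √(1 - q ^ b) : ℝ) : ℂ)‖ ≤ 1 := by
  rw [Complex.norm_real, Real.norm_of_nonneg (by positivity)]
  apply mul_le_one₀ (pow_le_one₀ h0.le h1.le) (Real.sqrt_nonneg _)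
  have : 0 ≤ q ^ b := by positivity
  exact Real.sqrt_le_one.mpr (by linarith)

section sphereRep

variable {q : ℝ} (h0 : 0 < q) (h1 : q < 1)

/-- `|m⟩ ↦ q^{m_1+...+m_{l-1}} √(1 - q^{2(m_l+1)}) |m + e_l⟩` -/
def up (l : Fin n) : Hil n →L[ℂ] Hil n :=
  WShift.op
    { map := fun m => m + Pi.single l 1
      coef := fun m => ((q ^ psum m l * √(1 - q ^ (2 * (m l + 1))) : ℝ) : ℂ)
      inj := fun _ _ _ _ h => add_right_cancel h
      bdd := fun _ => pow_mul_sqrt_le h0 h1 _ _ }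

/-- `|m⟩ ↦ q^{m_1+...+m_k} |m⟩` -/
def dg (k : ℕ) : Hil n →L[ℂ] Hil n :=
  WShift.op
    { map := id
      coef := fun m => ((q ^ psum m k : ℝ) : ℂ)
      inj := fun _ _ _ _ h => h
      bdd := fun m => by
        rw [Complex.norm_real, Real.norm_of_nonneg (by positivity)]
        exact pow_le_one₀ h0.le h1.le }

theorem psum_add_single (m : Fin n → ℕ) (l : Fin n) (i : ℕ) :
    psum (m + Pi.single l 1) i = psum m i + if l.val < i then 1 else 0 := by
  simp [psum, Finset.sum_add_distrib, Pi.single_apply, Finset.sum_ite_eq']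

theorem psum_succ (m : Fin n → ℕ) (l : Fin n) : psum m (l + 1) = psum m l + m l := by
  have : (Finset.univ.filter fun t : Fin n => t.val < l.val + 1) =
      insert l (Finset.univ.filter fun t : Fin n => t.val < l.val) := by
    ext t; simp [Fin.ext_iff]; omega
  rw [psum, this, Finset.sum_insert (by simp), add_comm]; rfl

theorem up_ket (l : Fin n) (m : Fin n → ℕ) :
    up h0 h1 l (ket m) =
      ((q ^ psum m l * √(1 - q ^ (2 * (m l + 1))) : ℝ) : ℂ) • ket (m + Pi.single l 1) :=
  WShift.op_ket _ m

theorem dg_ket (k : ℕ) (m : Fin n → ℕ) :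
    dg h0 h1 k (ket m) = ((q ^ psum m k : ℝ) : ℂ) • ket m := WShift.op_ket _ m

theorem star_dg_ket (k : ℕ) (m : Fin n → ℕ) :
    (star (dg h0 h1 k)) (ket m) = ((q ^ psum m k : ℝ) : ℂ) • ket m := by
  ext j
  rw [dg, WShift.star_op_apply]
  simp only [id, lp.coeFn_smul, Pi.smul_apply, ket_apply, smul_eq_mul]
  split_ifs with h
  · subst h; simp
  · simp

theorem star_up_ket (l : Fin n) (m : Fin n → ℕ) :
    (star (up h0 h1 l)) (ket m) =
      ((q ^ psum m l * √(1 - q ^ (2 * m l)) : ℝ) : ℂ) • ket (m - Pi.single l 1) := by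
  ext j
  rw [up, WShift.star_op_apply]
  simp only [lp.coeFn_smul, Pi.smul_apply, ket_apply, smul_eq_mul]
  by_cases h : j + Pi.single l 1 = m
  · subst h
    rw [if_pos rfl, if_pos (by simp), psum_add_single]
    simp
  · rw [if_neg h]
    by_cases h' : j = m - Pi.single l 1
    · have : m l = 0 := by
        by_contra hm
        apply h
        subst h'
        ext t
        by_cases ht : t = l
        · subst ht; simp; omega
        · simp [Pi.single_eq_of_ne ht]
      simp [this]
    · rw [if_neg h']; simp

theorem dg_star (k : ℕ) : star (dg (n := n) h0 h1 k) = dg h0 h1 k :=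
  ext_ket fun m => by rw [star_dg_ket, dg_ket]

end sphereRep

section sphereRep

variable {q : ℝ} (h0 : 0 < q) (h1 : q < 1)

theorem clm_mul_apply (A B : Hil n →L[ℂ] Hil n) (v : Hil n) : (A * B) v = A (B v) := rfl

theorem add_sub_single (m : Fin n → ℕ) (l l' : Fin n) (h : l ≠ l') :
    m + Pi.single l' 1 - Pi.single l 1 = m - Pi.single l 1 + Pi.single l' 1 := by
  ext t
  simp only [Pi.sub_apply, Pi.add_apply, Pi.single_apply]
  split_ifs <;> simp_all

theorem psum_sub_single (m : Fin n → ℕ) (l : Fin n) (i : ℕ) (hm : m l ≠ 0) (h : l.val < i) :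
    psum m i = psum (m - Pi.single l 1) i + 1 := by
  have : m = (m - Pi.single l 1) + Pi.single l 1 := by
    ext t
    by_cases ht : t = l
    · subst ht; simp; omega
    · simp [Pi.single_eq_of_ne ht]
  conv_lhs => rw [this]
  rw [psum_add_single, if_pos h]

theorem psum_sub_single' (m : Fin n → ℕ) (l : Fin n) (i : ℕ) (h : i ≤ l.val) :
    psum (m - Pi.single l 1) i = psum m i := by
  apply Finset.sum_congr rfl
  intro t ht
  have : t ≠ l := by rintro rfl; simp at ht; omega
  simp [Pi.single_eq_of_ne this]

theorem up_mul_up {l l' : Fin n} (h : l < l') :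
    up h0 h1 l * up h0 h1 l' = (q : ℂ)⁻¹ • (up h0 h1 l' * up h0 h1 l) := by
  apply ext_ket
  intro m
  have hq : (q : ℂ) ≠ 0 := by exact_mod_cast h0.ne'
  simp only [clm_mul_apply, smul_apply, up_ket, map_smul,
    smul_smul, psum_add_single, if_pos (show l.val < l'.val from h),
    if_neg (show ¬ l'.val < l.val from not_lt.mpr h.le), add_right_comm m (Pi.single l 1)]
  congr 1
  simp only [Pi.add_apply, Pi.single_eq_of_ne h.ne, Pi.single_eq_of_ne h.ne', add_zero]
  push_cast
  field_simp
  ring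

theorem up_mul_dg {l : Fin n} {k : ℕ} (h : l.val < k) :
    up h0 h1 l * dg h0 h1 k = (q : ℂ)⁻¹ • (dg h0 h1 k * up h0 h1 l) := by
  apply ext_ket
  intro m
  have hq : (q : ℂ) ≠ 0 := by exact_mod_cast h0.ne'
  simp only [clm_mul_apply, smul_apply, up_ket, dg_ket,
    map_smul, smul_smul, psum_add_single, if_pos h]
  congr 1
  push_cast
  field_simp
  ring

theorem star_up_mul_up_ne {l l' : Fin n} (h : l ≠ l') :
    star (up h0 h1 l) * up h0 h1 l' = (q : ℂ) • (up h0 h1 l' * star (up h0 h1 l)) := by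
  apply ext_ket
  intro m
  simp only [clm_mul_apply, smul_apply, up_ket, star_up_ket,
    map_smul, smul_smul, add_sub_single m l l' h, psum_add_single, Pi.add_apply,
    Pi.single_eq_of_ne h, add_zero, Pi.sub_apply, Pi.single_eq_of_ne h.symm, Nat.sub_zero]
  by_cases hm : m l = 0
  · simp [hm]
  congr 1
  rcases lt_or_gt_of_ne h with hl | hl
  · rw [if_neg (show ¬ l'.val < l.val from not_lt.mpr hl.le), psum_sub_single m l l' hm hl]
    push_cast; ring
  · rw [if_pos (show l'.val < l.val from hl), psum_sub_single' m l l' hl.le]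
    push_cast; ring

theorem star_up_mul_dg {l : Fin n} {k : ℕ} (h : l.val < k) :
    star (up h0 h1 l) * dg h0 h1 k = (q : ℂ) • (dg h0 h1 k * star (up h0 h1 l)) := by
  apply ext_ket
  intro m
  simp only [clm_mul_apply, smul_apply, dg_ket, star_up_ket,
    map_smul, smul_smul]
  by_cases hm : m l = 0
  · simp [hm]
  congr 1
  rw [psum_sub_single m l k hm h]
  push_cast; ring

theorem dg_mul_up {l : Fin n} {k : ℕ} (h : l.val < k) :
    dg h0 h1 k * up h0 h1 l = (q : ℂ) • (up h0 h1 l * dg h0 h1 k) := by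
  have hq : (q : ℂ) ≠ 0 := by exact_mod_cast h0.ne'
  rw [up_mul_dg h0 h1 h, smul_smul, mul_inv_cancel₀ hq, one_smul]

theorem sqrt_sq_aux {q : ℝ} (h0 : 0 < q) (h1 : q < 1) (a : ℕ) : √(1 - q ^ a) * √(1 - q ^ a) = 1 - q ^ a :=
  Real.mul_self_sqrt (by linarith [pow_le_one₀ (n := a) h0.le h1.le])

theorem star_up_mul_up_ket (l : Fin n) (m : Fin n → ℕ) :
    (star (up h0 h1 l)) (up h0 h1 l (ket m)) =
      ((q ^ (2 * psum m l) - q ^ (2 * psum m l) * q ^ (2 * (m l + 1)) : ℝ) : ℂ) • ket m := by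
  have h := sqrt_sq_aux h0 h1 (2 * (m l + 1))
  rw [up_ket, map_smul, star_up_ket, smul_smul, add_tsub_cancel_right, psum_add_single,
    if_neg (lt_irrefl _)]
  congr 1
  rw [← Complex.ofReal_mul]
  congr 1
  simp only [Pi.add_apply, Pi.single_eq_same, add_zero]
  rw [mul_mul_mul_comm, h]
  ring

theorem up_mul_star_up_ket (l : Fin n) (m : Fin n → ℕ) :
    up h0 h1 l ((star (up h0 h1 l)) (ket m)) =
      ((q ^ (2 * psum m l) - q ^ (2 * psum m (l + 1)) : ℝ) : ℂ) • ket m := by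
  by_cases hm : m l = 0
  · simp [star_up_ket, psum_succ, hm]
  have hs : m - Pi.single l 1 + Pi.single l 1 = m := by
    ext t
    by_cases ht : t = l
    · subst ht; simp; omega
    · simp [Pi.single_eq_of_ne ht]
  have h := sqrt_sq_aux h0 h1 (2 * m l)
  have hl : (m - Pi.single l 1 : Fin n → ℕ) l + 1 = m l := by simp; omega
  rw [star_up_ket, map_smul, up_ket, smul_smul, hs, psum_sub_single' m l l le_rfl, psum_succ, hl]
  congr 1
  rw [← Complex.ofReal_mul]
  congr 1
  rw [mul_mul_mul_comm, h]
  ring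

/-- The images of the generators `z_i` in the representation of the sphere of dimension `2k+1`,
pulled back along `z_i ↦ 0` for `i > k` and amplified by the last `n - k` labels:
`z_i |m⟩ = q^{m_1+...+m_i} √(1 - q^{2(m_{i+1}+1)}) |m + e_{i+1}⟩` for `i < k`,
`z_k |m⟩ = q^{m_1+...+m_k} |m⟩` and `z_i = 0` for `i > k`. -/
def sphGen (k : Fin (n + 1)) (i : Fin (n + 1)) : Hil n →L[ℂ] Hil n :=
  if h : i < k then up h0 h1 ⟨i, lt_of_lt_of_le h (Nat.lt_succ_iff.mp k.2)⟩
  else if i = k then dg h0 h1 k else 0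

/-- Auxiliary function for the telescoping sums of the `z_i z_i^*`. -/
def tele (q : ℝ) (k : ℕ) (m : Fin n → ℕ) (i : ℕ) : ℝ := if i ≤ k then q ^ (2 * psum m i) else 0

theorem sphGen_mul_star_ket (k i : Fin (n + 1)) (m : Fin n → ℕ) :
    (sphGen h0 h1 k i * star (sphGen h0 h1 k i)) (ket m) =
      ((tele q k m i - tele q k m (i + 1) : ℝ) : ℂ) • ket m := by
  rw [clm_mul_apply, sphGen]
  split_ifs with h h'
  · rw [up_mul_star_up_ket, tele, tele, if_pos (show i.val ≤ k.val from h.le),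
      if_pos (show i.val + 1 ≤ k.val from h)]
  · subst h'
    rw [star_dg_ket, map_smul, dg_ket, smul_smul, tele, tele, if_pos le_rfl, if_neg (by omega)]
    congr 1
    push_cast; ring
  · have : k < i := lt_of_le_of_ne (not_lt.mp h) (Ne.symm h')
    have h2 : ¬ i.val ≤ k.val := not_le.mpr this
    simp [tele, h2, show ¬ i.val + 1 ≤ k.val by omega]

theorem sum_tele (k : Fin (n + 1)) (m : Fin n → ℕ) (a : ℕ) (ha : a ≤ n + 1) :
    ∑ j : Fin (n + 1) with a ≤ j.val, (tele q k m j - tele q k m (j + 1)) = tele q k m a := by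
  induction ha using Nat.decreasingInduction with
  | self =>
    rw [Finset.sum_eq_zero, tele, if_neg (by omega)]
    intro x hx
    simp at hx; omega
  | of_succ a ha ih =>
    have : (Finset.univ.filter fun t : Fin (n + 1) => a ≤ t.val) =
        insert ⟨a, ha⟩ (Finset.univ.filter fun t : Fin (n + 1) => a + 1 ≤ t.val) := by
      ext t; simp [Fin.ext_iff]; omega
    rw [this, Finset.sum_insert (by simp), ih]
    ring

theorem sphGen_relations (k : Fin (n + 1)) : Sphere.Relations q (sphGen (n := n) h0 h1 k) where
  comm i j h := by
    unfold sphGen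
    by_cases hj : j < k
    · rw [dif_pos hj, dif_pos (h.trans hj)]
      exact up_mul_up h0 h1 h
    · rw [dif_neg hj]
      by_cases hj' : j = k
      · subst hj'
        rw [if_pos rfl, dif_pos h]
        exact up_mul_dg h0 h1 h
      · rw [if_neg hj']; simp
  mixed i j h := by
    unfold sphGen
    by_cases hi : i < k
    · rw [dif_pos hi]
      by_cases hj : j < k
      · rw [dif_pos hj]
        exact star_up_mul_up_ne h0 h1 (fun h' => h (Fin.ext (Fin.mk.inj_iff.mp h')))
      · rw [dif_neg hj]
        by_cases hj' : j = k
        · rw [if_pos hj']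
          exact star_up_mul_dg h0 h1 hi
        · rw [if_neg hj']; simp
    · rw [dif_neg hi]
      by_cases hi' : i = k
      · rw [if_pos hi', dg_star]
        by_cases hj : j < k
        · rw [dif_pos hj]
          exact dg_mul_up h0 h1 hj
        · rw [dif_neg hj, if_neg (fun h' => h (hi'.trans h'.symm))]; simp
      · rw [if_neg hi']; simp
  self i := by
    apply ext_ket
    intro m
    have hsum : (∑ j ∈ Finset.Ioi i, sphGen h0 h1 k j * star (sphGen h0 h1 k j)) (ket m) =
        ((tele q k m (i + 1) : ℝ) : ℂ) • ket m := by
      rw [← sum_tele k m (i + 1) (by omega), sum_apply,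
        Complex.ofReal_sum, Finset.sum_smul]
      have : Finset.Ioi i = Finset.univ.filter fun t : Fin (n + 1) => i.val + 1 ≤ t.val := by
        ext t; simp only [Finset.mem_Ioi, Finset.mem_filter, Finset.mem_univ, true_and]; exact Iff.rfl
      rw [this]
      exact Finset.sum_congr rfl fun j _ => sphGen_mul_star_ket h0 h1 k j m
    rw [smul_apply, hsum, sub_apply, sphGen_mul_star_ket,
      clm_mul_apply, smul_smul]
    by_cases hi : i < k
    · simp only [sphGen, dif_pos hi]
      rw [star_up_mul_up_ket, ← sub_smul, tele, tele, if_pos (show i.val ≤ k.val from hi.le),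
        if_pos (show i.val + 1 ≤ k.val from hi)]
      congr 1
      have := psum_succ m ⟨i, lt_of_lt_of_le hi (Nat.lt_succ_iff.mp k.2)⟩
      simp only at this
      rw [this]
      push_cast; ring
    · have h2 : ¬ i.val + 1 ≤ k.val := fun h => hi (Nat.lt_of_succ_le h)
      rw [tele, tele, if_neg h2]
      simp only [sphGen, dif_neg hi]
      by_cases hi' : i = k
      · subst hi'
        simp only [if_true, dg_ket, map_smul, star_dg_ket, smul_smul, le_refl]
        rw [← sub_smul]
        convert zero_smul ℂ _ using 2
        · push_cast; ring
        · simp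
      · have : ¬ i.val ≤ k.val := fun h => hi' (Fin.ext (by
          have := not_lt.mp hi; exact le_antisymm h this))
        simp [hi', this]
  sphere := by
    apply ext_ket
    intro m
    rw [sum_apply]
    have := sum_tele (q := q) k m 0 (by omega)
    simp only [zero_le, Finset.filter_true] at this
    simp only [sphGen_mul_star_ket, ← Finset.sum_smul, ← Complex.ofReal_sum, this]
    simp [tele, psum]

/-- The `*`-representation of `O(S^{2n+1}_q)` on `ℓ²(ℕⁿ)` given on generators by `sphGen`. -/
def sphRep (k : Fin (n + 1)) : Sphere q n →⋆ₐ[ℂ] (Hil n →L[ℂ] Hil n) :=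
  Sphere.lift (sphGen_relations h0 h1 k)

theorem sphRep_z (k i : Fin (n + 1)) : sphRep h0 h1 k (Sphere.z i) = sphGen h0 h1 k i :=
  Sphere.lift_z _ i

end sphereRep

/-- The diagonal operator `|m⟩ ↦ f(m) |m⟩`. -/
def diag (f : (Fin n → ℕ) → ℂ) (hf : ∀ m, ‖f m‖ ≤ 1) : Hil n →L[ℂ] Hil n :=
  WShift.co { map := id, coef := f, inj := fun _ _ _ _ h => h, bdd := hf }

theorem diag_apply (f : (Fin n → ℕ) → ℂ) (hf : ∀ m, ‖f m‖ ≤ 1) (v : Hil n) (m : Fin n → ℕ) :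
    diag f hf v m = f m * v m := rfl

theorem diag_ket (f : (Fin n → ℕ) → ℂ) (hf : ∀ m, ‖f m‖ ≤ 1) (m : Fin n → ℕ) :
    diag f hf (ket m) = f m • ket m := by
  ext j
  simp only [diag_apply, lp.coeFn_smul, Pi.smul_apply, ket_apply, smul_eq_mul]
  split_ifs with h
  · rw [h]
  · simp

theorem star_diag_ket (f : (Fin n → ℕ) → ℂ) (hf : ∀ m, ‖f m‖ ≤ 1) (m : Fin n → ℕ) :
    (star (diag f hf)) (ket m) = star (f m) • ket m := by
  have h := WShift.op_ket
    { map := id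
      coef := fun m => star (f m)
      inj := fun _ _ _ _ h => h
      bdd := fun m => by simpa using hf m } m
  simpa [WShift.op, diag] using h

theorem diag_unitary (f : (Fin n → ℕ) → ℂ) (hf : ∀ m, ‖f m‖ = 1) :
    star (diag f fun m => (hf m).le) * diag f (fun m => (hf m).le) = 1 ∧
    diag f (fun m => (hf m).le) * star (diag f fun m => (hf m).le) = 1 := by
  have h : ∀ m, star (f m) * f m = 1 := fun m => by
    have := Complex.normSq_eq_conj_mul_self (z := f m)
    rw [Complex.normSq_eq_norm_sq, hf m] at this
    simpa using this.symm
  constructor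
  · apply ext_ket
    intro m
    rw [clm_mul_apply, diag_ket, map_smul, star_diag_ket, smul_smul, mul_comm, h m, one_smul]; rfl
  · apply ext_ket
    intro m
    rw [clm_mul_apply, star_diag_ket, map_smul, diag_ket, smul_smul, h m, one_smul]; rfl

theorem entry_eq_zero (f : (Fin n → ℕ) → ℂ) (hf : ∀ m, ‖f m‖ ≤ 1) (A : Hil n →L[ℂ] Hil n)
    (h : diag f hf * A = A * diag f hf) (j j' : Fin n → ℕ) (hj : A (ket j) j' ≠ 0) :
    f j' = f j := by
  have h1 := congrFun (congrArg Subtype.val (congrArg (fun B => B (ket j)) h)) j'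
  simp only [clm_mul_apply, diag_ket, map_smul] at h1
  exact mul_right_cancel₀ hj h1

section rep

variable {q : ℝ} (h0 : 0 < q) (h1 : q < 1)

theorem diag_mul_up (f : (Fin n → ℕ) → ℂ) (hf : ∀ m, ‖f m‖ ≤ 1) (l : Fin n) (c : ℂ)
    (hc : ∀ m, f (m + Pi.single l 1) = c * f m) :
    diag f hf * up h0 h1 l = c • (up h0 h1 l * diag f hf) := by
  apply ext_ket
  intro m
  simp only [clm_mul_apply, smul_apply, diag_ket, up_ket, map_smul, smul_smul, hc]
  congr 1
  ring

theorem diag_mul_dg (f : (Fin n → ℕ) → ℂ) (hf : ∀ m, ‖f m‖ ≤ 1) (k : ℕ) :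
    diag f hf * dg h0 h1 k = dg h0 h1 k * diag f hf := by
  apply ext_ket
  intro m
  simp only [clm_mul_apply, diag_ket, dg_ket, map_smul, smul_smul, mul_comm]

theorem diag_mul_sphRep (k : Fin (n + 1)) (f : (Fin n → ℕ) → ℂ) (hf : ∀ m, ‖f m‖ = 1)
    (u : Fin (n + 1) → ℂ) (hu : ∀ l : Fin n, l.val < k.val → ∀ m,
      f (m + Pi.single l 1) = u l.castSucc * f m) (huk : u k = 1)
    (τ : Sphere q n →⋆ₐ[ℂ] Sphere q n) (hτ : ∀ i, τ (Sphere.z i) = u i • Sphere.z i)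
    (a : Sphere q n) :
    diag f (fun m => (hf m).le) * sphRep h0 h1 k a =
      sphRep h0 h1 k (τ a) * diag f (fun m => (hf m).le) := by
  set M := diag f (fun m => (hf m).le) with hM
  have hz : ∀ i, M * sphRep h0 h1 k (Sphere.z i) = u i • (sphRep h0 h1 k (Sphere.z i) * M) := by
    intro i
    rw [sphRep_z, sphGen]
    split_ifs with h h'
    · exact diag_mul_up h0 h1 f _ _ _ (hu ⟨i, _⟩ h)
    · rw [h', huk, one_smul]
      exact diag_mul_dg h0 h1 f _ _
    · simp
  induction a using Sphere.induct with
  | halg c =>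
    rw [AlgHomClass.commutes τ, AlgHomClass.commutes (sphRep h0 h1 k)]
    exact (Algebra.commutes c M).symm
  | hgen x =>
    rcases x with ⟨i, b⟩
    cases b with
    | false =>
      change M * sphRep h0 h1 k (Sphere.z i) = sphRep h0 h1 k (τ (Sphere.z i)) * M
      rw [hz, hτ, map_smul, smul_mul_assoc]
    | true =>
      rw [← Sphere.star_z, map_star, map_star, hτ, map_star, map_smul]
      set Z := sphRep h0 h1 k (Sphere.z i)
      have h2 := congrArg star (hz i)
      obtain ⟨hs1, hs2⟩ := diag_unitary f hf
      rw [← hM] at hs1 hs2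
      rw [star_mul, star_smul, star_mul] at h2
      calc M * star Z = M * (star Z * star M) * M := by
            rw [mul_assoc, mul_assoc (star Z), hs1, mul_one]
        _ = star (u i • Z) * M := by
            rw [h2, star_smul, mul_smul_comm, ← mul_assoc, hs2, one_mul]
  | hadd a b ha hb => rw [map_add, mul_add, ha, hb, map_add, map_add, add_mul]
  | hmul a b ha hb =>
    rw [map_mul, ← mul_assoc, ha, mul_assoc, hb, ← mul_assoc, map_mul, map_mul]

end rep

/-- The weight vector `p^♯`, whose `i`-th component is the product of the `p_j` with `j ≠ i`. -/
def sharp (p : Fin (n + 1) → ℕ) (i : Fin (n + 1)) : ℕ := ∏ j ∈ Finset.univ.erase i, p j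

/-- The constraints `m_1 ≤ m_2 ≤ ... ≤ m_k` and `m_{k+1} > m_{k+2} > ... > m_n` on the basis vectors
which span the subspace `V^n_k`. -/
def InV (k : Fin (n + 1)) (m : Fin n → ℕ) : Prop :=
  (∀ a b : Fin n, a < b → b.val < k.val → m a ≤ m b) ∧
    ∀ a b : Fin n, k.val ≤ a.val → a < b → m b < m a

/-- The component `m_{l-1}` of `m`, with the convention `m_0 = 0`. -/
def prev (m : Fin n → ℕ) (l : Fin n) : ℕ :=
  if l.val = 0 then 0 else m ⟨l.val - 1, lt_of_le_of_lt (Nat.sub_le _ _) l.2⟩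

/-- The relabelling `k_i = p_{i-1} (m_i - m_{i-1}) + r_{i-1}` for `i ≤ k`, the other labels being
unchanged. -/
def relabel (p : Fin (n + 1) → ℕ) (r : Fin n → ℕ) (k : Fin (n + 1)) (m : Fin n → ℕ) : Fin n → ℕ :=
  fun l => if l.val < k.val then p l.castSucc * (m l - prev m l) + r l else m l

theorem prev_le {k : Fin (n + 1)} {m : Fin n → ℕ} (hm : InV k m) (l : Fin n) (hl : l.val < k.val) :
    prev m l ≤ m l := by
  unfold prev
  split_ifs with h
  · exact Nat.zero_le _
  · exact hm.1 _ _ (Fin.lt_def.mpr (by simp; omega)) hl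

theorem relabel_injOn {p : Fin (n + 1) → ℕ} (hp : ∀ i, 0 < p i) (r : Fin n → ℕ)
    (k : Fin (n + 1)) {m m' : Fin n → ℕ} (hm : InV k m) (hm' : InV k m')
    (h : relabel p r k m = relabel p r k m') : m = m' := by
  have key : ∀ a : ℕ, ∀ ha : a < n, m ⟨a, ha⟩ = m' ⟨a, ha⟩ := by
    intro a
    induction a with
    | zero =>
      intro ha
      have h2 := congrFun h ⟨0, ha⟩
      simp only [relabel, prev] at h2
      split_ifs at h2 with hk
      · have := Nat.eq_of_mul_eq_mul_left (hp _) (Nat.add_right_cancel h2)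
        simpa using this
      · exact h2
    | succ a ih =>
      intro ha
      have h2 := congrFun h ⟨a + 1, ha⟩
      have hl := prev_le hm ⟨a + 1, ha⟩
      have hl' := prev_le hm' ⟨a + 1, ha⟩
      simp only [relabel, prev, Nat.add_eq_zero_iff, one_ne_zero, and_false, if_false,
        Nat.add_sub_cancel] at h2 hl hl'
      rw [ih (by omega)] at h2 hl
      split_ifs at h2 with hk
      · have := Nat.eq_of_mul_eq_mul_left (hp _) (Nat.add_right_cancel h2)
        have := hl hk
        have := hl' hk
        omega
      · exact h2
  ext l
  exact key l l.2

theorem exists_relabel_iff {p : Fin (n + 1) → ℕ} {r : Fin n → ℕ}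
    (hr : ∀ l : Fin n, r l < p l.castSucc) (k : Fin (n + 1)) (j : Fin n → ℕ) :
    (∃ m, InV k m ∧ relabel p r k m = j) ↔
      (∀ l : Fin n, l.val < k.val → j l ≡ r l [MOD p l.castSucc]) ∧
        ∀ a b : Fin n, k.val ≤ a.val → a < b → j b < j a := by
  constructor
  · rintro ⟨m, hm, rfl⟩
    constructor
    · intro l hl
      simp [relabel, hl, Nat.ModEq]
    · intro a b ha hab
      have h1 : ¬ a.val < k.val := not_lt.mpr ha
      have h2 : ¬ b.val < k.val := by have := Fin.lt_def.mp hab; omega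
      simpa [relabel, h1, h2] using hm.2 a b ha hab
  · rintro ⟨h1, h2⟩
    let s : ℕ → ℕ := fun a => ∑ t : Fin n with t.val < a, j t / p t.castSucc
    have hs : ∀ l : Fin n, s (l.val + 1) = s l.val + j l / p l.castSucc := fun l =>
      psum_succ (fun t => j t / p t.castSucc) l
    have hmono : Monotone s := fun a b hab => by
      apply Finset.sum_le_sum_of_subset
      intro t ht
      simp only [Finset.mem_filter, Finset.mem_univ, true_and] at ht ⊢
      omega
    have hprev : ∀ l : Fin n, l.val < k.val →
        prev (fun l : Fin n => if l.val < k.val then s (l.val + 1) else j l) l = s l.val := by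
      intro l hl
      unfold prev
      split_ifs with h
      · rw [h]; simp [s]
      · simp only [Nat.sub_add_cancel (Nat.one_le_iff_ne_zero.mpr h)]
        exact if_pos (by omega)
    refine ⟨fun l => if l.val < k.val then s (l.val + 1) else j l, ⟨?_, ?_⟩, ?_⟩
    · intro a b hab hb
      have hab' := Fin.lt_def.mp hab
      simp only [if_pos hb, if_pos (show a.val < k.val by omega)]
      exact hmono (by omega)
    · intro a b ha hab
      have hab' := Fin.lt_def.mp hab
      simp only [if_neg (show ¬ a.val < k.val by omega), if_neg (show ¬ b.val < k.val by omega)]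
      exact h2 a b ha hab
    · ext l
      unfold relabel
      split_ifs with hl
      · rw [hprev l hl]
        simp only [if_pos hl]
        rw [hs, Nat.add_sub_cancel_left]
        have h3 := h1 l hl
        rw [Nat.ModEq, Nat.mod_eq_of_lt (hr l)] at h3
        rw [← h3]
        exact Nat.div_add_mod _ _
      · simp only [if_neg hl]

section pik

variable {q : ℝ} (h0 : 0 < q) (h1 : q < 1) {p : Fin (n + 1) → ℕ} (hp : ∀ i, 0 < p i)
  (hcop : Pairwise fun i j => Nat.Coprime (p i) (p j)) {r : Fin n → ℕ}
  (hr : ∀ l : Fin n, r l < p l.castSucc)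

open Classical in
/-- The partial isometry `|m⟩ ↦ |relabel m⟩` for `m` in `V^n_k`, zero on the orthogonal complement. -/
def relabelOp (hp : ∀ i, 0 < p i) (r : Fin n → ℕ) (k : Fin (n + 1)) : Hil n →L[ℂ] Hil n :=
  WShift.op
    { map := relabel p r k
      coef := fun m => if InV k m then 1 else 0
      inj := fun a ha b hb h => relabel_injOn hp r k (by simpa using ha) (by simpa using hb) h
      bdd := fun m => by split_ifs <;> simp }

open Classical in
theorem relabelOp_ket (k : Fin (n + 1)) (m : Fin n → ℕ) :
    relabelOp hp r k (ket m) = (if InV k m then (1 : ℂ) else 0) • ket (relabel p r k m) :=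
  WShift.op_ket _ m

open Classical in
theorem star_relabelOp_apply (k : Fin (n + 1)) (v : Hil n) (m : Fin n → ℕ) :
    (star (relabelOp hp r k)) v m = (if InV k m then (1 : ℂ) else 0) * v (relabel p r k m) := by
  rw [relabelOp, WShift.star_op_apply]
  by_cases h : InV k m <;> simp [h]

theorem star_relabelOp_ket (k : Fin (n + 1)) (m : Fin n → ℕ) (hm : InV k m) :
    (star (relabelOp hp r k)) (ket (relabel p r k m)) = ket m := by
  ext j
  rw [star_relabelOp_apply, ket_apply, ket_apply]
  by_cases hj : InV k j
  · rw [if_pos hj, one_mul]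
    by_cases h : j = m
    · rw [h]; simp
    · rw [if_neg h, if_neg (fun h' => h (relabel_injOn hp r k hj hm h'))]
  · rw [if_neg hj, if_neg (fun h : j = m => hj (h ▸ hm)), zero_mul]

theorem star_relabelOp_ket' (k : Fin (n + 1)) (j : Fin n → ℕ)
    (hj : ¬ ∃ m, InV k m ∧ relabel p r k m = j) : (star (relabelOp hp r k)) (ket j) = 0 := by
  ext m
  rw [star_relabelOp_apply, ket_apply]
  by_cases hm : InV k m
  · rw [if_neg (fun h => hj ⟨m, hm, h⟩)]; simp
  · simp [hm]

open Classical in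
theorem relabelOp_mul_star (k : Fin (n + 1)) :
    relabelOp hp r k * star (relabelOp hp r k) =
      diag (fun j => if ∃ m, InV k m ∧ relabel p r k m = j then 1 else 0)
        (fun m => by split_ifs <;> simp) := by
  apply ext_ket
  intro j
  rw [clm_mul_apply, diag_ket]
  split_ifs with h
  · obtain ⟨m, hm, rfl⟩ := h
    rw [star_relabelOp_ket hp k m hm, relabelOp_ket, if_pos hm]
  · rw [star_relabelOp_ket' hp k j h]; simp

theorem star_relabelOp_mul (k : Fin (n + 1)) :
    star (relabelOp hp r k) * relabelOp hp r k * star (relabelOp hp r k) =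
      star (relabelOp hp r k) := by
  apply ext_ket
  intro j
  by_cases h : ∃ m, InV k m ∧ relabel p r k m = j
  · obtain ⟨m, hm, rfl⟩ := h
    rw [clm_mul_apply, clm_mul_apply, star_relabelOp_ket hp k m hm, relabelOp_ket, if_pos hm,
      one_smul, star_relabelOp_ket hp k m hm]
  · rw [clm_mul_apply, star_relabelOp_ket' hp k j h, map_zero]

theorem dvd_sharp (p : Fin (n + 1) → ℕ) {i l : Fin (n + 1)} (h : i ≠ l) : p l ∣ sharp p i :=
  Finset.dvd_prod_of_mem p (Finset.mem_erase.mpr ⟨h.symm, Finset.mem_univ _⟩)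

theorem coprime_sharp (hcop : Pairwise fun i j => Nat.Coprime (p i) (p j)) (l : Fin (n + 1)) :
    Nat.Coprime (sharp p l) (p l) :=
  Nat.Coprime.prod_left fun _ hi => hcop (Finset.ne_of_mem_erase hi)

/-- The elements of the lens algebra preserve the residues of the first labels. -/
theorem modEq_of_entry (hp : ∀ i, 0 < p i) (hcop : Pairwise fun i j => Nat.Coprime (p i) (p j))
    (k : Fin (n + 1)) {a : Sphere q n} (ha : a ∈ lens q (∏ i, p i) (sharp p)) (l : Fin n)
    (hl : l.val < k.val) (j j' : Fin n → ℕ) (h : sphRep h0 h1 k a (ket j) j' ≠ 0) :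
    j' l ≡ j l [MOD p l.castSucc] := by
  set P := p l.castSucc with hP
  have hP0 : P ≠ 0 := (hp _).ne'
  set t : Circle := Circle.exp (2 * Real.pi / P) with ht
  have htC : (t : ℂ) = Complex.exp (2 * Real.pi * Complex.I / P) := by
    rw [ht, Circle.coe_exp]; congr 1; push_cast; ring
  have hprim : IsPrimitiveRoot (t : ℂ) P := htC ▸ Complex.isPrimitiveRoot_exp P hP0
  have htn : ∀ N, P ∣ N → (t : ℂ) ^ N = 1 := fun N hN => hprim.pow_eq_one_iff_dvd N |>.mpr hN
  have hprim' : IsPrimitiveRoot ((t : ℂ) ^ sharp p l.castSucc) P :=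
    hprim.pow_of_coprime _ (coprime_sharp hcop _)
  set w : ℂ := (t : ℂ) ^ sharp p l.castSucc with hw
  have hfix : Sphere.act (sharp p) t a = a := ha t (by
    have := htn (∏ i, p i) (Finset.dvd_prod_of_mem p (Finset.mem_univ _))
    exact Circle.ext (by simpa using this))
  have hnorm : ∀ m : Fin n → ℕ, ‖w ^ m l‖ = 1 := fun m => by
    rw [hw, norm_pow, norm_pow, Circle.norm_coe, one_pow, one_pow]
  have hcomm := diag_mul_sphRep h0 h1 k (fun m => w ^ m l) hnorm
    (fun i => (t : ℂ) ^ sharp p i) (by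
      intro l' hl' m
      by_cases h : l' = l
      · subst h
        simp [pow_succ, hw, mul_comm]
      · have : l'.castSucc ≠ l.castSucc := fun h' => h (Fin.castSucc_injective _ h')
        simp [Pi.single_eq_of_ne (Ne.symm h), htn _ (dvd_sharp p this)])
    (htn _ (dvd_sharp p (fun h' => by rw [h'] at hl; simp at hl)))
    (Sphere.act (sharp p) t) (fun i => Sphere.act_z _ _ i) a
  rw [hfix] at hcomm
  have := entry_eq_zero _ _ _ hcomm j j' h
  rw [(hprim'.isOfFinOrder hP0).pow_eq_pow_iff_modEq, ← hprim'.eq_orderOf] at this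
  exact this

/-- The elements of the sphere algebra preserve the last labels. -/
theorem eq_of_entry (k : Fin (n + 1)) {p : ℕ} {w : Fin (n + 1) → ℕ}
    {a : Sphere q n} (ha : a ∈ lens q p w) (l : Fin n)
    (hl : k.val ≤ l.val) (j j' : Fin n → ℕ) (h : sphRep h0 h1 k a (ket j) j' ≠ 0) :
    j' l = j l := by
  have hfix : Sphere.act w 1 a = a := ha 1 (by simp)
  have hcomm := diag_mul_sphRep h0 h1 k (fun m => if m l = j l then -1 else 1)
    (fun m => by split_ifs <;> simp)
    (fun _ => 1) (by
      intro l' hl' m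
      have : l ≠ l' := fun h => by rw [h] at hl; omega
      simp [Pi.single_eq_of_ne this]) rfl
    (Sphere.act w 1) (fun i => by simp [Sphere.act_z]) a
  rw [hfix] at hcomm
  have := entry_eq_zero _ _ _ hcomm j j' h
  by_contra hne
  simp [hne] at this
  norm_num [eq_comm] at this

theorem relabel_comm (k : Fin (n + 1)) {a : Sphere q n}
    (hcop : Pairwise fun i j => Nat.Coprime (p i) (p j)) (hr : ∀ l : Fin n, r l < p l.castSucc)
    (ha : a ∈ lens q (∏ i, p i) (sharp p)) :
    relabelOp hp r k * star (relabelOp hp r k) * sphRep h0 h1 k a =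
      sphRep h0 h1 k a * (relabelOp hp r k * star (relabelOp hp r k)) := by
  classical
  rw [relabelOp_mul_star]
  apply ext_ket
  intro j
  rw [clm_mul_apply, clm_mul_apply, diag_ket, map_smul]
  ext j'
  rw [diag_apply, lp.coeFn_smul, Pi.smul_apply, smul_eq_mul]
  by_cases h : sphRep h0 h1 k a (ket j) j' = 0
  · rw [h, mul_zero, mul_zero]
  · congr 1
    have e1 : ∀ l : Fin n, l.val < k.val → j' l ≡ j l [MOD p l.castSucc] :=
      fun l hl => modEq_of_entry h0 h1 hp hcop k ha l hl j j' h
    have e2 : ∀ l : Fin n, k.val ≤ l.val → j' l = j l :=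
      fun l hl => eq_of_entry h0 h1 k ha l hl j j' h
    have : (∃ m, InV k m ∧ relabel p r k m = j') ↔ (∃ m, InV k m ∧ relabel p r k m = j) := by
      rw [exists_relabel_iff hr, exists_relabel_iff hr]
      apply and_congr
      · exact forall₂_congr fun l hl =>
          ⟨fun h => (e1 l hl).symm.trans h, fun h => (e1 l hl).trans h⟩
      · refine forall₄_congr fun a b ha hab => ?_
        rw [e2 a ha, e2 b (by have := Fin.lt_def.mp hab; omega)]
    rw [if_congr this rfl rfl]

/-- The representation of the sphere algebra restricted to the span of the basis vectors whose
labels are of the form `relabel p r k m` with `m` in `V^n_k`, and transported to `V^n_k`; it is zero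
on the orthogonal complement of `V^n_k`. -/
def compress (hp : ∀ i, 0 < p i) (r : Fin n → ℕ) (k : Fin (n + 1)) (a : Sphere q n) :
    Hil n →L[ℂ] Hil n :=
  star (relabelOp hp r k) * sphRep h0 h1 k a * relabelOp hp r k

/-- The representation `π_k^{(n)}` of the lens algebra on `ℓ²(ℕⁿ)`; see `compress_zeta_of_lt`,
`compress_zeta_self`, `compress_zeta_of_gt`, `compress_x` and `compress_ket_of_not_inV` below for its
values on the generators `ζ_i = z_i^{p_i}` and `x_i = z_i z_i^*`. -/
def repK (hcop : Pairwise fun i j => Nat.Coprime (p i) (p j)) (hr : ∀ l : Fin n, r l < p l.castSucc)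
    (k : Fin (n + 1)) : lens q (∏ i, p i) (sharp p) →⋆ₙₐ[ℂ] (Hil n →L[ℂ] Hil n) where
  toFun a := compress h0 h1 hp r k a
  map_smul' c a := by simp [compress]
  map_zero' := by simp [compress]
  map_add' a b := by simp [compress, mul_add, add_mul]
  map_mul' a b := by
    have h := relabel_comm h0 h1 hp k hcop hr b.2
    have h2 := star_relabelOp_mul hp (r := r) k
    set W := relabelOp hp r k
    have h3 : W * star W * W = W := by
      have := congrArg star h2
      simpa [mul_assoc] using this
    simp only [compress, MulMemClass.coe_mul, map_mul]
    set A := sphRep h0 h1 k (a : Sphere q n)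
    set B := sphRep h0 h1 k (b : Sphere q n)
    calc star W * (A * B) * W = star W * A * (B * W) := by simp only [mul_assoc]
      _ = star W * A * (B * (W * star W) * W) := by rw [mul_assoc B, h3]
      _ = star W * A * W * (star W * B * W) := by rw [← h]; simp only [mul_assoc]
  map_star' a := by simp [compress, mul_assoc, map_star]

end pik

section formulas

variable {q : ℝ} (h0 : 0 < q) (h1 : q < 1) {p : Fin (n + 1) → ℕ} (hp : ∀ i, 0 < p i)
  {r : Fin n → ℕ}

/-- The vector `e_{lk}` with entries `1` in the places `l ≤ t < k` (counted from `0`). -/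
def stepVec (l : Fin n) (k : Fin (n + 1)) (t : Fin n) : ℕ :=
  if l ≤ t ∧ t.val < k.val then 1 else 0

theorem inV_add_stepVec {k : Fin (n + 1)} {m : Fin n → ℕ} (hm : InV k m) (l : Fin n) :
    InV k (m + stepVec l k) := by
  constructor
  · intro a b hab hb
    have := hm.1 a b hab hb
    simp only [Pi.add_apply, stepVec, Fin.le_def]
    have := Fin.lt_def.mp hab
    split_ifs <;> omega
  · intro a b ha hab
    have := hm.2 a b ha hab
    simp only [Pi.add_apply, stepVec, Fin.le_def]
    have := Fin.lt_def.mp hab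
    split_ifs <;> omega

theorem relabel_add_stepVec {k : Fin (n + 1)} {m : Fin n → ℕ} (hm : InV k m) (l : Fin n)
    (hl : l.val < k.val) :
    relabel p r k (m + stepVec l k) = relabel p r k m + Pi.single l (p l.castSucc) := by
  ext t
  rw [Pi.add_apply]
  unfold relabel
  split_ifs with ht
  · have hle := prev_le hm t ht
    have hprev : prev (m + stepVec l k) t = prev m t + if l < t then 1 else 0 := by
      unfold prev
      split_ifs with h1 h2 h2
      · exact absurd (Fin.lt_def.mp h2) (by omega)
      · rfl
      · have := Fin.lt_def.mp h2
        rw [Pi.add_apply, stepVec, if_pos ⟨Fin.le_def.mpr (by simp only; omega), by simp only; omega⟩]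
      · have : ¬ l.val < t.val := h2
        rw [Pi.add_apply, stepVec, if_neg]
        intro h
        have := Fin.le_def.mp h.1
        simp only at this; omega
    rw [hprev, Pi.add_apply, stepVec]
    rcases lt_trichotomy l t with h | h | h
    · rw [if_pos ⟨h.le, ht⟩, if_pos h, Pi.single_eq_of_ne h.ne', Nat.add_sub_add_right, add_zero]
    · subst h
      rw [if_pos ⟨le_rfl, ht⟩, if_neg (lt_irrefl _), Pi.single_eq_same, add_zero,
        Nat.sub_add_comm hle]
      ring
    · rw [if_neg (fun h' => absurd h (not_lt.mpr h'.1)), if_neg (not_lt.mpr h.le),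
        Pi.single_eq_of_ne h.ne]
      simp
  · have : t ≠ l := by rintro rfl; exact ht hl
    rw [Pi.add_apply, stepVec, if_neg (fun h => ht h.2), Pi.single_eq_of_ne this]

theorem up_pow_ket (l : Fin n) (j : Fin n → ℕ) (N : ℕ) :
    (up h0 h1 l ^ N) (ket j) =
      ((q ^ (N * psum j l) * √(∏ t ∈ Finset.range N, (1 - q ^ (2 * (j l + t + 1)))) : ℝ) : ℂ) •
        ket (j + Pi.single l N) := by
  induction N with
  | zero => simp
  | succ N ih =>
    have hps : psum (j + Pi.single l N) l = psum j l := by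
      apply Finset.sum_congr rfl
      intro t ht
      have : t ≠ l := by rintro rfl; simp at ht
      simp [Pi.single_eq_of_ne this]
    have hnn : 0 ≤ ∏ t ∈ Finset.range N, (1 - q ^ (2 * (j l + t + 1))) :=
      Finset.prod_nonneg fun t _ => by linarith [pow_le_one₀ (n := 2 * (j l + t + 1)) h0.le h1.le]
    rw [pow_succ', clm_mul_apply, ih, map_smul, up_ket, smul_smul, hps, Finset.prod_range_succ,
      Real.sqrt_mul hnn, add_assoc, ← Pi.single_add]
    congr 1
    simp only [Pi.add_apply, Pi.single_eq_same]
    push_cast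
    ring

theorem dg_pow_ket (k : ℕ) (j : Fin n → ℕ) (N : ℕ) :
    (dg h0 h1 k ^ N) (ket j) = ((q ^ (N * psum j k) : ℝ) : ℂ) • ket j := by
  induction N with
  | zero => simp
  | succ N ih =>
    rw [pow_succ', clm_mul_apply, ih, map_smul, dg_ket, smul_smul]
    congr 1
    push_cast
    ring

theorem compress_ket_of_not_inV (k : Fin (n + 1)) (a : Sphere q n) (m : Fin n → ℕ)
    (hm : ¬ InV k m) : compress h0 h1 hp r k a (ket m) = 0 := by
  rw [compress, clm_mul_apply, relabelOp_ket, if_neg hm, zero_smul, map_zero]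

/-- The operator `π_k(ζ_i)`, `i < k`, where `ζ_i = z_i^{p_i}`. -/
theorem compress_zeta_of_lt (k : Fin (n + 1)) (l : Fin n) (hl : l.val < k.val) (m : Fin n → ℕ)
    (hm : InV k m) :
    compress h0 h1 hp r k (Sphere.z l.castSucc ^ p l.castSucc) (ket m) =
      ((q ^ (p l.castSucc * psum (relabel p r k m) l) *
        √(∏ t ∈ Finset.range (p l.castSucc), (1 - q ^ (2 * (relabel p r k m l + t + 1)))) : ℝ) : ℂ) •
        ket (m + stepVec l k) := by
  have hg : sphGen h0 h1 k l.castSucc = up h0 h1 l := dif_pos (show l.castSucc < k from hl)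
  rw [compress, clm_mul_apply, clm_mul_apply, relabelOp_ket, if_pos hm, one_smul, map_pow,
    sphRep_z, hg, up_pow_ket, map_smul, ← relabel_add_stepVec hm l hl,
    star_relabelOp_ket hp k _ (inV_add_stepVec hm l)]

/-- The operator `π_k(ζ_k)`, where `ζ_k = z_k^{p_k}`. -/
theorem compress_zeta_self (k : Fin (n + 1)) (m : Fin n → ℕ) (hm : InV k m) :
    compress h0 h1 hp r k (Sphere.z k ^ p k) (ket m) =
      ((q ^ (p k * psum (relabel p r k m) k) : ℝ) : ℂ) • ket m := by
  have hg : sphGen (n := n) h0 h1 k k = dg h0 h1 k := by simp [sphGen]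
  rw [compress, clm_mul_apply, clm_mul_apply, relabelOp_ket, if_pos hm, one_smul, map_pow,
    sphRep_z, hg, dg_pow_ket, map_smul, star_relabelOp_ket hp k _ hm]

/-- `π_k(ζ_i) = 0` for `i > k`. -/
theorem compress_zeta_of_gt (k i : Fin (n + 1)) (h : k < i) :
    compress h0 h1 hp r k (Sphere.z i ^ p i) = 0 := by
  have hg : sphGen (n := n) h0 h1 k i = 0 := by simp [sphGen, h.ne', not_lt.mpr h.le]
  rw [compress, map_pow, sphRep_z, hg, zero_pow (hp i).ne']
  simp

/-- The operators `π_k(x_i)`, where `x_i = z_i z_i^*`. -/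
theorem compress_x (k i : Fin (n + 1)) (m : Fin n → ℕ) (hm : InV k m) :
    compress h0 h1 hp r k (Sphere.z i * star (Sphere.z i)) (ket m) =
      ((if i < k then q ^ (2 * psum (relabel p r k m) i) - q ^ (2 * psum (relabel p r k m) (i + 1))
        else if i = k then q ^ (2 * psum (relabel p r k m) k) else 0 : ℝ) : ℂ) • ket m := by
  have : (if i < k then q ^ (2 * psum (relabel p r k m) i) - q ^ (2 * psum (relabel p r k m) (i + 1))
        else if i = k then q ^ (2 * psum (relabel p r k m) k) else 0 : ℝ) =
      tele q k (relabel p r k m) i - tele q k (relabel p r k m) (i + 1) := by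
    unfold tele
    simp only [Fin.lt_def, Fin.ext_iff]
    rcases lt_trichotomy i.val k.val with h | h | h
    · simp [h, h.le, Nat.succ_le_of_lt h]
    · simp [h]
    · simp [h.ne', not_lt.mpr h.le, not_le.mpr h, show ¬ i.val + 1 ≤ k.val by omega]
  rw [compress, clm_mul_apply, clm_mul_apply, relabelOp_ket, if_pos hm, one_smul, map_mul,
    map_star, sphRep_z, sphGen_mul_star_ket, map_smul, star_relabelOp_ket hp k _ hm, this]

end formulas

/-- The Hilbert space `H⁺ ⊕ H⁻` of two copies of `ℓ²(ℕⁿ)`. -/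
abbrev Hil2 (n : ℕ) : Type := WithLp 2 (Hil n × Hil n)

/-- The operator `A ⊕ B`. -/
def blockDiag (A B : Hil n →L[ℂ] Hil n) : Hil2 n →L[ℂ] Hil2 n :=
  ((WithLp.prodContinuousLinearEquiv 2 ℂ (Hil n) (Hil n)).symm : _ →L[ℂ] Hil2 n) ∘L
    (A.prodMap B) ∘L (WithLp.prodContinuousLinearEquiv 2 ℂ (Hil n) (Hil n) : Hil2 n →L[ℂ] _)

theorem blockDiag_apply (A B : Hil n →L[ℂ] Hil n) (v : Hil2 n) :
    blockDiag A B v = WithLp.toLp 2 (A v.fst, B v.snd) := rfl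

theorem star_blockDiag (A B : Hil n →L[ℂ] Hil n) :
    star (blockDiag A B) = blockDiag (star A) (star B) := by
  rw [ContinuousLinearMap.star_eq_adjoint]
  symm
  rw [ContinuousLinearMap.eq_adjoint_iff]
  intro u v
  rw [blockDiag_apply, blockDiag_apply, WithLp.prod_inner_apply, WithLp.prod_inner_apply]
  simp only [ContinuousLinearMap.star_eq_adjoint, ContinuousLinearMap.adjoint_inner_left]
  rfl

/-- The flip `F (v ⊕ w) = w ⊕ v`. -/
def flip (v : Hil2 n) : Hil2 n := WithLp.toLp 2 (v.snd, v.fst)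

/-- The grading `γ (v ⊕ w) = v ⊕ (-w)`. -/
def grading (n : ℕ) : Hil2 n →L[ℂ] Hil2 n := blockDiag 1 (-1)

/-- The (unbounded, selfadjoint) operator `|D^λ| : |m⟩ ↦ λ(‖m‖₁) |m⟩` on its maximal domain. -/
def absD (n : ℕ) (lam : NNReal → NNReal) : Hil n →ₗ.[ℂ] Hil n where
  domain :=
    { carrier := {v | Memℓp (fun m : Fin n → ℕ => ((lam (∑ i, m i : ℕ) : ℝ) : ℂ) * v m) 2}
      add_mem' := fun {u v} hu hv => by
        have := hu.add hv
        refine Eq.mp (congrArg (fun f => Memℓp f 2) ?_) this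
        ext m; exact (mul_add _ _ _).symm
      zero_mem' := by
        refine Eq.mp (congrArg (fun f => Memℓp f 2) ?_) (zero_memℓp (E := fun _ : Fin n → ℕ => ℂ))
        ext m; exact (mul_zero _).symm
      smul_mem' := fun c v hv => by
        have := hv.const_smul c
        refine Eq.mp (congrArg (fun f => Memℓp f 2) ?_) this
        ext m; exact mul_left_comm _ _ _ }
  toFun :=
    { toFun := fun v => ⟨fun m => ((lam (∑ i, m i : ℕ) : ℝ) : ℂ) * v.1 m, v.2⟩
      map_add' := fun u v => by ext m; exact mul_add _ _ _
      map_smul' := fun c v => by ext m; exact mul_left_comm _ _ _ }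

/-- The Dirac operator `D^λ = (|D^λ| ⊕ |D^λ|) F`, with `F` the flip. -/
def dirac (n : ℕ) (lam : NNReal → NNReal) : Hil2 n →ₗ.[ℂ] Hil2 n where
  domain :=
    { carrier := {v | (flip v).fst ∈ (absD n lam).domain ∧ (flip v).snd ∈ (absD n lam).domain}
      add_mem' := fun hu hv => ⟨add_mem hu.1 hv.1, add_mem hu.2 hv.2⟩
      zero_mem' := ⟨zero_mem _, zero_mem _⟩
      smul_mem' := fun c _ hv => ⟨Submodule.smul_mem _ c hv.1, Submodule.smul_mem _ c hv.2⟩ }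
  toFun :=
    { toFun := fun v => WithLp.toLp 2
        (absD n lam ⟨(flip v.1).fst, v.2.1⟩, absD n lam ⟨(flip v.1).snd, v.2.2⟩)
      map_add' := fun u v => by
        rw [← WithLp.toLp_add, Prod.mk_add_mk, ← LinearPMap.map_add, ← LinearPMap.map_add]; rfl
      map_smul' := fun c v => by
        rw [RingHom.id_apply, ← WithLp.toLp_smul, Prod.smul_mk, ← LinearPMap.map_smul,
          ← LinearPMap.map_smul]; rfl }

section pi

variable {q : ℝ} (h0 : 0 < q) (h1 : q < 1) {p : Fin (n + 1) → ℕ} (hp : ∀ i, 0 < p i)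
  (hcop : Pairwise fun i j => Nat.Coprime (p i) (p j)) {r : Fin n → ℕ}
  (hr : ∀ l : Fin n, r l < p l.castSucc)

theorem inV_disjoint {j k : Fin (n + 1)} (h : j.val + 2 ≤ k.val) (m : Fin n → ℕ) (hj : InV j m) :
    ¬ InV k m := by
  intro hk
  have h2 := k.2
  have e1 := hj.2 ⟨j.val, by omega⟩ ⟨j.val + 1, by omega⟩ le_rfl (Fin.mk_lt_mk.mpr (by omega))
  have e2 := hk.1 ⟨j.val, by omega⟩ ⟨j.val + 1, by omega⟩ (Fin.mk_lt_mk.mpr (by omega))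
    (by simp only; omega)
  omega

theorem relabelOp_mul_star_ne {j k : Fin (n + 1)} (h : ∀ m, InV k m → ¬ InV j m) :
    relabelOp hp r j * star (relabelOp hp r k) = 0 := by
  apply ext_ket
  intro m
  rw [clm_mul_apply]
  by_cases hm : ∃ m', InV k m' ∧ relabel p r k m' = m
  · obtain ⟨m', hm', rfl⟩ := hm
    rw [star_relabelOp_ket hp k m' hm', relabelOp_ket, if_neg (h m' hm'), zero_smul]; rfl
  · rw [star_relabelOp_ket' hp k m hm, map_zero]; rfl

theorem repK_mul_repK {j k : Fin (n + 1)} (hjk : j ≠ k) (hpar : j.val % 2 = k.val % 2)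
    (a b : lens q (∏ i, p i) (sharp p)) :
    repK h0 h1 hp hcop hr j a * repK h0 h1 hp hcop hr k b = 0 := by
  have h : relabelOp hp r j * star (relabelOp hp r k) = 0 := by
    apply relabelOp_mul_star_ne
    intro m hk hj
    have : j.val ≠ k.val := fun h => hjk (Fin.ext h)
    rcases lt_or_gt_of_ne this with h | h
    · exact inV_disjoint (by omega) m hj hk
    · exact inV_disjoint (by omega) m hk hj
  change star (relabelOp hp r j) * sphRep h0 h1 j a * relabelOp hp r j *
    (star (relabelOp hp r k) * sphRep h0 h1 k b * relabelOp hp r k) = 0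
  calc _ = star (relabelOp hp r j) * sphRep h0 h1 j a *
        (relabelOp hp r j * star (relabelOp hp r k)) * sphRep h0 h1 k b * relabelOp hp r k := by
          simp only [mul_assoc]
    _ = 0 := by rw [h]; simp

/-- The sum of the representations `π_k^{(n)}` with `k` of parity `s`: this is `π_+` for `s = 0` and
`π_-` for `s = 1`. -/
def repPar (s : ℕ) : lens q (∏ i, p i) (sharp p) →⋆ₙₐ[ℂ] (Hil n →L[ℂ] Hil n) where
  toFun a := ∑ k : Fin (n + 1) with k.val % 2 = s, repK h0 h1 hp hcop hr k a
  map_smul' c a := by simp [Finset.smul_sum]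
  map_zero' := by simp
  map_add' a b := by simp [Finset.sum_add_distrib]
  map_mul' a b := by
    rw [Finset.sum_mul_sum]
    refine Finset.sum_congr rfl fun j hj => ?_
    rw [map_mul, Finset.sum_eq_single_of_mem j hj]
    intro k hk hkj
    simp only [Finset.mem_filter, Finset.mem_univ, true_and] at hj hk
    exact repK_mul_repK h0 h1 hp hcop hr hkj.symm (hj.trans hk.symm) a b
  map_star' a := by simp only [map_star, star_sum]

theorem wproj_le_lens {w : Fin (n + 1) → ℕ} {a : Sphere q n} (ha : a ∈ wproj q w) (N : ℕ) :
    a ∈ lens q N w := fun t _ => ha t (Set.mem_univ t)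

/-- The representation `π_+ ⊕ π_-` of `O(P_q(p^♯))`. -/
def piRep : wproj q (sharp p) →⋆ₙₐ[ℂ] (Hil2 n →L[ℂ] Hil2 n) where
  toFun a := blockDiag (repPar h0 h1 hp hcop hr 0 ⟨a, wproj_le_lens a.2 _⟩)
    (repPar h0 h1 hp hcop hr 1 ⟨a, wproj_le_lens a.2 _⟩)
  map_smul' c a := by
    rw [show (⟨(c • a : wproj q (sharp p)), wproj_le_lens (c • a).2 _⟩ :
      lens q (∏ i, p i) (sharp p)) = c • ⟨a, wproj_le_lens a.2 _⟩ from rfl, map_smul, map_smul]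
    rfl
  map_zero' := by
    rw [show (⟨((0 : wproj q (sharp p)) : Sphere q n), wproj_le_lens (0 : wproj q (sharp p)).2 _⟩ :
      lens q (∏ i, p i) (sharp p)) = 0 from rfl, map_zero, map_zero]
    rfl
  map_add' a b := by
    rw [show (⟨(a + b : wproj q (sharp p)), wproj_le_lens (a + b).2 _⟩ :
      lens q (∏ i, p i) (sharp p)) = ⟨a, wproj_le_lens a.2 _⟩ + ⟨b, wproj_le_lens b.2 _⟩ from rfl,
      map_add, map_add]
    rfl
  map_mul' a b := by
    rw [show (⟨(a * b : wproj q (sharp p)), wproj_le_lens (a * b).2 _⟩ :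
      lens q (∏ i, p i) (sharp p)) = ⟨a, wproj_le_lens a.2 _⟩ * ⟨b, wproj_le_lens b.2 _⟩ from rfl,
      map_mul, map_mul]
    rfl
  map_star' a := by
    rw [star_blockDiag, ← map_star, ← map_star]
    rfl

end pi

section triple

variable {A : Type*} [Ring A] [StarRing A] [Algebra ℂ A]
  {H : Type*} [NormedAddCommGroup H] [InnerProductSpace ℂ H] [CompleteSpace H]

/-- Even spectral triples `(A, H, π, D, γ)`: the operator `D` is densely defined and selfadjoint with
compact resolvent, every `π a` preserves the domain of `D` and has a bounded commutator with `D`, and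
`γ` is a selfadjoint unitary which commutes with every `π a`, preserves the domain of `D` and
anticommutes with `D`. The representation may be degenerate. -/
structure IsEvenSpectralTriple (π : A →⋆ₙₐ[ℂ] (H →L[ℂ] H)) (D : H →ₗ.[ℂ] H)
    (γ : H →L[ℂ] H) : Prop where
  dense_domain : Dense (D.domain : Set H)
  selfAdjoint : IsSelfAdjoint D
  compact_resolvent : ∃ R : H →L[ℂ] H, IsCompactOperator R ∧
    (∀ v : H, ∃ h : R v ∈ D.domain, D ⟨R v, h⟩ + Complex.I • R v = v) ∧
    ∀ v : D.domain, R (D v + Complex.I • (v : H)) = v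
  bounded_comm : ∀ a : A, ∃ h : ∀ v ∈ D.domain, π a v ∈ D.domain,
    ∃ C : ℝ, ∀ v : D.domain, ‖D ⟨π a v, h v v.2⟩ - π a (D v)‖ ≤ C * ‖(v : H)‖
  grading_selfAdjoint : IsSelfAdjoint γ
  grading_sq : γ * γ = 1
  grading_comm : ∀ a : A, γ * π a = π a * γ
  grading_anticomm : ∃ h : ∀ v ∈ D.domain, γ v ∈ D.domain,
    ∀ v : D.domain, D ⟨γ v, h v v.2⟩ = -γ (D v)

/-- The multiplicity of the real number `x` as an eigenvalue of `D` (zero if `x` is no eigenvalue). -/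
def eigenMult (D : H →ₗ.[ℂ] H) (x : ℝ) : ENat :=
  Cardinal.toENat (Module.rank ℂ (LinearMap.ker (D.toFun - (x : ℂ) • D.domain.subtype)))

/-- The trace of `|D|^{-s}` on the orthogonal complement of the kernel of `D`, for a selfadjoint
operator `D` with compact resolvent: the sum of `|x|^{-s}` over the nonzero eigenvalues `x` of `D`,
counted with multiplicity. -/
def zetaTrace (D : H →ₗ.[ℂ] H) (s : ℝ) : ENNReal :=
  ∑' x : {x : ℝ // x ≠ 0}, (eigenMult D x : ENNReal) * ENNReal.ofReal (|(x : ℝ)| ^ (-s))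

/-- The metric dimension of a spectral triple with operator `D` is `d`: the infimum of the `s > 0` for
which `|D|^{-s}` is of trace class on the orthogonal complement of the kernel of `D` exists and is
equal to `d`. -/
def HasMetricDimension (D : H →ₗ.[ℂ] H) (d : ℝ) : Prop :=
  IsGLB {s : ℝ | 0 < s ∧ zetaTrace D s < ⊤} d

end triple

end QWProj

end

namespace QWProj

open Finset

variable {q : ℝ} {n : ℕ}

/-! The algebraic input is that a fixed point of `U(1)` is a linear combination of words in the
`z_i`, `z_i^*` of weight zero (`wproj_le_wordSpan`). For such a word, coprimality of the `p_i` makes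
its degree in each `z_i` a multiple `p_i b_i`, and the integers `b_i` add up to zero (`mul_powDeg`,
`sum_powDeg`). In the labels `m` of `V^n_k` the word is therefore a weighted shift: it moves `m` by
a fixed integer vector, and its coefficients are at most one in absolute value
(`compress_word_ket`). The shift changes `m_1 + ... + m_n` by a constant, so a Lipschitz `λ` gives a
bounded commutator with `|D^λ|` in each `π_k` (`boundedCommutator_word`).

Since `D^λ` is off-diagonal, boundedness of its commutators also needs `|D^λ| (π_+(a) - π_-(a))` to
be bounded; this is the main point. Every label of `V^n_k` lies in exactly one of `V^n_{k-1}` and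
`V^n_{k+1}` (`ite_inV_eq`), so `π_+ - π_-` is the alternating sum of the differences `π_k - π_{k+1}`
on the intersections `V^n_k ∩ V^n_{k+1}` (`sum_telescope`). There the entry `m_{k+1}` is the largest
one. A given word is translated in the same way by both representations, unless `π_k` kills it, and
the coefficients differ by `O(q^{m_{k+1}})` (`exists_abs_compCoef_sub_le`). As `λ` grows at most
linearly on the integers, this exponential decay absorbs it (`boundedProduct_word`,
`dirac_bounded_comm`).

The rest concerns the diagonal operator `|D^λ|`. Its eigenvalues tend to infinity, so the explicit
operator `(D - i)(D^2 + 1)^{-1}` is a compact resolvent. The trace of `|D^λ|^{-s}` is twice the sum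
over all labels of the `-s`-th powers of the nonzero eigenvalues (`zetaTrace_dirac`). For `λ(t) =
t^{n/d}`, grouping labels by their sum `N`, with about `N^{n-1}` labels each, leaves a series which
converges exactly when `s > d`. -/

/-! ### Words in the generators and the invariants of the circle action -/

/-- The product of the generators along a word. -/
noncomputable def Sphere.word (L : List (Fin (n + 1) × Bool)) : Sphere q n := (L.map Sphere.gen).prod

/-- The degree of a letter in the generator `z_i`: it is `1` for `z_i` and `-1` for `z_i^*`. -/
def letterDeg (x : Fin (n + 1) × Bool) (i : Fin (n + 1)) : ℤ :=
  if x.1 = i then (if x.2 then -1 else 1) else 0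

/-- The degree of a word in the generator `z_i`. -/
def wordDeg (L : List (Fin (n + 1) × Bool)) (i : Fin (n + 1)) : ℤ :=
  (L.map fun x => letterDeg x i).sum

/-- The weight of a word under the circle action with weights `w`. -/
def wordWeight (w : Fin (n + 1) → ℕ) (L : List (Fin (n + 1) × Bool)) : ℤ :=
  ∑ i, (w i : ℤ) * wordDeg L i

theorem wordDeg_cons (x : Fin (n + 1) × Bool) (L : List (Fin (n + 1) × Bool)) (i : Fin (n + 1)) :
    wordDeg (x :: L) i = letterDeg x i + wordDeg L i := by simp [wordDeg]

theorem wordWeight_cons (w : Fin (n + 1) → ℕ) (x : Fin (n + 1) × Bool)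
    (L : List (Fin (n + 1) × Bool)) :
    wordWeight w (x :: L) = (w x.1 : ℤ) * (if x.2 then -1 else 1) + wordWeight w L := by
  simp [wordWeight, wordDeg_cons, mul_add, sum_add_distrib, letterDeg]

theorem Sphere.word_cons (x : Fin (n + 1) × Bool) (L : List (Fin (n + 1) × Bool)) :
    (Sphere.word (x :: L) : Sphere q n) = Sphere.gen x * Sphere.word L := by simp [Sphere.word]

theorem Sphere.mem_span_word (a : Sphere q n) :
    a ∈ Submodule.span ℂ (Set.range (Sphere.word : _ → Sphere q n)) := by
  induction a using Sphere.induct with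
  | halg c =>
    rw [Algebra.algebraMap_eq_smul_one]
    exact Submodule.smul_mem _ _ (Submodule.subset_span ⟨[], by simp [Sphere.word]⟩)
  | hgen x => exact Submodule.subset_span ⟨[x], by simp [Sphere.word]⟩
  | hadd a b ha hb => exact add_mem ha hb
  | hmul a b ha hb =>
    have h := Submodule.mul_mem_mul ha hb
    rw [Submodule.span_mul_span] at h
    refine Submodule.span_mono ?_ h
    rintro _ ⟨_, ⟨L, rfl⟩, _, ⟨M, rfl⟩, rfl⟩
    exact ⟨L ++ M, by simp [Sphere.word]⟩

theorem Sphere.act_gen (w : Fin (n + 1) → ℕ) (t : Circle) (x : Fin (n + 1) × Bool) :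
    act w t (gen x : Sphere q n) = ((t : ℂ) ^ ((w x.1 : ℤ) * if x.2 then -1 else 1)) • gen x := by
  obtain ⟨i, b⟩ := x
  cases b with
  | false =>
    change act w t (z i) = _ • z i
    simpa using act_z w t i
  | true =>
    rw [← star_z, map_star, act_z, star_smul, star_z]
    have h : star ((t : ℂ) ^ w i) = ((t : ℂ) ^ w i)⁻¹ :=
      eq_inv_of_mul_eq_one_left (circle_star_mul t (w i))
    rw [h]
    simp

theorem Sphere.act_word (w : Fin (n + 1) → ℕ) (t : Circle) (L : List (Fin (n + 1) × Bool)) :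
    act w t (word L : Sphere q n) = ((t : ℂ) ^ wordWeight w L) • word L := by
  induction L with
  | nil => simp [word, wordWeight, wordDeg]
  | cons x L ih =>
    rw [word_cons, map_mul, ih, act_gen, wordWeight_cons, zpow_add₀ (Circle.coe_ne_zero t),
      smul_mul_smul_comm]

/-- The span of the words of weight zero. -/
def wordSpan (q : ℝ) (w : Fin (n + 1) → ℕ) : Submodule ℂ (Sphere q n) :=
  Submodule.span ℂ (Sphere.word '' {L | wordWeight w L = 0})

/-- Averaging over sufficiently many roots of unity projects to the words of weight zero. -/
theorem exists_sum_act_mem (w : Fin (n + 1) → ℕ) (a : Sphere q n) :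
    ∃ M : ℕ, ∀ N > M, ∀ t : Circle, IsPrimitiveRoot (t : ℂ) N →
      ∑ j ∈ range N, Sphere.act w (t ^ j) a ∈ wordSpan q w := by
  induction Sphere.mem_span_word a using Submodule.span_induction with
  | mem a ha =>
    obtain ⟨L, rfl⟩ := ha
    -- An `N` exceeding the absolute value of a nonzero weight does not divide it, so the geometric
    -- sum over the roots of unity vanishes.
    refine ⟨(wordWeight w L).natAbs, fun N hN t ht => ?_⟩
    by_cases h : wordWeight w L = 0
    · refine sum_mem fun j _ => ?_
      rw [Sphere.act_word, h, zpow_zero, one_smul]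
      exact Submodule.subset_span ⟨L, h, rfl⟩
    · have h1 : (t : ℂ) ^ wordWeight w L ≠ 1 := by
        rw [Ne, ht.zpow_eq_one_iff_dvd]
        intro hd
        have := Nat.le_of_dvd (Int.natAbs_pos.mpr h) (Int.natCast_dvd.mp hd)
        omega
      have h2 : ∑ j ∈ range N, ((t : ℂ) ^ wordWeight w L) ^ j = 0 := by
        rw [geom_sum_eq h1, ← zpow_natCast, zpow_comm, zpow_natCast, ht.pow_eq_one, one_zpow]
        simp
      have h3 : ∑ j ∈ range N, Sphere.act w (t ^ j) (Sphere.word L : Sphere q n) = 0 := by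
        have : ∀ j, Sphere.act w (t ^ j) (Sphere.word L : Sphere q n) =
            (((t : ℂ) ^ wordWeight w L) ^ j) • Sphere.word L := fun j => by
          rw [Sphere.act_word, Circle.coe_pow, ← zpow_natCast, ← zpow_natCast, zpow_comm]
        simp only [this, ← sum_smul, h2, zero_smul]
      rw [h3]
      exact zero_mem _
  | zero => exact ⟨0, fun N _ t _ => by simp⟩
  | add a b _ _ ha hb =>
    obtain ⟨M, hM⟩ := ha
    obtain ⟨M', hM'⟩ := hb
    refine ⟨max M M', fun N hN t ht => ?_⟩
    simp only [map_add, sum_add_distrib]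
    exact add_mem (hM N (lt_of_le_of_lt (le_max_left _ _) hN) t ht)
      (hM' N (lt_of_le_of_lt (le_max_right _ _) hN) t ht)
  | smul c a _ ha =>
    obtain ⟨M, hM⟩ := ha
    refine ⟨M, fun N hN t ht => ?_⟩
    simp only [map_smul, ← smul_sum]
    exact Submodule.smul_mem _ _ (hM N hN t ht)

/-- Every term of the average of a fixed element is that element, so the sum in `exists_sum_act_mem`
is `N • a`. -/
theorem wproj_le_wordSpan (w : Fin (n + 1) → ℕ) {a : Sphere q n} (ha : a ∈ wproj q w) :
    a ∈ wordSpan q w := by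
  obtain ⟨M, hM⟩ := exists_sum_act_mem w a
  set N := M + 1 with hN
  have hN0 : (N : ℂ) ≠ 0 := by exact_mod_cast (Nat.succ_ne_zero M)
  have htC : (Circle.exp (2 * Real.pi / N) : ℂ) = Complex.exp (2 * Real.pi * Complex.I / N) := by
    rw [Circle.coe_exp]; congr 1; push_cast; ring
  have hprim : IsPrimitiveRoot (Circle.exp (2 * Real.pi / N) : ℂ) N :=
    htC ▸ Complex.isPrimitiveRoot_exp N (Nat.succ_ne_zero M)
  have h := hM N (by omega) _ hprim
  rw [sum_congr rfl (fun j _ => ha _ (Set.mem_univ _)), sum_const, card_range,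
    ← Nat.cast_smul_eq_nsmul ℂ] at h
  have h2 := Submodule.smul_mem _ (N : ℂ)⁻¹ h
  rwa [smul_smul, inv_mul_cancel₀ hN0, one_smul] at h2

/-! ### The action of words on basis vectors -/

/-- The label to which the letter `x` moves the label `j` in the representation `sphRep k`. -/
def letterMove (k : ℕ) (x : Fin (n + 1) × Bool) (j : Fin n → ℕ) : Fin n → ℕ := fun l =>
  if l.val < k ∧ x.1 = l.castSucc then (if x.2 then j l - 1 else j l + 1) else j l

/-- The coefficient of the letter `x` on the basis vector `|j⟩` in the representation `sphRep k`. -/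
noncomputable def letterCoef (q : ℝ) (k : ℕ) (x : Fin (n + 1) × Bool) (j : Fin n → ℕ) : ℝ :=
  if x.1.val < k then q ^ psum j x.1 *
    √(1 - q ^ (2 * (psum j (x.1 + 1) - psum j x.1 + if x.2 then 0 else 1)))
  else if x.1.val = k then q ^ psum j k else 0

/-- The label to which the word `L` moves the label `j`. -/
def wordMove (k : ℕ) (L : List (Fin (n + 1) × Bool)) (j : Fin n → ℕ) : Fin n → ℕ :=
  L.foldr (letterMove k) j

/-- The coefficient of the word `L` on the basis vector `|j⟩`. -/
noncomputable def wordCoef (q : ℝ) (k : ℕ) : List (Fin (n + 1) × Bool) → (Fin n → ℕ) → ℝ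
  | [], _ => 1
  | x :: L, j => letterCoef q k x (wordMove k L j) * wordCoef q k L j

theorem sphRep_gen_ket (h0 : 0 < q) (h1 : q < 1) (k : Fin (n + 1)) (x : Fin (n + 1) × Bool)
    (j : Fin n → ℕ) :
    sphRep h0 h1 k (Sphere.gen x) (ket j) =
      (letterCoef q k x j : ℂ) • ket (letterMove k x j) := by
  obtain ⟨i, b⟩ := x
  by_cases h : i < k
  · obtain ⟨l, rfl⟩ : ∃ l : Fin n, i = l.castSucc :=
      ⟨⟨i, by have := k.2; have := Fin.lt_def.mp h; omega⟩, rfl⟩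
    have hl : l.val < k.val := h
    have hg : sphGen (n := n) h0 h1 k l.castSucc = up h0 h1 l := dif_pos h
    have hps := psum_succ j l
    -- `letterCoef` reads the entry as a difference of partial sums, because its letter is indexed
    -- by `Fin (n + 1)` and the label by `Fin n`.
    have hps' : psum j (l + 1) - psum j l = j l := by omega
    cases b with
    | false =>
      change sphRep h0 h1 k (Sphere.z l.castSucc) (ket j) = _
      rw [sphRep_z, hg, up_ket]
      have : letterMove k (l.castSucc, false) j = j + Pi.single l 1 := by
        ext t
        by_cases ht : t = l
        · subst ht; simp [letterMove, hl]
        · simp [letterMove, Ne.symm ht]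
      simp [letterCoef, hl, hps', this]
    | true =>
      rw [← Sphere.star_z, map_star, sphRep_z, hg, star_up_ket]
      have : letterMove k (l.castSucc, true) j = j - Pi.single l 1 := by
        ext t
        by_cases ht : t = l
        · subst ht; simp [letterMove, hl]
        · simp [letterMove, Ne.symm ht]
      simp [letterCoef, hl, hps', this]
  · have hm : letterMove k (i, b) j = j := by
      ext t
      rw [letterMove, if_neg]
      rintro ⟨h2, h3⟩
      exact h (by rw [show i = t.castSucc from h3]; exact h2)
    have hi : ¬ i.val < k.val := h
    by_cases h' : i = k
    · subst h'
      have hg : sphGen (n := n) h0 h1 i i = dg h0 h1 i := by simp [sphGen]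
      have hc : letterCoef q i (i, b) j = q ^ psum j i := by simp [letterCoef]
      cases b with
      | false =>
        change sphRep h0 h1 i (Sphere.z i) (ket j) = _
        rw [sphRep_z, hg, dg_ket, hc, hm]
      | true =>
        rw [← Sphere.star_z, map_star, sphRep_z, hg, dg_star, dg_ket, hc, hm]
    · have hg : sphGen (n := n) h0 h1 k i = 0 := by simp [sphGen, h, h']
      have hc : letterCoef q k (i, b) j = 0 := by
        simp [letterCoef, hi, show i.val ≠ k.val from fun h => h' (Fin.ext h)]
      cases b with
      | false =>
        change sphRep h0 h1 k (Sphere.z i) (ket j) = _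
        rw [sphRep_z, hg, hc]; simp
      | true =>
        rw [← Sphere.star_z, map_star, sphRep_z, hg, hc]; simp

theorem sphRep_word_ket (h0 : 0 < q) (h1 : q < 1) (k : Fin (n + 1))
    (L : List (Fin (n + 1) × Bool)) (j : Fin n → ℕ) :
    sphRep h0 h1 k (Sphere.word L) (ket j) = (wordCoef q k L j : ℂ) • ket (wordMove k L j) := by
  induction L with
  | nil => simp [Sphere.word, wordCoef, wordMove]
  | cons x L ih =>
    rw [Sphere.word_cons, map_mul, clm_mul_apply, ih, map_smul, sphRep_gen_ket, smul_smul]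
    simp [wordCoef, wordMove, mul_comm]

theorem letterCoef_nonneg (h0 : 0 < q) (k : ℕ) (x : Fin (n + 1) × Bool) (j : Fin n → ℕ) :
    0 ≤ letterCoef q k x j := by
  unfold letterCoef
  split_ifs <;> positivity

theorem letterCoef_le_one (h0 : 0 < q) (h1 : q < 1) (k : ℕ) (x : Fin (n + 1) × Bool)
    (j : Fin n → ℕ) : letterCoef q k x j ≤ 1 := by
  by_cases h : x.1.val < k
  · rw [letterCoef, if_pos h]
    have := pow_mul_sqrt_le h0 h1 (psum j x.1)
      (2 * (psum j (x.1 + 1) - psum j x.1 + if x.2 then 0 else 1))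
    rwa [Complex.norm_real, Real.norm_of_nonneg (by positivity)] at this
  · rw [letterCoef, if_neg h]
    split_ifs
    · exact pow_le_one₀ h0.le h1.le
    · exact zero_le_one

theorem wordCoef_nonneg (h0 : 0 < q) (k : ℕ) (L : List (Fin (n + 1) × Bool)) (j : Fin n → ℕ) :
    0 ≤ wordCoef q k L j := by
  induction L with
  | nil => exact zero_le_one
  | cons x L ih => exact mul_nonneg (letterCoef_nonneg h0 _ _ _) ih

theorem wordCoef_le_one (h0 : 0 < q) (h1 : q < 1) (k : ℕ) (L : List (Fin (n + 1) × Bool))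
    (j : Fin n → ℕ) : wordCoef q k L j ≤ 1 := by
  induction L with
  | nil => exact le_rfl
  | cons x L ih =>
    exact mul_le_one₀ (letterCoef_le_one h0 h1 _ _ _) (wordCoef_nonneg h0 _ _ _) ih

theorem psum_le_letterMove (k : ℕ) (x : Fin (n + 1) × Bool) (j : Fin n → ℕ) (i : ℕ) :
    psum j i ≤ psum (letterMove k x j) i + 1 := by
  have h1 : ∀ t : Fin n, j t ≤ letterMove k x j t + if x.1 = t.castSucc then 1 else 0 := by
    intro t
    unfold letterMove
    by_cases ht : x.1 = t.castSucc
    · simp only [ht, and_true, if_true]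
      split_ifs <;> omega
    · simp [ht]
  have h2 : ∑ t : Fin n with t.val < i, (if x.1 = t.castSucc then 1 else 0) ≤ 1 := by
    rw [sum_boole, Nat.cast_id, card_le_one]
    intro a ha b hb
    simp only [mem_filter] at ha hb
    exact Fin.castSucc_injective _ (ha.2.symm.trans hb.2)
  calc psum j i ≤ ∑ t : Fin n with t.val < i,
        (letterMove k x j t + if x.1 = t.castSucc then 1 else 0) := sum_le_sum fun t _ => h1 t
    _ ≤ _ := by rw [sum_add_distrib]; exact Nat.add_le_add_left h2 _

/-- One letter lowers at most one entry, by at most one. Hence a bound by a power of `q` at the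
moved label costs only the factor `q^{-length}` at the original one. -/
theorem psum_le_wordMove (k : ℕ) (L : List (Fin (n + 1) × Bool)) (j : Fin n → ℕ) (i : ℕ) :
    psum j i ≤ psum (wordMove k L j) i + L.length := by
  induction L with
  | nil => simp [wordMove]
  | cons x L ih =>
    have := psum_le_letterMove k x (wordMove k L j) i
    change psum j i ≤ psum (letterMove k x (wordMove k L j)) i + (L.length + 1)
    omega

/-- The truncated subtraction in `letterMove` is harmless: `z_i^*` acts on a zero entry with
coefficient `√(1 - q^0) = 0`, so a nonzero coefficient means that no truncation occurred. -/
theorem wordMove_of_ne_zero (k : ℕ) (L : List (Fin (n + 1) × Bool)) (j : Fin n → ℕ)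
    (h : wordCoef q k L j ≠ 0) (l : Fin n) :
    (wordMove k L j l : ℤ) = j l + if l.val < k then wordDeg L l.castSucc else 0 := by
  induction L with
  | nil => simp [wordMove, wordDeg]
  | cons x L ih =>
    have hx : letterCoef q k x (wordMove k L j) ≠ 0 := left_ne_zero_of_mul h
    have ih := ih (right_ne_zero_of_mul h)
    change (letterMove k x (wordMove k L j) l : ℤ) = _
    set j' := wordMove k L j
    rw [wordDeg_cons]
    by_cases hl : l.val < k
    · rw [if_pos hl] at ih ⊢
      obtain ⟨i, b⟩ := x
      by_cases hi : i = l.castSucc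
      · subst hi
        cases b with
        | false => simp [letterMove, letterDeg, hl, ih]; ring
        | true =>
          have hps := psum_succ j' l
          have hj : j' l ≠ 0 := by
            intro h0
            apply hx
            have : psum j' (l + 1) - psum j' l = 0 := by omega
            simp [letterCoef, hl, this]
          have : ((j' l - 1 : ℕ) : ℤ) = j' l - 1 := by omega
          simp [letterMove, letterDeg, hl, this, ih]; ring
      · simp [letterMove, letterDeg, hi, ih]
    · rw [if_neg hl] at ih ⊢
      simp [letterMove, hl, ih]

theorem wordCoef_eq_zero (k : ℕ) (L : List (Fin (n + 1) × Bool)) (j : Fin n → ℕ)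
    (x : Fin (n + 1) × Bool) (hx : x ∈ L) (hk : k < x.1.val) : wordCoef q k L j = 0 := by
  induction L with
  | nil => simp at hx
  | cons y L ih =>
    rcases List.mem_cons.mp hx with rfl | h
    · rw [wordCoef, letterCoef, if_neg (by omega), if_neg (by omega), zero_mul]
    · rw [wordCoef, ih h, mul_zero]

theorem wordDeg_eq_zero {L : List (Fin (n + 1) × Bool)} {i : Fin (n + 1)}
    (h : ∀ x ∈ L, x.1 ≠ i) : wordDeg L i = 0 := by
  apply List.sum_eq_zero
  intro d hd
  obtain ⟨x, hx, rfl⟩ := List.mem_map.mp hd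
  simp [letterDeg, h x hx]

theorem psum_congr {j j' : Fin n → ℕ} {i : ℕ} (h : ∀ l : Fin n, l.val < i → j l = j' l) :
    psum j i = psum j' i :=
  sum_congr rfl fun t ht => h t (mem_filter.mp ht).2

theorem wordMove_agree (k : ℕ) (L : List (Fin (n + 1) × Bool)) {j j' : Fin n → ℕ}
    (h : ∀ l : Fin n, l.val < k → j l = j' l) (l : Fin n) (hl : l.val < k) :
    wordMove k L j l = wordMove (k + 1) L j' l := by
  induction L with
  | nil => exact h l hl
  | cons x L ih =>
    change letterMove k x (wordMove k L j) l = letterMove (k + 1) x (wordMove (k + 1) L j') l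
    simp [letterMove, hl, ih, Nat.lt_succ_of_lt hl]

theorem one_sub_sqrt_one_sub_le {y : ℝ} (hy0 : 0 ≤ y) (hy1 : y ≤ 1) : 1 - √(1 - y) ≤ y := by
  have : 1 - y ≤ √(1 - y) := Real.le_sqrt_of_sq_le (by nlinarith)
  linarith

/-- The letters of two consecutive representations differ by little on labels with a large entry. -/
theorem abs_letterCoef_sub_le (h0 : 0 < q) (h1 : q < 1) {k : ℕ} (hk : k < n)
    (x : Fin (n + 1) × Bool) {j j' : Fin n → ℕ} (h : ∀ l : Fin n, l.val < k → j l = j' l) :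
    |letterCoef q k x j - letterCoef q (k + 1) x j'| ≤ q ^ psum j' (k + 1) := by
  have hpos : 0 < q ^ psum j' (k + 1) := by positivity
  have hps : ∀ i ≤ k, psum j i = psum j' i := fun i hi => psum_congr fun l hl => h l (by omega)
  rcases lt_trichotomy x.1.val k with hx | hx | hx
  · simp only [letterCoef, hx, Nat.lt_succ_of_lt hx, if_true, hps _ hx.le, hps _ hx, sub_self,
      abs_zero]
    exact hpos.le
  · simp only [letterCoef, hx, lt_irrefl, if_false, if_true, Nat.lt_succ_self, hps k le_rfl]
    have hk' := psum_succ j' ⟨k, hk⟩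
    simp only at hk'
    set e := psum j' (k + 1) - psum j' k + if x.2 then 0 else 1
    -- For `i = k` the diagonal generator `q^{j_1 + ... + j_k}` is compared with a shift carrying
    -- the extra factor `√(1 - q^{2e})`. Here `e` is the next entry or one more than it, so `q^{2e}`
    -- supplies the missing power.
    have he : psum j' (k + 1) ≤ psum j' k + 2 * e := by omega
    have hy1 : q ^ (2 * e) ≤ 1 := pow_le_one₀ h0.le h1.le
    have hs := one_sub_sqrt_one_sub_le (by positivity) hy1
    have hs1 : √(1 - q ^ (2 * e)) ≤ 1 :=
      Real.sqrt_le_one.mpr (by linarith [show 0 ≤ q ^ (2 * e) by positivity])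
    have hp : 0 < q ^ psum j' k := by positivity
    rw [abs_of_nonneg (by nlinarith)]
    calc q ^ psum j' k - q ^ psum j' k * √(1 - q ^ (2 * e))
        = q ^ psum j' k * (1 - √(1 - q ^ (2 * e))) := by ring
      _ ≤ q ^ psum j' k * q ^ (2 * e) := mul_le_mul_of_nonneg_left hs hp.le
      _ = q ^ (psum j' k + 2 * e) := (pow_add _ _ _).symm
      _ ≤ _ := pow_le_pow_of_le_one h0.le h1.le he
  -- The smaller representation kills the letter; the larger one does too, unless the index is `k +
  -- 1`, where the coefficient equals the bound.
  · simp only [letterCoef, not_lt.mpr hx.le, hx.ne', if_false,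
      show ¬ x.1.val < k + 1 by omega]
    split_ifs
    · rw [zero_sub, abs_neg, abs_of_pos hpos]
    · simpa using hpos.le

/-- Induction with `a b - a' b' = (a - a') b + a' (b - b')`, all factors being at most one in
absolute value. Each letter adds its own error, taken at the label moved by the letters to its
right. -/
theorem exists_abs_wordCoef_sub_le (h0 : 0 < q) (h1 : q < 1) (L : List (Fin (n + 1) × Bool)) :
    ∃ C : ℝ, ∀ k < n, ∀ j j' : Fin n → ℕ, (∀ l : Fin n, l.val < k → j l = j' l) →
      |wordCoef q k L j - wordCoef q (k + 1) L j'| ≤ C * q ^ psum j' (k + 1) := by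
  induction L with
  | nil => exact ⟨0, fun k _ j j' _ => by simp [wordCoef]⟩
  | cons x L ih =>
    obtain ⟨C, hC⟩ := ih
    -- The first summand pays for the partial sum having dropped by up to the length of the tail
    -- before the new letter acts.
    refine ⟨(q ^ L.length)⁻¹ + C, fun k hk j j' h => ?_⟩
    have hl := abs_letterCoef_sub_le h0 h1 hk x (j := wordMove k L j)
      (j' := wordMove (k + 1) L j') (wordMove_agree k L h)
    have hm := psum_le_wordMove (k + 1) L j' (k + 1)
    have hw := hC k hk j j' h
    have hb : q ^ psum (wordMove (k + 1) L j') (k + 1) ≤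
        (q ^ L.length)⁻¹ * q ^ psum j' (k + 1) := by
      rw [inv_mul_eq_div, le_div_iff₀ (by positivity), ← pow_add]
      exact pow_le_pow_of_le_one h0.le h1.le hm
    simp only [wordCoef]
    set a := letterCoef q k x (wordMove k L j)
    set a' := letterCoef q (k + 1) x (wordMove (k + 1) L j')
    set b := wordCoef q k L j
    set b' := wordCoef q (k + 1) L j'
    have hb1 : |b| ≤ 1 := by
      rw [abs_of_nonneg (wordCoef_nonneg h0 _ _ _)]; exact wordCoef_le_one h0 h1 _ _ _
    have ha1 : |a'| ≤ 1 := by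
      rw [abs_of_nonneg (letterCoef_nonneg h0 _ _ _)]; exact letterCoef_le_one h0 h1 _ _ _
    calc |a * b - a' * b'| = |(a - a') * b + a' * (b - b')| := by ring_nf
      _ ≤ |a - a'| * |b| + |a'| * |b - b'| := by
        rw [← abs_mul, ← abs_mul]; exact abs_add_le _ _
      _ ≤ |a - a'| * 1 + 1 * |b - b'| := by gcongr
      _ ≤ _ := by linarith

/-! ### Words of weight zero after the relabelling -/

/-- The degree of a word in `z_i^{p_i}`. -/
def powDeg (p : Fin (n + 1) → ℕ) (L : List (Fin (n + 1) × Bool)) (i : Fin (n + 1)) : ℤ :=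
  wordDeg L i / p i

/-- The translation of the labels by a word of weight zero. -/
def labelShift (p : Fin (n + 1) → ℕ) (k : ℕ) (L : List (Fin (n + 1) × Bool)) (l : Fin n) : ℤ :=
  if l.val < k then ∑ t : Fin (n + 1) with t.val < l.val + 1, powDeg p L t else 0

/-- The label to which the word `L` moves the label `m` in the representation `π_k`. -/
def compMove (p : Fin (n + 1) → ℕ) (k : ℕ) (L : List (Fin (n + 1) × Bool)) (m : Fin n → ℕ) :
    Fin n → ℕ := fun l => (m l + labelShift p k L l).toNat

open Classical in
/-- The coefficient of the word `L` on the basis vector `|m⟩` in the representation `π_k`. -/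
noncomputable def compCoef (q : ℝ) (p : Fin (n + 1) → ℕ) (r : Fin n → ℕ) (k : Fin (n + 1))
    (L : List (Fin (n + 1) × Bool)) (m : Fin n → ℕ) : ℝ :=
  if InV k m then wordCoef q k L (relabel p r k m) else 0

/-! ### Divisibility of the degrees of words of weight zero. -/

section weight

variable {p : Fin (n + 1) → ℕ} {L : List (Fin (n + 1) × Bool)}

/-- All weights `sharp p j` with `j ≠ i` are divisible by `p i`, so vanishing weight forces `p i` to
divide `sharp p i` times the degree; and `sharp p i` is coprime to `p i`. Thus the integer division
in `powDeg` is exact. -/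
theorem mul_powDeg (hcop : Pairwise fun i j => Nat.Coprime (p i) (p j))
    (hL : wordWeight (sharp p) L = 0) (i : Fin (n + 1)) :
    (p i : ℤ) * powDeg p L i = wordDeg L i := by
  apply Int.mul_ediv_cancel'
  have h1 : (p i : ℤ) ∣ (sharp p i : ℤ) * wordDeg L i := by
    have h2 : (sharp p i : ℤ) * wordDeg L i =
        -∑ j ∈ univ.erase i, (sharp p j : ℤ) * wordDeg L j := by
      rw [eq_neg_iff_add_eq_zero, add_sum_erase _ (fun j => (sharp p j : ℤ) * wordDeg L j)
        (mem_univ i)]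
      exact hL
    rw [h2, dvd_neg]
    exact dvd_sum fun j hj => Dvd.dvd.mul_right
      (Int.natCast_dvd_natCast.mpr (dvd_sharp p (ne_of_mem_erase hj))) _
  exact IsCoprime.dvd_of_dvd_mul_left (Nat.isCoprime_iff_coprime.mpr (coprime_sharp hcop i).symm) h1

/-- Since `sharp p i * p i` is the product of all `p j` for every `i`, the weight is that product
times this sum. -/
theorem sum_powDeg (hp : ∀ i, 0 < p i) (hcop : Pairwise fun i j => Nat.Coprime (p i) (p j))
    (hL : wordWeight (sharp p) L = 0) : ∑ i, powDeg p L i = 0 := by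
  have h1 : ∀ i, (sharp p i : ℤ) * wordDeg L i = (∏ j, p j : ℕ) * powDeg p L i := fun i => by
    rw [← mul_powDeg hcop hL i, ← mul_assoc, ← Nat.cast_mul, sharp,
      prod_erase_mul _ _ (mem_univ i)]
  have h2 : ((∏ j, p j : ℕ) : ℤ) * ∑ i, powDeg p L i = 0 := by
    rw [mul_sum, ← sum_congr rfl fun i _ => h1 i]
    exact hL
  refine (mul_eq_zero.mp h2).resolve_left ?_
  exact_mod_cast (prod_pos fun i _ => hp i).ne'

theorem powDeg_eq_zero {i : Fin (n + 1)} (h : ∀ x ∈ L, x.1 ≠ i) : powDeg p L i = 0 := by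
  rw [powDeg, wordDeg_eq_zero h, Int.zero_ediv]

/-- The two shifts can differ only in place `k`. There the larger one is the sum of all `powDeg`, as
no generator with index above `k` occurs, and this sum is zero. -/
theorem labelShift_succ (hp : ∀ i, 0 < p i) (hcop : Pairwise fun i j => Nat.Coprime (p i) (p j))
    (hL : wordWeight (sharp p) L = 0) {k : ℕ} (h : ∀ x ∈ L, x.1.val ≤ k) :
    labelShift p (k + 1) L = labelShift p k L := by
  ext l
  unfold labelShift
  rcases lt_trichotomy l.val k with hl | hl | hl
  · rw [if_pos hl, if_pos (by omega)]
  · rw [if_pos (by omega), if_neg (by omega), ← sum_powDeg hp hcop hL]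
    refine sum_subset (filter_subset _ _) fun t _ ht => powDeg_eq_zero fun x hx hxt => ht ?_
    have := h x hx
    rw [hxt] at this
    simp only [mem_filter, mem_univ, true_and]
    omega
  · rw [if_neg (by omega), if_neg (by omega)]

end weight

section prev

theorem prev_zero (m : Fin n → ℕ) {l : Fin n} (h : l.val = 0) : prev m l = 0 := by simp [prev, h]

theorem prev_succ (m : Fin n → ℕ) {a : ℕ} (ha : a + 1 < n) :
    prev m ⟨a + 1, ha⟩ = m ⟨a, by omega⟩ := by simp [prev]

theorem relabel_cast {p : Fin (n + 1) → ℕ} {r : Fin n → ℕ} {k : Fin (n + 1)} {m : Fin n → ℕ}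
    (hm : InV k m) (l : Fin n) (hl : l.val < k.val) :
    (relabel p r k m l : ℤ) = p l.castSucc * (m l - prev m l : ℤ) + r l := by
  rw [relabel, if_pos hl]
  push_cast [Nat.cast_sub (prev_le hm l hl)]
  rfl

/-- Each relabelled entry is at least the increment `m_i - m_{i-1}` because `p ≥ 1`, and the
increments telescope. This turns decay in the relabelled partial sums into decay in an entry of `m`.
-/
theorem le_psum_relabel {p : Fin (n + 1) → ℕ} (hp : ∀ i, 0 < p i) {r : Fin n → ℕ}
    (k : Fin (n + 1)) (m : Fin n → ℕ) (l : Fin n) (hl : l.val < k.val) :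
    m l ≤ psum (relabel p r k m) (l.val + 1) := by
  obtain ⟨a, ha⟩ := l
  have key : ∀ l : Fin n, l.val < k.val → m l ≤ prev m l + relabel p r k m l := fun l hl => by
    rw [relabel, if_pos hl]
    have := Nat.le_mul_of_pos_left (m l - prev m l) (hp l.castSucc)
    omega
  induction a with
  | zero =>
    have h1 := key ⟨0, ha⟩ hl
    rw [prev_zero m rfl] at h1
    rw [psum_succ _ ⟨0, ha⟩]
    omega
  | succ a ih =>
    have h1 := key ⟨a + 1, ha⟩ hl
    rw [prev_succ] at h1
    have h2 := ih (by omega) (Nat.lt_of_succ_lt hl)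
    rw [psum_succ _ ⟨a + 1, ha⟩]
    simp only at h2 ⊢
    omega

end prev

/-! ### Words of weight zero in the representations `π_k`. -/

section compress

variable {p : Fin (n + 1) → ℕ} {r : Fin n → ℕ} {L : List (Fin (n + 1) × Bool)}

/-- A word of weight zero moves labels in the image of `V^n_k` under the relabelling to such
labels. -/
theorem exists_relabel_wordMove (hr : ∀ l : Fin n, r l < p l.castSucc)
    (hcop : Pairwise fun i j => Nat.Coprime (p i) (p j)) (hL : wordWeight (sharp p) L = 0)
    (k : Fin (n + 1)) {m : Fin n → ℕ} (hm : InV k m)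
    (h : wordCoef q k L (relabel p r k m) ≠ 0) :
    ∃ m', InV k m' ∧ relabel p r k m' = wordMove k L (relabel p r k m) ∧
      ∀ l, (m' l : ℤ) = m l + labelShift p k L l := by
  have hw := wordMove_of_ne_zero k L _ h
  obtain ⟨hres, hdec⟩ := (exists_relabel_iff hr k _).mp ⟨m, hm, rfl⟩
  have hex : ∃ m', InV k m' ∧ relabel p r k m' = wordMove k L (relabel p r k m) := by
    -- The first labels move by multiples of the `p_i`, which keeps their residues, and the labels
    -- from place `k` on do not move.
    rw [exists_relabel_iff hr]
    constructor
    · intro l hl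
      have h1 := hw l
      rw [if_pos hl, ← mul_powDeg hcop hL] at h1
      refine Nat.ModEq.trans ?_ (hres l hl)
      rw [← Int.natCast_modEq_iff, h1]
      simp [Int.ModEq]
    · intro a b ha hab
      have h1 := hw a
      have h2 := hw b
      have := Fin.lt_def.mp hab
      rw [if_neg (by omega), add_zero, Nat.cast_inj] at h1 h2
      rw [h1, h2]
      exact hdec a b ha hab
  obtain ⟨m', hm', heq⟩ := hex
  refine ⟨m', hm', heq, ?_⟩
  -- Each increment of `m` changes by one `powDeg`; summing the increments gives the partial sums in
  -- `labelShift`.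
  have key : ∀ l : Fin n, l.val < k.val →
      (m' l : ℤ) - prev m' l = m l - prev m l + powDeg p L l.castSucc := by
    intro l hl
    have h1 := hw l
    rw [← heq, if_pos hl, ← mul_powDeg hcop hL, relabel_cast hm l hl, relabel_cast hm' l hl] at h1
    have hpl : (p l.castSucc : ℤ) ≠ 0 := by exact_mod_cast (lt_of_le_of_lt (Nat.zero_le _) (hr l)).ne'
    apply mul_left_cancel₀ hpl
    linarith
  have hsum : ∀ a : ℕ, ∀ ha : a < n + 1, ∑ t : Fin (n + 1) with t.val < a + 1, powDeg p L t =
      ∑ t : Fin (n + 1) with t.val < a, powDeg p L t + powDeg p L ⟨a, ha⟩ := by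
    intro a ha
    have : (univ.filter fun t : Fin (n + 1) => t.val < a + 1) =
        insert ⟨a, ha⟩ (univ.filter fun t : Fin (n + 1) => t.val < a) := by
      ext t; simp [Fin.ext_iff]; omega
    rw [this, sum_insert (by simp), add_comm]
  rintro ⟨a, ha⟩
  by_cases hl : a < k.val
  · rw [labelShift, if_pos hl]
    induction a with
    | zero =>
      have h1 := key ⟨0, ha⟩ hl
      rw [prev_zero m rfl, prev_zero m' rfl] at h1
      rw [hsum 0 (by omega)]
      simpa using h1
    | succ a ih =>
      have h1 := key ⟨a + 1, ha⟩ hl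
      have h2 := ih (by omega) (by omega)
      rw [prev_succ, prev_succ] at h1
      rw [hsum (a + 1) (by omega)]
      simp only [Fin.castSucc_mk] at h1 h2 ⊢
      linarith
  · have h1 := hw ⟨a, ha⟩
    rw [← heq, if_neg hl, relabel, relabel, if_neg hl, if_neg hl] at h1
    rw [labelShift, if_neg hl]
    exact h1

theorem compMove_of_ne_zero (hr : ∀ l : Fin n, r l < p l.castSucc)
    (hcop : Pairwise fun i j => Nat.Coprime (p i) (p j)) (hL : wordWeight (sharp p) L = 0)
    (k : Fin (n + 1)) {m : Fin n → ℕ} (h : compCoef q p r k L m ≠ 0) (l : Fin n) :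
    (compMove p k L m l : ℤ) = m l + labelShift p k L l := by
  have hm : InV k m := by
    by_contra hm
    exact h (if_neg hm)
  rw [compCoef, if_pos hm] at h
  obtain ⟨m', -, -, h'⟩ := exists_relabel_wordMove hr hcop hL k hm h
  rw [compMove, Int.toNat_of_nonneg]
  rw [← h' l]
  exact Int.natCast_nonneg _

/-- On `V^n_k` the word becomes a weighted translation. Where the coefficient vanishes, `compMove`
carries no information and none is needed. -/
theorem compress_word_ket (h0 : 0 < q) (h1 : q < 1) (hp : ∀ i, 0 < p i)
    (hr : ∀ l : Fin n, r l < p l.castSucc) (hcop : Pairwise fun i j => Nat.Coprime (p i) (p j))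
    (hL : wordWeight (sharp p) L = 0) (k : Fin (n + 1)) (m : Fin n → ℕ) :
    compress h0 h1 hp r k (Sphere.word L) (ket m) =
      (compCoef q p r k L m : ℂ) • ket (compMove p k L m) := by
  by_cases hm : InV k m
  · rw [compress, clm_mul_apply, clm_mul_apply, relabelOp_ket, if_pos hm, one_smul,
      sphRep_word_ket, map_smul, compCoef, if_pos hm]
    by_cases h : wordCoef q k L (relabel p r k m) = 0
    · rw [h]; simp
    · obtain ⟨m', hm', heq, h'⟩ := exists_relabel_wordMove hr hcop hL k hm h
      have : compMove p k L m = m' := by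
        ext l
        rw [compMove, ← h' l, Int.toNat_natCast]
      rw [← heq, star_relabelOp_ket hp k m' hm', this]
  · rw [compress_ket_of_not_inV h0 h1 hp k _ m hm, compCoef, if_neg hm]
    simp

theorem abs_compCoef_le_one (h0 : 0 < q) (h1 : q < 1) (k : Fin (n + 1)) (m : Fin n → ℕ) :
    |compCoef q p r k L m| ≤ 1 := by
  unfold compCoef
  split_ifs
  · rw [abs_of_nonneg (wordCoef_nonneg h0 _ _ _)]
    exact wordCoef_le_one h0 h1 _ _ _
  · simp

/-! ### Comparison of consecutive representations on the common labels. -/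

/-- The intersection of the sets of labels of `V^n_k` and `V^n_{k+1}`. -/
def InBoth (k : Fin n) (m : Fin n → ℕ) : Prop := InV k.castSucc m ∧ InV k.succ m

/-- The larger index makes the entries nondecreasing up to place `k` (counted from zero), and the
smaller one makes them strictly decreasing from there on. -/
theorem InBoth.le_peak {k : Fin n} {m : Fin n → ℕ} (h : InBoth k m) (l : Fin n) : m l ≤ m k := by
  rcases lt_trichotomy l k with hl | rfl | hl
  · exact h.2.1 l k hl (by simp)
  · exact le_rfl
  · exact (h.1.2 k l (by simp) hl).le

theorem InBoth.sum_le {k : Fin n} {m : Fin n → ℕ} (h : InBoth k m) : ∑ l, m l ≤ n * m k := by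
  calc ∑ l, m l ≤ ∑ _l : Fin n, m k := sum_le_sum fun l _ => h.le_peak l
    _ = n * m k := by simp

/-- The two relabellings agree below place `k`, so the estimate for words applies; its exponent
dominates the peak `m k` by `le_psum_relabel`. -/
theorem exists_abs_compCoef_sub_le (h0 : 0 < q) (h1 : q < 1) (hp : ∀ i, 0 < p i)
    (L : List (Fin (n + 1) × Bool)) :
    ∃ C : ℝ, 0 ≤ C ∧ ∀ (k : Fin n) (m : Fin n → ℕ), InBoth k m →
      |compCoef q p r k.castSucc L m - compCoef q p r k.succ L m| ≤ C * q ^ m k := by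
  obtain ⟨C, hC⟩ := exists_abs_wordCoef_sub_le h0 h1 L
  refine ⟨|C|, abs_nonneg _, fun k m hm => ?_⟩
  rw [compCoef, compCoef, if_pos hm.1, if_pos hm.2]
  have h := hC k k.2 (relabel p r k.castSucc m) (relabel p r k.succ m) (fun l hl => by
    simp [relabel, hl, Nat.lt_succ_of_lt hl])
  refine h.trans (mul_le_mul (le_abs_self C) ?_ (by positivity) (abs_nonneg _))
  exact pow_le_pow_of_le_one h0.le h1.le (le_psum_relabel hp k.succ m k (by simp))

/-- In the difference of two consecutive representations only one translation of the labels
occurs. -/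
theorem compCoef_eq_zero_or_compMove_eq (hp : ∀ i, 0 < p i)
    (hcop : Pairwise fun i j => Nat.Coprime (p i) (p j)) (hL : wordWeight (sharp p) L = 0)
    (k : Fin n) :
    (∀ m, compCoef q p r k.castSucc L m = 0) ∨
      labelShift p k.castSucc L = labelShift p k.succ L := by
  -- A letter with index above `k` makes the smaller representation kill the word; otherwise the two
  -- translations coincide.
  by_cases h : ∀ x ∈ L, x.1.val ≤ k.val
  · right
    simpa using (labelShift_succ hp hcop hL h).symm
  · left
    intro m
    push Not at h
    obtain ⟨x, hx, hk⟩ := h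
    unfold compCoef
    split_ifs
    · exact wordCoef_eq_zero _ L _ x hx (by simpa using hk)
    · rfl

open Classical in
/-- The indicator function of `V^n_k` is the sum of those of its intersections with the neighbours. -/
theorem ite_inV_eq (hn : 1 ≤ n) (k : Fin (n + 1)) (m : Fin n → ℕ) :
    (if InV k m then (1 : ℂ) else 0) =
      (if h : k.val < n then (if InBoth ⟨k, h⟩ m then (1 : ℂ) else 0) else 0) +
        (if h : 0 < k.val then (if InBoth ⟨k - 1, by omega⟩ m then (1 : ℂ) else 0) else 0) := by
  have hkn := k.2
  have e1 : ∀ h : k.val < n, (⟨k, h⟩ : Fin n).castSucc = k := fun h => rfl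
  have e2 : ∀ h : 0 < k.val, (⟨k - 1, by omega⟩ : Fin n).succ = k := fun h => by
    ext; simp; omega
  by_cases hm : InV k m
  · by_cases ha : ∃ h : k.val < n, InBoth ⟨k, h⟩ m
    · obtain ⟨h, hb⟩ := ha
      -- The label cannot lie in both neighbours, since their indices differ by two.
      have : ¬ ∃ h : 0 < k.val, InBoth ⟨k - 1, by omega⟩ m := by
        rintro ⟨h', hb'⟩
        exact inV_disjoint (j := (⟨k - 1, by omega⟩ : Fin n).castSucc) (k := (⟨k, h⟩ : Fin n).succ)
          (by simp only [Fin.val_castSucc, Fin.val_succ]; omega) m hb'.1 hb.2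
      rw [if_pos hm, dif_pos h, if_pos hb]
      split_ifs with h2 h3
      · exact absurd ⟨h2, h3⟩ this
      · simp
      · simp
    · have hb : ∃ h : 0 < k.val, InBoth ⟨k - 1, by omega⟩ m := by
        -- For `k = 0` the label would lie in `V^n_1`, whose monotonicity condition on a single
        -- place is vacuous; here `n ≥ 1` enters.
        have hk0 : 0 < k.val := by
          by_contra hk0
          refine ha ⟨by omega, hm, ⟨fun a b hab hb => ?_, fun a b ha' hab => hm.2 a b ?_ hab⟩⟩
          · have := Fin.lt_def.mp hab
            simp only [Fin.val_succ] at hb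
            omega
          · simp only [Fin.val_succ] at ha'
            omega
        refine ⟨hk0, ⟨fun a b hab hb => hm.1 a b hab (by simp at hb; omega), fun a b ha' hab => ?_⟩,
          by rw [e2 hk0]; exact hm⟩
        have hab' := Fin.lt_def.mp hab
        simp only [Fin.val_castSucc] at ha'
        rcases Nat.lt_or_ge a.val k.val with hak | hak
        · have hkn' : k.val < n := by have := b.2; omega
          -- Here `a` is the place `k - 1`. Without a drop after it the nondecreasing run would
          -- extend by one place, putting the label into `V^n_{k+1}`, which is excluded by `ha`.
          have hstep : m ⟨k, hkn'⟩ < m a := by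
            by_contra hle
            refine ha ⟨hkn', hm, ⟨fun c d hcd hd => ?_, fun c d hc hcd =>
              hm.2 c d (by simp at hc; omega) hcd⟩⟩
            have hcd' := Fin.lt_def.mp hcd
            simp only [Fin.val_succ] at hd
            rcases Nat.lt_or_ge d.val k.val with hdk | hdk
            · exact hm.1 c d hcd hdk
            · have hdd : d = ⟨k, hkn'⟩ := Fin.ext (by simp only; omega)
              subst hdd
              refine le_trans ?_ (not_lt.mp hle)
              rcases eq_or_lt_of_le (show c ≤ a from Fin.le_def.mpr (by simp at hcd'; omega)) with h | h
              · rw [h]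
              · exact hm.1 c a h hak
          rcases eq_or_lt_of_le (show (⟨k, hkn'⟩ : Fin n) ≤ b from Fin.le_def.mpr (by simp only; omega))
            with h | h
          · rwa [← h]
          · exact (hm.2 _ b (by simp) h).trans hstep
        · exact hm.2 a b hak hab
      obtain ⟨h, hb⟩ := hb
      rw [if_pos hm, dif_pos h, if_pos hb]
      split_ifs with h2 h3
      · exact absurd ⟨h2, h3⟩ ha
      · simp
      · simp
  · rw [if_neg hm]
    have hA : ∀ h : k.val < n, ¬ InBoth ⟨k, h⟩ m := fun h hb => hm hb.1
    have hB : ∀ h : 0 < k.val, ¬ InBoth ⟨k - 1, by omega⟩ m := fun h hb => hm (by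
      rw [← e2 h]; exact hb.2)
    simp only [hA, if_false, dite_eq_ite, ite_self]
    split_ifs with h h'
    · exact absurd h' (hB h)
    · simp
    · simp

end compress

/-! ### Weighted shifts and the operator `|D^λ|` -/

/-- The adjoint of a weighted shift has a pointwise formula which does not invert `f`. For this
reason the estimates are made for adjoints of words and transferred by closure of the algebra under
`star`. -/
theorem star_apply_of_ket {A : Hil n →L[ℂ] Hil n} {c : (Fin n → ℕ) → ℂ}
    {f : (Fin n → ℕ) → (Fin n → ℕ)} (h : ∀ m, A (ket m) = c m • ket (f m)) (v : Hil n)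
    (m : Fin n → ℕ) : (star A) v m = star (c m) * v (f m) := by
  have h1 : inner ℂ (ket m) ((star A) v) = inner ℂ (A (ket m)) v := by
    rw [ContinuousLinearMap.star_eq_adjoint, ContinuousLinearMap.adjoint_inner_right]
  rw [h, inner_smul_left, ket, ket, lp.inner_single_left, lp.inner_single_left] at h1
  simpa using h1

theorem exists_weightedShift {c : (Fin n → ℕ) → ℂ} {f : (Fin n → ℕ) → (Fin n → ℕ)}
    (hf : Set.InjOn f (Function.support c)) {C : ℝ} (hc : ∀ m, ‖c m‖ ≤ C) :
    ∃ B : Hil n →L[ℂ] Hil n, ∀ v m, B v m = c m * v (f m) := by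
  -- `WShift` accepts only contractions, so the coefficients are rescaled by a constant that is
  -- positive whatever `C` is.
  have hD : 0 < |C| + 1 := by positivity
  have hD' : ((|C| + 1 : ℝ) : ℂ) ≠ 0 := by exact_mod_cast hD.ne'
  refine ⟨((|C| + 1 : ℝ) : ℂ) • WShift.co
    { map := f
      coef := fun m => ((|C| + 1 : ℝ) : ℂ)⁻¹ * c m
      inj := hf.mono fun m hm => right_ne_zero_of_mul hm
      bdd := fun m => ?_ }, fun v m => ?_⟩
  · rw [norm_mul, norm_inv, Complex.norm_real, Real.norm_of_nonneg hD.le, inv_mul_le_iff₀ hD,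
      mul_one]
    linarith [hc m, le_abs_self C]
  · change ((|C| + 1 : ℝ) : ℂ) * (((|C| + 1 : ℝ) : ℂ)⁻¹ * c m * v (f m)) = _
    field_simp

/-- The eigenvalue of `|D^λ|` on the basis vector `|m⟩`. -/
noncomputable def eig (lam : NNReal → NNReal) (m : Fin n → ℕ) : ℝ := (lam (∑ i, m i : ℕ) : ℝ)

theorem mem_absD_domain {lam : NNReal → NNReal} {v : Hil n} :
    v ∈ (absD n lam).domain ↔ Memℓp (fun m : Fin n → ℕ => (eig lam m : ℂ) * v m) 2 := Iff.rfl

theorem absD_apply {lam : NNReal → NNReal} (v : (absD n lam).domain) (m : Fin n → ℕ) :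
    (absD n lam v) m = (eig lam m : ℂ) * (v : Hil n) m := rfl

/-- `v` belongs to the domain of `|D^λ|` and `|D^λ| v = w`. -/
theorem exists_absD_eq {lam : NNReal → NNReal} {v w : Hil n}
    (h : ∀ m, (eig lam m : ℂ) * v m = w m) :
    ∃ hv : v ∈ (absD n lam).domain, absD n lam ⟨v, hv⟩ = w := by
  have hv : v ∈ (absD n lam).domain := by
    rw [mem_absD_domain, funext h]
    exact lp.memℓp w
  exact ⟨hv, by ext m; exact h m⟩

/-- The commutator of `A` with `|D^λ|` extends to a bounded operator. -/
def BoundedCommutator (lam : NNReal → NNReal) (A : Hil n →L[ℂ] Hil n) : Prop :=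
  ∃ B : Hil n →L[ℂ] Hil n, ∀ (v : (absD n lam).domain) (m : Fin n → ℕ),
    (eig lam m : ℂ) * A v m = A (absD n lam v) m + B v m

/-- The product `|D^λ| A` is a bounded operator. -/
def BoundedProduct (lam : NNReal → NNReal) (A : Hil n →L[ℂ] Hil n) : Prop :=
  ∃ B : Hil n →L[ℂ] Hil n, ∀ (v : Hil n) (m : Fin n → ℕ), (eig lam m : ℂ) * A v m = B v m

/-! ### Linearity of the two boundedness properties. -/

section closure

variable {lam : NNReal → NNReal} {A A' : Hil n →L[ℂ] Hil n}

theorem BoundedCommutator.zero : BoundedCommutator lam (0 : Hil n →L[ℂ] Hil n) :=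
  ⟨0, fun v m => by simp⟩

theorem BoundedCommutator.add (h : BoundedCommutator lam A) (h' : BoundedCommutator lam A') :
    BoundedCommutator lam (A + A') := by
  obtain ⟨B, hB⟩ := h
  obtain ⟨B', hB'⟩ := h'
  refine ⟨B + B', fun v m => ?_⟩
  simp only [add_apply, lp.coeFn_add, Pi.add_apply, mul_add, hB, hB']
  ring

theorem BoundedCommutator.smul (c : ℂ) (h : BoundedCommutator lam A) :
    BoundedCommutator lam (c • A) := by
  obtain ⟨B, hB⟩ := h
  refine ⟨c • B, fun v m => ?_⟩
  simp only [smul_apply, lp.coeFn_smul, Pi.smul_apply, smul_eq_mul]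
  rw [mul_left_comm, hB]
  ring

theorem BoundedCommutator.sum {ι : Type*} (s : Finset ι) {A : ι → Hil n →L[ℂ] Hil n}
    (h : ∀ i ∈ s, BoundedCommutator lam (A i)) : BoundedCommutator lam (∑ i ∈ s, A i) :=
  sum_induction A _ (fun _ _ h h' => h.add h') .zero h

theorem BoundedProduct.zero : BoundedProduct lam (0 : Hil n →L[ℂ] Hil n) :=
  ⟨0, fun v m => by simp⟩

theorem BoundedProduct.add (h : BoundedProduct lam A) (h' : BoundedProduct lam A') :
    BoundedProduct lam (A + A') := by
  obtain ⟨B, hB⟩ := h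
  obtain ⟨B', hB'⟩ := h'
  refine ⟨B + B', fun v m => ?_⟩
  simp only [add_apply, lp.coeFn_add, Pi.add_apply, mul_add, hB, hB']

theorem BoundedProduct.smul (c : ℂ) (h : BoundedProduct lam A) :
    BoundedProduct lam (c • A) := by
  obtain ⟨B, hB⟩ := h
  refine ⟨c • B, fun v m => ?_⟩
  simp only [smul_apply, lp.coeFn_smul, Pi.smul_apply, smul_eq_mul]
  rw [mul_left_comm, hB]

end closure

/-! ### Bounded commutators and products for words of weight zero. -/

section words

variable {p : Fin (n + 1) → ℕ} {r : Fin n → ℕ} {L : List (Fin (n + 1) × Bool)}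
  {lam : NNReal → NNReal}

theorem compMove_injOn (hr : ∀ l : Fin n, r l < p l.castSucc)
    (hcop : Pairwise fun i j => Nat.Coprime (p i) (p j)) (hL : wordWeight (sharp p) L = 0)
    (k : Fin (n + 1)) : Set.InjOn (compMove p k L) {m | compCoef q p r k L m ≠ 0} := by
  intro m hm m' hm' h
  ext l
  have h1 := compMove_of_ne_zero hr hcop hL k hm l
  have h2 := compMove_of_ne_zero hr hcop hL k hm' l
  rw [h] at h1
  omega

/-- The translation changes the sum of the entries by a number independent of `m`, and `λ` is
Lipschitz on the integers. -/
theorem abs_eig_sub_eig_compMove_le (hr : ∀ l : Fin n, r l < p l.castSucc)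
    (hcop : Pairwise fun i j => Nat.Coprime (p i) (p j)) (hL : wordWeight (sharp p) L = 0)
    {K : ℝ} (hK : ∀ a b : ℕ, |(lam a : ℝ) - lam b| ≤ K * |(a : ℝ) - b|)
    (k : Fin (n + 1)) {m : Fin n → ℕ} (hm : compCoef q p r k L m ≠ 0) :
    |eig lam m - eig lam (compMove p k L m)| ≤ |K| * |((∑ l, labelShift p k L l : ℤ) : ℝ)| := by
  refine (hK _ _).trans ?_
  have h1 : ((∑ l, compMove p k L m l : ℕ) : ℤ) = (∑ l, m l : ℕ) + ∑ l, labelShift p k L l := by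
    push_cast
    rw [← sum_add_distrib]
    exact sum_congr rfl fun l _ => compMove_of_ne_zero hr hcop hL k hm l
  have h2 : ((∑ l, compMove p k L m l : ℕ) : ℝ) =
      (∑ l, m l : ℕ) + ((∑ l, labelShift p k L l : ℤ) : ℝ) := by exact_mod_cast h1
  rw [h2, sub_add_cancel_left, abs_neg]
  exact mul_le_mul_of_nonneg_right (le_abs_self K) (abs_nonneg _)

/-- The commutator is again a weighted shift along `compMove`; its coefficient is the old one times
the difference of the eigenvalues at the two labels. -/
theorem boundedCommutator_word (h0 : 0 < q) (h1 : q < 1) (hp : ∀ i, 0 < p i)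
    (hr : ∀ l : Fin n, r l < p l.castSucc) (hcop : Pairwise fun i j => Nat.Coprime (p i) (p j))
    (hL : wordWeight (sharp p) L = 0)
    {K : ℝ} (hK : ∀ a b : ℕ, |(lam a : ℝ) - lam b| ≤ K * |(a : ℝ) - b|) (k : Fin (n + 1)) :
    BoundedCommutator lam (star (compress h0 h1 hp r k (Sphere.word L))) := by
  have hA := star_apply_of_ket (compress_word_ket h0 h1 hp hr hcop hL k)
  have hinj : Set.InjOn (compMove p k L) (Function.support fun m =>
      (((eig lam m - eig lam (compMove p k L m)) * compCoef q p r k L m : ℝ) : ℂ)) :=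
    (compMove_injOn (q := q) hr hcop hL k).mono fun m hm => by
      simp only [Function.mem_support, ne_eq, Complex.ofReal_eq_zero] at hm
      exact right_ne_zero_of_mul hm
  obtain ⟨B, hB⟩ := exists_weightedShift hinj
    (C := |K| * |((∑ l, labelShift p k L l : ℤ) : ℝ)|) (fun m => by
      rw [Complex.norm_real, Real.norm_eq_abs, abs_mul]
      by_cases hm : compCoef q p r k L m = 0
      · rw [hm, abs_zero, mul_zero]; positivity
      · exact (mul_le_of_le_one_right (abs_nonneg _) (abs_compCoef_le_one h0 h1 k m)).trans
          (abs_eig_sub_eig_compMove_le hr hcop hL hK k hm))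
  refine ⟨B, fun v m => ?_⟩
  rw [hA, hA, hB, absD_apply, Complex.star_def, Complex.conj_ofReal]
  push_cast
  ring

/-- By `ite_inV_eq` each term splits over the two adjacent intersections. Each intersection then
receives contributions from its two neighbouring indices, with opposite signs. -/
theorem sum_telescope (hn : 1 ≤ n) (m : Fin n → ℕ) (X : Fin (n + 1) → ℂ)
    (hX : ∀ k, ¬ InV k m → X k = 0) (χ : Fin n → ℂ) (hχ : ∀ k, InBoth k m → χ k = 1)
    (hχ' : ∀ k, ¬ InBoth k m → χ k = 0) :
    ∑ k : Fin (n + 1), (-1) ^ k.val * X k =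
      ∑ k : Fin n, (-1) ^ k.val * χ k * (X k.castSucc - X k.succ) := by
  classical
  have h1 : ∀ k, X k = (if InV k m then (1 : ℂ) else 0) * X k := fun k => by
    split_ifs with h
    · rw [one_mul]
    · rw [hX k h, mul_zero]
  have hχ2 : ∀ k, (if InBoth k m then (1 : ℂ) else 0) = χ k := fun k => by
    split_ifs with h
    · exact (hχ k h).symm
    · exact (hχ' k h).symm
  rw [sum_congr rfl fun k _ => congrArg _ (h1 k)]
  simp only [ite_inV_eq hn, hχ2, add_mul, mul_add, sum_add_distrib]
  have hA : ∑ k : Fin (n + 1), (-1) ^ k.val * ((if h : k.val < n then χ ⟨k, h⟩ else 0) * X k) =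
      ∑ k : Fin n, (-1) ^ k.val * (χ k * X k.castSucc) := by
    rw [Fin.sum_univ_castSucc]
    simp
  have hB : ∑ k : Fin (n + 1), (-1) ^ k.val *
      ((if h : 0 < k.val then χ ⟨k.val - 1, by omega⟩ else 0) * X k) =
      ∑ k : Fin n, (-1) ^ (k.val + 1) * (χ k * X k.succ) := by
    rw [Fin.sum_univ_succ]
    simp
  rw [hA, hB, ← sum_add_distrib]
  refine sum_congr rfl fun k _ => ?_
  rw [pow_succ]
  ring

theorem exists_mul_pow_le (h0 : 0 < q) (h1 : q < 1) : ∃ M : ℝ, ∀ x : ℕ, (x : ℝ) * q ^ x ≤ M := by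
  obtain ⟨M, hM⟩ := (tendsto_self_mul_const_pow_of_lt_one h0.le h1).bddAbove_range
  exact ⟨M, fun x => hM ⟨x, rfl⟩⟩

/-- On the intersection the sum of the entries is at most `n` times the peak, so the eigenvalue is
at most affine in `m k`, and `x q^x` is bounded. -/
theorem exists_eig_mul_pow_le (h0 : 0 < q) (h1 : q < 1)
    {K : ℝ} (hK : ∀ a b : ℕ, |(lam a : ℝ) - lam b| ≤ K * |(a : ℝ) - b|) :
    ∃ M : ℝ, ∀ (k : Fin n) (m : Fin n → ℕ), InBoth k m → eig lam m * q ^ m k ≤ M := by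
  obtain ⟨M, hM⟩ := exists_mul_pow_le h0 h1
  refine ⟨lam 0 + |K| * n * M, fun k m hm => ?_⟩
  have h2 := hK (∑ l, m l) 0
  have h3 : ((∑ l, m l : ℕ) : ℝ) ≤ n * m k := by exact_mod_cast hm.sum_le
  have h4 : eig lam m ≤ lam 0 + |K| * (n * m k) := by
    have h5 := (le_abs_self _).trans h2
    rw [Nat.cast_zero, Nat.cast_zero, sub_zero, Nat.abs_cast] at h5
    have h6 : K * ((∑ l, m l : ℕ) : ℝ) ≤ |K| * (n * m k) :=
      mul_le_mul (le_abs_self K) h3 (Nat.cast_nonneg _) (abs_nonneg K)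
    have : eig lam m = (lam (∑ l, m l : ℕ) : ℝ) := rfl
    linarith
  have h7 : q ^ m k ≤ 1 := pow_le_one₀ h0.le h1.le
  calc eig lam m * q ^ m k ≤ (lam 0 + |K| * (n * m k)) * q ^ m k := by gcongr
    _ = lam 0 * q ^ m k + |K| * n * (m k * q ^ m k) := by ring
    _ ≤ lam 0 * 1 + |K| * n * M := by gcongr; exact hM _
    _ = _ := by ring

/-- This is the cancellation between `π_+` and `π_-`. The alternating sum telescopes into `n`
weighted shifts supported on the intersections, where the coefficient differences decay
exponentially and compensate the eigenvalue. -/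
theorem boundedProduct_word (hn : 1 ≤ n) (h0 : 0 < q) (h1 : q < 1) (hp : ∀ i, 0 < p i)
    (hr : ∀ l : Fin n, r l < p l.castSucc) (hcop : Pairwise fun i j => Nat.Coprime (p i) (p j))
    (hL : wordWeight (sharp p) L = 0)
    {K : ℝ} (hK : ∀ a b : ℕ, |(lam a : ℝ) - lam b| ≤ K * |(a : ℝ) - b|) :
    BoundedProduct lam (∑ k : Fin (n + 1),
      (-1 : ℂ) ^ k.val • star (compress h0 h1 hp r k (Sphere.word L))) := by
  classical
  have hA := fun k => star_apply_of_ket (compress_word_ket h0 h1 hp hr hcop hL k)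
  obtain ⟨C, hC0, hC⟩ := exists_abs_compCoef_sub_le (r := r) h0 h1 hp L
  obtain ⟨M, hM⟩ := exists_eig_mul_pow_le (n := n) h0 h1 hK
  set χ : Fin n → (Fin n → ℕ) → ℝ := fun k m => if InBoth k m then 1 else 0 with hχ
  set b : Fin n → (Fin n → ℕ) → ℝ := fun k m => eig lam m * ((-1) ^ k.val * χ k m *
    (compCoef q p r k.castSucc L m - compCoef q p r k.succ L m)) with hb
  have hB : ∀ k : Fin n, ∃ B : Hil n →L[ℂ] Hil n, ∀ v m,
      B v m = (b k m : ℂ) * v (compMove p k.succ L m) := by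
    intro k
    refine exists_weightedShift (C := |M| * C) ?_ fun m => ?_
    · intro m hm m' hm' h
      -- A nonzero difference means that one of the two coefficients is nonzero. If only that of the
      -- smaller representation is, the word is not killed there and its translation equals that of
      -- the larger one. So a single translation governs the whole support, and injectivity follows.
      have key : ∀ m, (b k m : ℂ) ≠ 0 → ∀ l,
          (compMove p k.succ L m l : ℤ) = m l + labelShift p k.succ L l := by
        intro m hm l
        have hd : compCoef q p r k.castSucc L m - compCoef q p r k.succ L m ≠ 0 :=
          right_ne_zero_of_mul (right_ne_zero_of_mul (Complex.ofReal_ne_zero.mp hm))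
        by_cases hs : compCoef q p r k.succ L m = 0
        · rw [hs, sub_zero] at hd
          rcases compCoef_eq_zero_or_compMove_eq (q := q) (r := r) hp hcop hL k with h | h
          · exact absurd (h m) hd
          · have h2 := compMove_of_ne_zero hr hcop hL k.castSucc hd l
            unfold compMove at h2 ⊢
            rwa [← h]
        · exact compMove_of_ne_zero hr hcop hL k.succ hs l
      ext l
      have e1 := key m hm l
      have e2 := key m' hm' l
      rw [h] at e1
      omega
    · rw [Complex.norm_real, Real.norm_eq_abs]
      by_cases hm : InBoth k m
      · have he : 0 ≤ eig lam m := NNReal.coe_nonneg _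
        simp only [hb, hχ, if_pos hm, abs_mul, abs_pow, abs_neg, abs_one, one_pow, one_mul,
          abs_of_nonneg he]
        calc _ ≤ eig lam m * (C * q ^ m k) := by gcongr; exact hC k m hm
          _ = eig lam m * q ^ m k * C := by ring
          _ ≤ |M| * C := by gcongr; exact (hM k m hm).trans (le_abs_self M)
      · simp only [hb, hχ, if_neg hm, mul_zero, zero_mul, abs_zero]
        positivity
  choose B hB using hB
  refine ⟨∑ k, B k, fun v m => ?_⟩
  have h2 := sum_telescope hn m
    (fun k => (compCoef q p r k L m : ℂ) * v (compMove p k L m))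
    (fun k hk => by simp [compCoef, hk]) (fun k => (χ k m : ℂ))
    (fun k hk => by simp [hχ, hk]) (fun k hk => by simp [hχ, hk])
  have h3 : (∑ k : Fin (n + 1),
      (-1 : ℂ) ^ k.val • star (compress h0 h1 hp r k (Sphere.word L))) v m =
      ∑ k : Fin (n + 1), (-1) ^ k.val * ((compCoef q p r k L m : ℂ) * v (compMove p k L m)) := by
    rw [_root_.sum_apply, lp.coeFn_sum, Finset.sum_apply]
    refine sum_congr rfl fun k _ => ?_
    rw [smul_apply, lp.coeFn_smul, Pi.smul_apply, smul_eq_mul, hA, Complex.star_def,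
      Complex.conj_ofReal]
  rw [h3, h2, _root_.sum_apply, lp.coeFn_sum, Finset.sum_apply, mul_sum]
  refine sum_congr rfl fun k _ => ?_
  rw [hB]
  -- The two terms of the difference read `v` at the same label, unless the first one is zero.
  rcases compCoef_eq_zero_or_compMove_eq (q := q) (r := r) hp hcop hL k with h | h
  · simp only [hb, h m]
    push_cast
    ring
  · have : compMove p k.castSucc L m = compMove p k.succ L m := by
      unfold compMove
      rw [h]
    simp only [hb, this]
    push_cast
    ring

end words

/-! ### From words to all elements of the fixed-point algebra. -/

section representation

variable {p : Fin (n + 1) → ℕ} {r : Fin n → ℕ} {lam : NNReal → NNReal}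

theorem star_compress (h0 : 0 < q) (h1 : q < 1) (hp : ∀ i, 0 < p i) (k : Fin (n + 1))
    (a : Sphere q n) : star (compress h0 h1 hp r k a) = compress h0 h1 hp r k (star a) := by
  simp [compress, mul_assoc, map_star]

theorem compress_add (h0 : 0 < q) (h1 : q < 1) (hp : ∀ i, 0 < p i) (k : Fin (n + 1))
    (a b : Sphere q n) :
    compress h0 h1 hp r k (a + b) = compress h0 h1 hp r k a + compress h0 h1 hp r k b := by
  simp [compress, mul_add, add_mul]

theorem compress_smul (h0 : 0 < q) (h1 : q < 1) (hp : ∀ i, 0 < p i) (k : Fin (n + 1))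
    (c : ℂ) (a : Sphere q n) :
    compress h0 h1 hp r k (c • a) = c • compress h0 h1 hp r k a := by
  simp [compress]

theorem boundedCommutator_compress (h0 : 0 < q) (h1 : q < 1) (hp : ∀ i, 0 < p i)
    (hr : ∀ l : Fin n, r l < p l.castSucc) (hcop : Pairwise fun i j => Nat.Coprime (p i) (p j))
    {K : ℝ} (hK : ∀ a b : ℕ, |(lam a : ℝ) - lam b| ≤ K * |(a : ℝ) - b|) (k : Fin (n + 1))
    {a : Sphere q n} (ha : a ∈ wproj q (sharp p)) :
    BoundedCommutator lam (compress h0 h1 hp r k a) := by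
  have key : ∀ b ∈ wordSpan q (sharp p),
      BoundedCommutator lam (star (compress h0 h1 hp r k b)) := by
    intro b hb
    induction hb using Submodule.span_induction with
    | mem b hb =>
      obtain ⟨L, hL, rfl⟩ := hb
      exact boundedCommutator_word h0 h1 hp hr hcop hL hK k
    | zero =>
      rw [← zero_smul ℂ (0 : Sphere q n), compress_smul, zero_smul, star_zero]
      exact .zero
    | add b c _ _ hb hc =>
      rw [compress_add, star_add]
      exact hb.add hc
    | smul c b _ hb =>
      rw [compress_smul, star_smul]
      exact hb.smul _
  -- The result for adjoints is applied to `star a`, which is also fixed by the circle.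
  have h := key _ (wproj_le_wordSpan _ (star_mem ha))
  rwa [star_compress, star_star] at h

theorem boundedProduct_sum_compress (hn : 1 ≤ n) (h0 : 0 < q) (h1 : q < 1) (hp : ∀ i, 0 < p i)
    (hr : ∀ l : Fin n, r l < p l.castSucc) (hcop : Pairwise fun i j => Nat.Coprime (p i) (p j))
    {K : ℝ} (hK : ∀ a b : ℕ, |(lam a : ℝ) - lam b| ≤ K * |(a : ℝ) - b|)
    {a : Sphere q n} (ha : a ∈ wproj q (sharp p)) :
    BoundedProduct lam (∑ k : Fin (n + 1), (-1 : ℂ) ^ k.val • compress h0 h1 hp r k a) := by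
  have key : ∀ b ∈ wordSpan q (sharp p), BoundedProduct lam
      (∑ k : Fin (n + 1), (-1 : ℂ) ^ k.val • star (compress h0 h1 hp r k b)) := by
    intro b hb
    induction hb using Submodule.span_induction with
    | mem b hb =>
      obtain ⟨L, hL, rfl⟩ := hb
      exact boundedProduct_word hn h0 h1 hp hr hcop hL hK
    | zero =>
      have : ∀ k, compress h0 h1 hp r k 0 = 0 := fun k => by
        rw [← zero_smul ℂ (0 : Sphere q n), compress_smul, zero_smul]
      simp only [this, star_zero, smul_zero, sum_const_zero]
      exact .zero
    | add b c _ _ hb hc =>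
      simp only [compress_add, star_add, smul_add, sum_add_distrib]
      exact hb.add hc
    | smul c b _ hb =>
      simp only [compress_smul, star_smul, smul_comm _ (star c), ← smul_sum]
      exact hb.smul _
  have h := key _ (wproj_le_wordSpan _ (star_mem ha))
  simpa only [star_compress, star_star] using h

theorem repPar_apply (h0 : 0 < q) (h1 : q < 1) (hp : ∀ i, 0 < p i)
    (hcop : Pairwise fun i j => Nat.Coprime (p i) (p j)) (hr : ∀ l : Fin n, r l < p l.castSucc)
    (s : ℕ) (a : lens q (∏ i, p i) (sharp p)) :
    repPar h0 h1 hp hcop hr s a =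
      ∑ k : Fin (n + 1) with k.val % 2 = s, compress h0 h1 hp r k a := rfl

theorem repPar_sub (h0 : 0 < q) (h1 : q < 1) (hp : ∀ i, 0 < p i)
    (hcop : Pairwise fun i j => Nat.Coprime (p i) (p j)) (hr : ∀ l : Fin n, r l < p l.castSucc)
    (a : lens q (∏ i, p i) (sharp p)) :
    repPar h0 h1 hp hcop hr 0 a - repPar h0 h1 hp hcop hr 1 a =
      ∑ k : Fin (n + 1), (-1 : ℂ) ^ k.val • compress h0 h1 hp r k a := by
  rw [repPar_apply, repPar_apply, sum_filter, sum_filter, ← sum_sub_distrib]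
  refine sum_congr rfl fun k _ => ?_
  rcases Nat.mod_two_eq_zero_or_one k.val with h | h
  · rw [(Nat.even_iff.mpr h).neg_one_pow]
    simp [h]
  · rw [(Nat.odd_iff.mpr h).neg_one_pow]
    simp [h]

end representation

/-! ### The Dirac operator -/

section dirac

variable {lam : NNReal → NNReal}

theorem dirac_apply (v : (dirac n lam).domain) : dirac n lam v =
    WithLp.toLp 2 (absD n lam ⟨(v : Hil2 n).snd, v.2.1⟩, absD n lam ⟨(v : Hil2 n).fst, v.2.2⟩) := rfl

theorem dirac_fst (v : (dirac n lam).domain) (m : Fin n → ℕ) :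
    (dirac n lam v).fst m = (eig lam m : ℂ) * (v : Hil2 n).snd m := rfl

theorem dirac_snd (v : (dirac n lam).domain) (m : Fin n → ℕ) :
    (dirac n lam v).snd m = (eig lam m : ℂ) * (v : Hil2 n).fst m := rfl

theorem Hil2.ext {u v : Hil2 n} (h1 : ∀ m, u.fst m = v.fst m) (h2 : ∀ m, u.snd m = v.snd m) :
    u = v := by
  apply WithLp.ofLp_injective
  exact Prod.ext (lp.ext (funext h1)) (lp.ext (funext h2))

theorem ket_mem_domain (m : Fin n → ℕ) : ket m ∈ (absD n lam).domain :=
  (exists_absD_eq (w := (eig lam m : ℂ) • ket m) fun j => by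
    simp only [lp.coeFn_smul, Pi.smul_apply, smul_eq_mul, ket_apply]
    split_ifs with h
    · rw [h]
    · simp).1

theorem absD_ket (m : Fin n → ℕ) :
    absD n lam ⟨ket m, ket_mem_domain m⟩ = (eig lam m : ℂ) • ket m := by
  ext j
  rw [absD_apply]
  simp only [lp.coeFn_smul, Pi.smul_apply, smul_eq_mul, ket_apply]
  split_ifs with h
  · rw [h]
  · simp

theorem inner_ket (m : Fin n → ℕ) (v : Hil n) : inner ℂ (ket m) v = v m := by
  rw [ket, lp.inner_single_left]
  simp

theorem ketFst_mem (m : Fin n → ℕ) : WithLp.toLp 2 (ket m, 0) ∈ (dirac n lam).domain :=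
  ⟨zero_mem _, ket_mem_domain m⟩

theorem ketSnd_mem (m : Fin n → ℕ) : WithLp.toLp 2 (0, ket m) ∈ (dirac n lam).domain :=
  ⟨ket_mem_domain m, zero_mem _⟩

theorem inner_ketFst (m : Fin n → ℕ) (v : Hil2 n) :
    inner ℂ (WithLp.toLp 2 (ket m, 0)) v = v.fst m := by
  rw [WithLp.prod_inner_apply]
  simp [inner_ket]

theorem inner_ketSnd (m : Fin n → ℕ) (v : Hil2 n) :
    inner ℂ (WithLp.toLp 2 (0, ket m)) v = v.snd m := by
  rw [WithLp.prod_inner_apply]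
  simp [inner_ket]

theorem dirac_dense : Dense ((dirac n lam).domain : Set (Hil2 n)) := by
  rw [Submodule.dense_iff_topologicalClosure_eq_top, Submodule.topologicalClosure_eq_top_iff,
    Submodule.eq_bot_iff]
  intro v hv
  rw [Submodule.mem_orthogonal] at hv
  refine Hil2.ext (fun m => ?_) (fun m => ?_)
  · rw [← inner_ketFst, hv _ (ketFst_mem m)]; rfl
  · rw [← inner_ketSnd, hv _ (ketSnd_mem m)]; rfl

theorem absD_symm (u v : (absD n lam).domain) :
    inner ℂ (absD n lam u) (v : Hil n) = inner ℂ (u : Hil n) (absD n lam v) := by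
  rw [lp.inner_eq_tsum, lp.inner_eq_tsum]
  refine tsum_congr fun m => ?_
  rw [absD_apply, absD_apply]
  simp only [RCLike.inner_apply, map_mul, Complex.conj_ofReal]
  ring

theorem dirac_formalAdjoint : (dirac n lam).IsFormalAdjoint (dirac n lam) := by
  intro u v
  rw [dirac_apply, dirac_apply, WithLp.prod_inner_apply, WithLp.prod_inner_apply]
  have e1 := absD_symm ⟨(u : Hil2 n).snd, u.2.1⟩ ⟨(v : Hil2 n).fst, v.2.2⟩
  have e2 := absD_symm ⟨(u : Hil2 n).fst, u.2.2⟩ ⟨(v : Hil2 n).snd, v.2.1⟩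
  rw [add_comm]
  exact congrArg₂ (· + ·) e2 e1

theorem dirac_ketFst (m : Fin n → ℕ) : dirac n lam ⟨_, ketFst_mem m⟩ =
    (eig lam m : ℂ) • WithLp.toLp 2 (0, ket m) := by
  refine Hil2.ext (fun j => ?_) (fun j => ?_)
  · rw [dirac_fst]
    simp [-Complex.coe_smul]
  · rw [dirac_snd]
    exact congrFun (congrArg Subtype.val (absD_ket (lam := lam) m)) j

theorem dirac_ketSnd (m : Fin n → ℕ) : dirac n lam ⟨_, ketSnd_mem m⟩ =
    (eig lam m : ℂ) • WithLp.toLp 2 (ket m, 0) := by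
  refine Hil2.ext (fun j => ?_) (fun j => ?_)
  · rw [dirac_fst]
    exact congrFun (congrArg Subtype.val (absD_ket (lam := lam) m)) j
  · rw [dirac_snd]
    simp [-Complex.coe_smul]

/-- Pairing with basis vectors shows that the adjoint multiplies coordinates by the same
eigenvalues. Its image lies in the Hilbert space, so its domain is inside the maximal domain, which
is that of `dirac`. -/
theorem dirac_isSelfAdjoint : IsSelfAdjoint (dirac n lam) := by
  rw [LinearPMap.isSelfAdjoint_def]
  refine le_antisymm ?_ (dirac_formalAdjoint.le_adjoint dirac_dense)
  have key : ∀ y : (dirac n lam).adjoint.domain,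
      (∀ m, (eig lam m : ℂ) * (y : Hil2 n).snd m = ((dirac n lam).adjoint y).fst m) ∧
      (∀ m, (eig lam m : ℂ) * (y : Hil2 n).fst m = ((dirac n lam).adjoint y).snd m) := by
    intro y
    have h : ∀ x : (dirac n lam).domain, inner ℂ (x : Hil2 n) ((dirac n lam).adjoint y) =
        inner ℂ (dirac n lam x) (y : Hil2 n) := fun x => by
      rw [← inner_conj_symm, LinearPMap.adjoint_isFormalAdjoint dirac_dense y x, inner_conj_symm]
    constructor
    · intro m
      have h2 := h ⟨_, ketFst_mem m⟩
      rw [dirac_ketFst, inner_smul_left, inner_ketFst, inner_ketSnd, Complex.conj_ofReal] at h2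
      exact h2.symm
    · intro m
      have h2 := h ⟨_, ketSnd_mem m⟩
      rw [dirac_ketSnd, inner_smul_left, inner_ketFst, inner_ketSnd, Complex.conj_ofReal] at h2
      exact h2.symm
  refine ⟨fun y hy => ?_, fun y x hxy => ?_⟩
  · obtain ⟨e1, e2⟩ := key ⟨y, hy⟩
    exact ⟨(exists_absD_eq e1).1, (exists_absD_eq e2).1⟩
  · obtain ⟨e1, e2⟩ := key y
    refine Hil2.ext (fun m => ?_) (fun m => ?_)
    · rw [← e1, dirac_fst, hxy]
    · rw [← e2, dirac_snd, hxy]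

/-- The off-diagonal blocks are `|D| B - A |D| = [|D|, A] - |D| (A - B)` and `|D| A - B |D| = [|D|,
B] + |D| (A - B)`, which explains the three hypotheses. -/
theorem dirac_bounded_comm {A B : Hil n →L[ℂ] Hil n} (hA : BoundedCommutator lam A)
    (hB : BoundedCommutator lam B) (hAB : BoundedProduct lam (A - B)) :
    ∃ h : ∀ v ∈ (dirac n lam).domain, blockDiag A B v ∈ (dirac n lam).domain,
      ∃ C : ℝ, ∀ v : (dirac n lam).domain,
        ‖dirac n lam ⟨blockDiag A B v, h v v.2⟩ - blockDiag A B (dirac n lam v)‖ ≤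
          C * ‖(v : Hil2 n)‖ := by
  obtain ⟨A', hA⟩ := hA
  obtain ⟨B', hB⟩ := hB
  obtain ⟨E, hE⟩ := hAB
  have hdom : ∀ v ∈ (dirac n lam).domain, blockDiag A B v ∈ (dirac n lam).domain := by
    intro v hv
    refine ⟨(exists_absD_eq (w := B (absD n lam ⟨v.snd, hv.1⟩) + B' v.snd) fun m => ?_).1,
      (exists_absD_eq (w := A (absD n lam ⟨v.fst, hv.2⟩) + A' v.fst) fun m => ?_).1⟩
    · exact hB ⟨v.snd, hv.1⟩ m
    · exact hA ⟨v.fst, hv.2⟩ m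
  refine ⟨hdom, ‖A' - E‖ + ‖B' + E‖, fun v => ?_⟩
  have h : dirac n lam ⟨blockDiag A B v, hdom v v.2⟩ - blockDiag A B (dirac n lam v) =
      WithLp.toLp 2 ((A' - E) (v : Hil2 n).snd, 0) +
        WithLp.toLp 2 (0, (B' + E) (v : Hil2 n).fst) := by
    refine Hil2.ext (fun m => ?_) (fun m => ?_)
    · have e1 := hA ⟨(v : Hil2 n).snd, v.2.1⟩ m
      have e2 := hE (v : Hil2 n).snd m
      simp only [WithLp.sub_fst, WithLp.add_fst, lp.coeFn_sub, lp.coeFn_add, Pi.sub_apply,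
        Pi.add_apply, sub_apply, dirac_fst] at e1 e2 ⊢
      change (eig lam m : ℂ) * B (v : Hil2 n).snd m -
        A (absD n lam ⟨(v : Hil2 n).snd, v.2.1⟩) m = A' (v : Hil2 n).snd m - E (v : Hil2 n).snd m + 0
      linear_combination e1 - e2
    · have e1 := hB ⟨(v : Hil2 n).fst, v.2.2⟩ m
      have e2 := hE (v : Hil2 n).fst m
      simp only [WithLp.sub_snd, WithLp.add_snd, lp.coeFn_sub, lp.coeFn_add, Pi.sub_apply,
        Pi.add_apply, sub_apply, dirac_snd] at e1 e2 ⊢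
      change (eig lam m : ℂ) * A (v : Hil2 n).fst m -
        B (absD n lam ⟨(v : Hil2 n).fst, v.2.2⟩) m =
          0 + (B' (v : Hil2 n).fst m + E (v : Hil2 n).fst m)
      linear_combination e1 + e2
  rw [h, add_mul]
  refine (norm_add_le _ _).trans (add_le_add ?_ ?_)
  · rw [WithLp.norm_toLp_fst]
    exact ((A' - E).le_opNorm _).trans
      (mul_le_mul_of_nonneg_left (WithLp.norm_snd_le _ _) (norm_nonneg _))
  · rw [WithLp.norm_toLp_snd]
    exact ((B' + E).le_opNorm _).trans
      (mul_le_mul_of_nonneg_left (WithLp.norm_fst_le _ _) (norm_nonneg _))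

end dirac

/-! ### Compact resolvent -/

/-- The truncations to the finitely many `m` with `‖c m‖ ≥ 1/(N+1)` have finite rank and converge to
`B` in norm. -/
theorem isCompactOperator_diagonal {B : Hil n →L[ℂ] Hil n} {c : (Fin n → ℕ) → ℂ}
    (hB : ∀ v m, B v m = c m * v m) (hc : ∀ ε : ℝ, 0 < ε → {m | ε ≤ ‖c m‖}.Finite) :
    IsCompactOperator B := by
  have hε : ∀ N : ℕ, (0 : ℝ) < 1 / ((N : ℝ) + 1) := fun N => by positivity
  let F : ℕ → Hil n →L[ℂ] Hil n := fun N =>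
    ∑ m ∈ (hc _ (hε N)).toFinset, (innerSL ℂ (ket m)).smulRight (c m • ket m)
  have hF : ∀ N, IsCompactOperator (F N) := by
    intro N
    refine sum_induction (M := Hil n →L[ℂ] Hil n) _ (fun A => IsCompactOperator A)
      (fun A A' h h' => h.add h') isCompactOperator_zero fun m _ => ?_
    exact (isCompactOperator_of_locallyCompactSpace_rng
      (ContinuousLinearMap.toSpanSingleton ℂ (c m • ket m))).comp_clm (innerSL ℂ (ket m))
  have happ : ∀ N v j, F N v j = if 1 / ((N : ℝ) + 1) ≤ ‖c j‖ then c j * v j else 0 := by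
    intro N v j
    simp only [F]
    rw [_root_.sum_apply, lp.coeFn_sum, Finset.sum_apply]
    simp only [ContinuousLinearMap.smulRight_apply, innerSL_apply_apply, inner_ket, lp.coeFn_smul,
      Pi.smul_apply, smul_eq_mul, ket_apply, mul_ite, mul_one, mul_zero, sum_ite_eq,
      Set.Finite.mem_toFinset, Set.mem_ofPred_eq]
    rw [mul_comm]
  refine isCompactOperator_of_tendsto (l := Filter.atTop) (F := F) ?_ (Filter.Eventually.of_forall hF)
  rw [tendsto_iff_norm_sub_tendsto_zero]
  refine squeeze_zero (fun _ => norm_nonneg _) (fun N => ?_) tendsto_one_div_add_atTop_nhds_zero_nat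
  refine ContinuousLinearMap.opNorm_le_bound _ (hε N).le fun v => ?_
  have h : ‖(F N - B) v‖ ≤ ‖((1 / ((N : ℝ) + 1) : ℝ) : ℂ) • v‖ := by
    refine lp.norm_mono (by norm_num) fun j => ?_
    rw [lp.coeFn_smul, Pi.smul_apply, norm_smul, Complex.norm_real, Real.norm_of_nonneg (hε N).le,
      sub_apply, lp.coeFn_sub, Pi.sub_apply, happ, hB]
    split_ifs with h
    · rw [sub_self, norm_zero]
      exact mul_nonneg (hε N).le (norm_nonneg _)
    · rw [zero_sub, norm_neg, norm_mul]
      exact mul_le_mul_of_nonneg_right (not_le.mp h).le (norm_nonneg _)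
  rwa [norm_smul, Complex.norm_real, Real.norm_of_nonneg (hε N).le] at h

theorem finite_eig_le {lam : NNReal → NNReal}
    (hub : ∀ T : ℝ, ∃ N : ℕ, ∀ a : ℕ, N ≤ a → T < lam a) (T : ℝ) :
    {m : Fin n → ℕ | eig lam m ≤ T}.Finite := by
  obtain ⟨N, hN⟩ := hub T
  refine (Set.finite_Iic fun _ : Fin n => N).subset fun m hm l => ?_
  by_contra h
  have h1 : m l ≤ ∑ i, m i := single_le_sum (fun _ _ => Nat.zero_le _) (mem_univ l)
  exact absurd (hN (∑ i, m i) ((not_le.mp h).le.trans h1)) (not_lt.mpr hm)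

/-- As `D^2` is diagonal, the inverse of `D + i` is `(D - i)(D^2 + 1)^{-1}`. Its off-diagonal
entries are `c₁` and its diagonal ones `c₂`. -/
theorem dirac_compact_resolvent {lam : NNReal → NNReal}
    (hub : ∀ T : ℝ, ∃ N : ℕ, ∀ a : ℕ, N ≤ a → T < lam a) :
    ∃ R : Hil2 n →L[ℂ] Hil2 n, IsCompactOperator R ∧
      (∀ v, ∃ h : R v ∈ (dirac n lam).domain, dirac n lam ⟨R v, h⟩ + Complex.I • R v = v) ∧
      ∀ v : (dirac n lam).domain, R (dirac n lam v + Complex.I • (v : Hil2 n)) = v := by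
  set e : (Fin n → ℕ) → ℝ := eig lam with he
  have he0 : ∀ m, 0 ≤ e m := fun m => NNReal.coe_nonneg _
  have hsq : ∀ m, ((e m : ℂ) ^ 2 + 1) ≠ 0 := fun m => by
    have : (0 : ℝ) < e m ^ 2 + 1 := by positivity
    exact_mod_cast this.ne'
  set c₁ : (Fin n → ℕ) → ℂ := fun m => ((e m / (e m ^ 2 + 1) : ℝ) : ℂ) with hc₁
  set c₂ : (Fin n → ℕ) → ℂ := fun m => -Complex.I * ((1 / (e m ^ 2 + 1) : ℝ) : ℂ) with hc₂
  -- A common bound for both coefficients, decaying as the eigenvalue grows; it rests on `(e - 1)^2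
  -- ≥ 0`.
  have hn₁ : ∀ m, ‖c₁ m‖ ≤ 2 / (e m + 1) := fun m => by
    have := he0 m
    rw [hc₁, Complex.norm_real, Real.norm_of_nonneg (by positivity),
      div_le_div_iff₀ (by positivity) (by positivity)]
    nlinarith [sq_nonneg (e m - 1)]
  have hn₂ : ∀ m, ‖c₂ m‖ ≤ 2 / (e m + 1) := fun m => by
    have := he0 m
    rw [hc₂, norm_mul, norm_neg, Complex.norm_I, one_mul, Complex.norm_real,
      Real.norm_of_nonneg (by positivity), div_le_div_iff₀ (by positivity) (by positivity)]
    nlinarith [sq_nonneg (e m - 1)]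
  have hfin : ∀ c : (Fin n → ℕ) → ℂ, (∀ m, ‖c m‖ ≤ 2 / (e m + 1)) → ∀ ε : ℝ, 0 < ε →
      {m | ε ≤ ‖c m‖}.Finite := by
    intro c hc ε hε
    refine (finite_eig_le hub (2 / ε)).subset fun m hm => ?_
    have h1 : ε ≤ 2 / (e m + 1) := le_trans hm (hc m)
    have h0 := he0 m
    rw [le_div_iff₀ (by positivity)] at h1
    change e m ≤ 2 / ε
    rw [le_div_iff₀ hε]
    nlinarith
  have hbd : ∀ c : (Fin n → ℕ) → ℂ, (∀ m, ‖c m‖ ≤ 2 / (e m + 1)) →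
      ∃ B : Hil n →L[ℂ] Hil n, IsCompactOperator B ∧ ∀ v m, B v m = c m * v m := by
    intro c hc
    obtain ⟨B, hB⟩ := exists_weightedShift (c := c) (f := id) (Set.injOn_id _) (C := 2)
      (fun m => (hc m).trans (div_le_self (by norm_num) (by linarith [he0 m])))
    exact ⟨B, isCompactOperator_diagonal hB (hfin c hc), hB⟩
  obtain ⟨B₁, hK₁, hB₁⟩ := hbd c₁ hn₁
  obtain ⟨B₂, hK₂, hB₂⟩ := hbd c₂ hn₂
  let P₁ : Hil2 n →L[ℂ] Hil n := WithLp.fstL 2 ℂ (Hil n) (Hil n)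
  let P₂ : Hil2 n →L[ℂ] Hil n := WithLp.sndL 2 ℂ (Hil n) (Hil n)
  let J₁ : Hil n →L[ℂ] Hil2 n :=
    ((WithLp.prodContinuousLinearEquiv 2 ℂ (Hil n) (Hil n)).symm : _ →L[ℂ] Hil2 n) ∘L
      ContinuousLinearMap.inl ℂ (Hil n) (Hil n)
  let J₂ : Hil n →L[ℂ] Hil2 n :=
    ((WithLp.prodContinuousLinearEquiv 2 ℂ (Hil n) (Hil n)).symm : _ →L[ℂ] Hil2 n) ∘L
      ContinuousLinearMap.inr ℂ (Hil n) (Hil n)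
  let R : Hil2 n →L[ℂ] Hil2 n :=
    J₁ ∘L (B₂ ∘L P₁ + B₁ ∘L P₂) + J₂ ∘L (B₁ ∘L P₁ + B₂ ∘L P₂)
  have hR1 : ∀ v m, (R v).fst m = c₂ m * v.fst m + c₁ m * v.snd m := fun v m => by
    have : (R v).fst = B₂ v.fst + B₁ v.snd + 0 := rfl
    rw [this, add_zero, lp.coeFn_add, Pi.add_apply, hB₁, hB₂]
  have hR2 : ∀ v m, (R v).snd m = c₁ m * v.fst m + c₂ m * v.snd m := fun v m => by
    have : (R v).snd = 0 + (B₁ v.fst + B₂ v.snd) := rfl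
    rw [this, zero_add, lp.coeFn_add, Pi.add_apply, hB₁, hB₂]
  have hI := Complex.I_sq
  have hfst : ∀ (u v : Hil2 n) m, (u + Complex.I • v).fst m = u.fst m + Complex.I * v.fst m :=
    fun _ _ _ => rfl
  have hsnd : ∀ (u v : Hil2 n) m, (u + Complex.I • v).snd m = u.snd m + Complex.I * v.snd m :=
    fun _ _ _ => rfl
  refine ⟨R, ?_, fun v => ?_, fun v => ?_⟩
  · exact (((hK₂.comp_clm P₁).add (hK₁.comp_clm P₂)).clm_comp J₁).add
      (((hK₁.comp_clm P₁).add (hK₂.comp_clm P₂)).clm_comp J₂)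
  · have e1 : ∀ m, (eig lam m : ℂ) * (R v).snd m = (v - Complex.I • R v).fst m := fun m => by
      have := hsq m
      change (e m : ℂ) * (R v).snd m = v.fst m - Complex.I * (R v).fst m
      rw [hR1, hR2, hc₁, hc₂]
      push_cast
      field_simp
      linear_combination -(v.fst m) * hI
    have e2 : ∀ m, (eig lam m : ℂ) * (R v).fst m = (v - Complex.I • R v).snd m := fun m => by
      have := hsq m
      change (e m : ℂ) * (R v).fst m = v.snd m - Complex.I * (R v).snd m
      rw [hR1, hR2, hc₁, hc₂]
      push_cast
      field_simp
      linear_combination -(v.snd m) * hI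
    refine ⟨⟨(exists_absD_eq e1).1, (exists_absD_eq e2).1⟩, ?_⟩
    rw [← eq_sub_iff_add_eq]
    exact Hil2.ext e1 e2
  · refine Hil2.ext (fun m => ?_) (fun m => ?_)
    · have := hsq m
      rw [hR1, hfst, hsnd, dirac_fst, dirac_snd, ← he, hc₁, hc₂]
      push_cast
      field_simp
      linear_combination -(v : Hil2 n).fst m * hI
    · have := hsq m
      rw [hR2, hfst, hsnd, dirac_fst, dirac_snd, ← he, hc₁, hc₂]
      push_cast
      field_simp
      linear_combination -(v : Hil2 n).snd m * hI

/-! ### The spectral triple -/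

theorem blockDiag_mul (A B A' B' : Hil n →L[ℂ] Hil n) :
    blockDiag A B * blockDiag A' B' = blockDiag (A * A') (B * B') := rfl

/-- Only the values of `λ` at natural numbers enter, so the growth and Lipschitz conditions are
required only there. This covers `t^{n/d}`, which for `d > n` is not Lipschitz near zero. -/
theorem isEvenSpectralTriple (hn : 1 ≤ n) (h0 : 0 < q) (h1 : q < 1) {p : Fin (n + 1) → ℕ}
    (hp : ∀ i, 0 < p i) (hcop : Pairwise fun i j => Nat.Coprime (p i) (p j)) {r : Fin n → ℕ}
    (hr : ∀ l : Fin n, r l < p l.castSucc) {lam : NNReal → NNReal}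
    {K : ℝ} (hK : ∀ a b : ℕ, |(lam a : ℝ) - lam b| ≤ K * |(a : ℝ) - b|)
    (hub : ∀ T : ℝ, ∃ N : ℕ, ∀ a : ℕ, N ≤ a → T < lam a) :
    IsEvenSpectralTriple (piRep h0 h1 hp hcop hr) (dirac n lam) (grading n) where
  dense_domain := dirac_dense
  selfAdjoint := dirac_isSelfAdjoint
  compact_resolvent := dirac_compact_resolvent hub
  bounded_comm a := by
    refine dirac_bounded_comm ?_ ?_ ?_
    · rw [repPar_apply]
      exact .sum _ fun k _ => boundedCommutator_compress h0 h1 hp hr hcop hK k a.2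
    · rw [repPar_apply]
      exact .sum _ fun k _ => boundedCommutator_compress h0 h1 hp hr hcop hK k a.2
    · rw [repPar_sub]
      exact boundedProduct_sum_compress hn h0 h1 hp hr hcop hK a.2
  grading_selfAdjoint := by
    rw [isSelfAdjoint_iff, grading, star_blockDiag, star_neg, star_one]
  grading_sq := by
    rw [grading, blockDiag_mul, mul_one, neg_mul_neg, mul_one]
    rfl
  grading_comm a := by
    change blockDiag 1 (-1) * blockDiag _ _ = blockDiag _ _ * blockDiag 1 (-1)
    rw [blockDiag_mul, blockDiag_mul, one_mul, mul_one, neg_one_mul, mul_neg_one]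
  grading_anticomm := by
    refine ⟨fun v hv => ⟨neg_mem hv.1, hv.2⟩, fun v => Hil2.ext (fun m => ?_) (fun m => ?_)⟩
    · rw [dirac_fst]
      change (eig lam m : ℂ) * (-(v : Hil2 n).snd m) = -((eig lam m : ℂ) * (v : Hil2 n).snd m)
      ring
    · rw [dirac_snd]
      change (eig lam m : ℂ) * (v : Hil2 n).fst m = - -((eig lam m : ℂ) * (v : Hil2 n).fst m)
      ring

/-! ### The metric dimension -/

section eigen

variable {lam : NNReal → NNReal}

theorem mem_eigenspace {x : ℝ} {v : (dirac n lam).domain} :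
    v ∈ LinearMap.ker ((dirac n lam).toFun - (x : ℂ) • (dirac n lam).domain.subtype) ↔
      (∀ m, (eig lam m : ℂ) * (v : Hil2 n).snd m = x * (v : Hil2 n).fst m) ∧
        ∀ m, (eig lam m : ℂ) * (v : Hil2 n).fst m = x * (v : Hil2 n).snd m := by
  rw [LinearMap.mem_ker, LinearMap.sub_apply, sub_eq_zero]
  constructor
  · intro h
    exact ⟨fun m => congrArg (fun w : Hil2 n => w.fst m) h,
      fun m => congrArg (fun w : Hil2 n => w.snd m) h⟩
  · rintro ⟨h1, h2⟩
    exact Hil2.ext h1 h2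

/-- Eliminating `b m` gives `(λ^2 - x^2) a m = 0` with `λ` the eigenvalue at `m`, so `a m` can be
nonzero only where `λ = |x|`; then `b m` is determined because `x ≠ 0`. -/
theorem eigenvector_eq_zero {x : ℝ} (hx : x ≠ 0) {a b : Hil n} {m : Fin n → ℕ}
    (h1 : (eig lam m : ℂ) * b m = x * a m) (h2 : (eig lam m : ℂ) * a m = x * b m)
    (h : eig lam m = |x| → a m = 0) : a m = 0 ∧ b m = 0 := by
  have hxC : (x : ℂ) ≠ 0 := by exact_mod_cast hx
  have ha : a m = 0 := by
    by_contra ha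
    have h3 : ((eig lam m : ℂ) ^ 2 - (x : ℂ) ^ 2) * a m = 0 := by
      linear_combination (eig lam m : ℂ) * h2 + (x : ℂ) * h1
    have h4 : eig lam m ^ 2 = x ^ 2 := by
      have := sub_eq_zero.mp ((mul_eq_zero.mp h3).resolve_right ha)
      exact_mod_cast this
    have h5 : eig lam m = |x| := by
      rw [← abs_of_nonneg (show 0 ≤ eig lam m from NNReal.coe_nonneg _)]
      exact (sq_eq_sq_iff_abs_eq_abs _ _).mp h4
    exact ha (h h5)
  refine ⟨ha, ?_⟩
  rw [ha, mul_zero] at h2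
  exact (mul_eq_zero.mp h2.symm).resolve_left hxC

/-- An eigenvector `(a, b)` is determined by the values of `a` on the finite set where the
eigenvalue of `|D|` is `|x|`, and these values are arbitrary. -/
theorem eigenMult_dirac (hub : ∀ T : ℝ, ∃ N : ℕ, ∀ a : ℕ, N ≤ a → T < lam a) {x : ℝ} (hx : x ≠ 0) :
    eigenMult (dirac n lam) x = {m : Fin n → ℕ | eig lam m = |x|}.ncard := by
  set S := {m : Fin n → ℕ | eig lam m = |x|} with hS
  have hfin : S.Finite := (finite_eig_le hub |x|).subset fun m hm => le_of_eq hm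
  have hxC : (x : ℂ) ≠ 0 := by exact_mod_cast hx
  have : Fintype S := hfin.fintype
  let V := LinearMap.ker ((dirac n lam).toFun - (x : ℂ) • (dirac n lam).domain.subtype)
  let f : V →ₗ[ℂ] (S → ℂ) :=
    { toFun := fun v m => ((v : (dirac n lam).domain) : Hil2 n).fst m
      map_add' := fun _ _ => rfl
      map_smul' := fun _ _ => rfl }
  have hinj : Function.Injective f := by
    rw [← LinearMap.ker_eq_bot, LinearMap.ker_eq_bot']
    intro v hv
    obtain ⟨h1, h2⟩ := mem_eigenspace.mp v.2
    have h3 := fun m => eigenvector_eq_zero hx (h1 m) (h2 m) (fun hm => congrFun hv ⟨m, hm⟩)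
    exact Subtype.ext (Subtype.ext (Hil2.ext (fun m => (h3 m).1) (fun m => (h3 m).2)))
  have hsurj : Function.Surjective f := by
    intro g
    set a : Hil n := ∑ m : S, g m • ket m.1 with ha
    have haS : ∀ m : S, a m = g m := by
      intro m
      rw [ha, lp.coeFn_sum, Finset.sum_apply]
      simp only [lp.coeFn_smul, Pi.smul_apply, ket_apply, smul_eq_mul, mul_ite, mul_one, mul_zero]
      rw [sum_eq_single m (fun b _ hb => if_neg fun h => hb (Subtype.ext h.symm))
        (fun h => absurd (mem_univ m) h), if_pos rfl]
    have haS' : ∀ m ∉ S, a m = 0 := by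
      intro m hm
      rw [ha, lp.coeFn_sum, Finset.sum_apply]
      refine sum_eq_zero fun b _ => ?_
      rw [lp.coeFn_smul, Pi.smul_apply, ket_apply, if_neg (fun h => hm (by rw [h]; exact b.2)),
        smul_zero]
    have hmul : ∀ m, (eig lam m : ℂ) * a m = (|x| : ℝ) * a m := by
      intro m
      by_cases hm : m ∈ S
      · rw [show eig lam m = |x| from hm]
      · rw [haS' m hm, mul_zero, mul_zero]
    have hsq : ((|x| : ℝ) : ℂ) * (|x| : ℝ) = x * x := by
      rw [← Complex.ofReal_mul, ← Complex.ofReal_mul, abs_mul_abs_self]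
    -- The factor is the sign of `x`: the eigenvectors are `(a, a)` for `x > 0` and `(a, -a)` for `x
    -- < 0`.
    set b : Hil n := (((|x| : ℝ) : ℂ) / x) • a with hb
    have hbm : ∀ m, b m = ((|x| : ℝ) : ℂ) / x * a m := fun m => rfl
    have h1 : ∀ m, (eig lam m : ℂ) * b m = ((x : ℂ) • a) m := by
      intro m
      change (eig lam m : ℂ) * b m = x * a m
      rw [hbm, mul_left_comm, hmul]
      field_simp
      linear_combination (a m) * hsq
    have h2 : ∀ m, (eig lam m : ℂ) * a m = ((x : ℂ) • b) m := by
      intro m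
      change (eig lam m : ℂ) * a m = x * b m
      rw [hbm, hmul]
      field_simp
    exact ⟨⟨⟨WithLp.toLp 2 (a, b), (exists_absD_eq h1).1, (exists_absD_eq h2).1⟩,
      mem_eigenspace.mpr ⟨h1, h2⟩⟩, funext haS⟩
  have hrank : Module.rank ℂ V = (Fintype.card S : Cardinal) := by
    rw [(LinearEquiv.ofBijective f ⟨hinj, hsurj⟩).rank_eq, rank_fun']
  rw [eigenMult, hrank, map_natCast, Set.ncard_eq_toFinset_card', Set.toFinset_card]

theorem tsum_ite_ncard {α : Type*} {P : α → Prop} [DecidablePred P] (h : {a | P a}.Finite)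
    (c : ENNReal) : ∑' a, (if P a then c else 0) = ({a | P a}.ncard : ENNReal) * c := by
  rw [tsum_eq_sum (s := h.toFinset) (fun a ha => if_neg (by simpa using ha)),
    sum_congr rfl (fun a ha => if_pos (by simpa using ha)), sum_const, nsmul_eq_mul,
    Set.ncard_eq_toFinset_card _ h]

/-- Writing multiplicities as sums over labels and exchanging the sums, a label with eigenvalue `λ >
0` is counted exactly for `x = λ` and `x = -λ`. -/
theorem zetaTrace_dirac (hub : ∀ T : ℝ, ∃ N : ℕ, ∀ a : ℕ, N ≤ a → T < lam a) {s : ℝ} (hs : 0 < s) :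
    zetaTrace (dirac n lam) s = ∑' m : Fin n → ℕ, 2 * ENNReal.ofReal (eig lam m ^ (-s)) := by
  classical
  have h1 : ∀ x : {x : ℝ // x ≠ 0}, (eigenMult (dirac n lam) x : ENNReal) *
      ENNReal.ofReal (|(x : ℝ)| ^ (-s)) = ∑' m : Fin n → ℕ,
        if eig lam m = |(x : ℝ)| then ENNReal.ofReal (|(x : ℝ)| ^ (-s)) else 0 := fun x => by
    rw [tsum_ite_ncard ((finite_eig_le hub |(x : ℝ)|).subset fun m hm => le_of_eq hm),
      eigenMult_dirac hub x.2]
    rfl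
  rw [zetaTrace, tsum_congr h1, ENNReal.tsum_comm]
  refine tsum_congr fun m => ?_
  have he : 0 ≤ eig lam m := NNReal.coe_nonneg _
  rcases eq_or_lt_of_le he with h | h
  -- A label in the kernel is counted for no `x`; on the right it contributes `0 ^ (-s)`, which is
  -- `0` by convention since `s ≠ 0`.
  · rw [← h, Real.zero_rpow (by linarith), ENNReal.ofReal_zero, mul_zero, ENNReal.tsum_eq_zero]
    exact fun x => if_neg (abs_pos.mpr x.2).ne
  · have hne : (⟨eig lam m, h.ne'⟩ : {x : ℝ // x ≠ 0}) ≠ ⟨-eig lam m, neg_ne_zero.mpr h.ne'⟩ := by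
      intro h2
      have := congrArg Subtype.val h2
      simp only at this
      linarith
    rw [tsum_eq_sum (s := {⟨eig lam m, h.ne'⟩, ⟨-eig lam m, neg_ne_zero.mpr h.ne'⟩}), sum_pair hne]
    · simp only [abs_neg, abs_of_pos h, if_true, two_mul]
    · intro x hx
      refine if_neg fun h2 => hx ?_
      rw [mem_insert, mem_singleton, Subtype.ext_iff, Subtype.ext_iff]
      exact eq_or_eq_neg_of_abs_eq h2.symm

end eigen

/-! ### Labels with a given sum and the resulting series. -/

section counting

theorem finite_sum_eq (N : ℕ) : {m : Fin n → ℕ | ∑ i, m i = N}.Finite :=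
  (Set.finite_Iic fun _ : Fin n => N).subset fun m hm l => by
    rw [← show ∑ i, m i = N from hm]
    exact single_le_sum (fun _ _ => Nat.zero_le _) (mem_univ l)

/-- Stars and bars. -/
theorem ncard_sum_eq (n N : ℕ) :
    {m : Fin n → ℕ | ∑ i, m i = N}.ncard = (n + N - 1).choose N := by
  have h : {m : Fin n → ℕ | ∑ i, m i = N} =
      ((univ.finsuppAntidiag N).map Finsupp.equivFunOnFinite.toEmbedding : Finset (Fin n → ℕ)) := by
    ext m
    simp only [Set.mem_ofPred_eq, coe_map, Set.mem_image, mem_coe, mem_finsuppAntidiag,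
      Equiv.coe_toEmbedding]
    constructor
    · intro hm
      exact ⟨Finsupp.equivFunOnFinite.symm m, ⟨by simpa using hm, subset_univ _⟩, by simp⟩
    · rintro ⟨f, ⟨hf, -⟩, rfl⟩
      simpa using hf
  rw [h, Set.ncard_coe_finset, card_map, card_finsuppAntidiag_nat_eq_choose, card_univ,
    Fintype.card_fin]

theorem tsum_comp_sum (h : ℕ → ENNReal) :
    ∑' m : Fin n → ℕ, h (∑ i, m i) = ∑' N : ℕ, ((n + N - 1).choose N : ENNReal) * h N := by
  have h1 : ∀ m : Fin n → ℕ, h (∑ i, m i) = ∑' N, if ∑ i, m i = N then h N else 0 := fun m => by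
    rw [tsum_eq_single (∑ i, m i) (fun N hN => if_neg hN.symm), if_pos rfl]
  rw [tsum_congr h1, ENNReal.tsum_comm]
  refine tsum_congr fun N => ?_
  rw [tsum_ite_ncard (finite_sum_eq N), ncard_sum_eq]

/-- For `N ≥ 1` the binomial coefficient lies between `N^k / k!` and `((k + 1) N)^k`, so the series
is compared with that of `N^{k - t}`. -/
theorem summable_choose_mul_rpow_iff (k : ℕ) (t : ℝ) :
    Summable (fun N : ℕ => ((k + N).choose N : ℝ) * (N : ℝ) ^ (-t)) ↔ (k + 1 : ℝ) < t := by
  have hpow : ∀ N : ℕ, 0 < N → (N : ℝ) ^ ((k : ℝ) - t) = (N : ℝ) ^ k * (N : ℝ) ^ (-t) := by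
    intro N hN
    rw [sub_eq_add_neg, Real.rpow_add (by exact_mod_cast hN), Real.rpow_natCast]
  constructor
  · intro h
    -- The index starts at one because the splitting of the power in `hpow` needs a positive base.
    have h2 : Summable fun N : ℕ => ((N + 1 : ℕ) : ℝ) ^ ((k : ℝ) - t) := by
      refine Summable.of_nonneg_of_le (fun N => by positivity) (fun N => ?_)
        (((summable_nat_add_iff 1).mpr h).mul_left (k.factorial : ℝ))
      rw [hpow _ N.succ_pos, ← mul_assoc]
      refine mul_le_mul_of_nonneg_right ?_ (by positivity)
      have h3 := Nat.pow_le_choose (α := ℝ) k (k + (N + 1))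
      rw [show k + (N + 1) + 1 - k = N + 2 by omega, div_le_iff₀ (by positivity)] at h3
      rw [← Nat.choose_symm_add, mul_comm]
      refine le_trans ?_ h3
      push_cast
      gcongr
      linarith
    have h3 := Real.summable_nat_rpow.mp ((summable_nat_add_iff 1).mp h2)
    linarith
  · intro h
    refine Summable.of_nonneg_of_le (fun N => by positivity) (fun N => ?_)
      ((Real.summable_nat_rpow.mpr (by linarith : (k : ℝ) - t < -1)).mul_left ((k + 1 : ℝ) ^ k))
    rcases Nat.eq_zero_or_pos N with rfl | hN
    -- The term at zero vanishes by the convention for `0 ^ (-t)`, as `t > 0`.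
    · rw [Nat.cast_zero, Real.zero_rpow (by linarith), mul_zero]
      positivity
    · rw [hpow N hN, ← mul_assoc, ← mul_pow]
      refine mul_le_mul_of_nonneg_right ?_ (by positivity)
      rw [← Nat.choose_symm_add]
      have h3 : (k + N).choose k ≤ ((k + 1) * N) ^ k :=
        (Nat.choose_le_pow _ _).trans (Nat.pow_le_pow_left (by nlinarith) k)
      exact_mod_cast h3

end counting

/-! ### The functions `t^α` and the exact range of convergence. -/

section power

/-- Subadditivity of `t^α` for `α ≤ 1` bounds the difference by `c^α`, where `c` is the gap; for a
natural number `c` this is at most `c`. -/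
theorem abs_rpow_sub_rpow_le {α : ℝ} (h0 : 0 < α) (h1 : α ≤ 1) (a b : ℕ) :
    |(((a : NNReal) ^ α : NNReal) : ℝ) - ((b : NNReal) ^ α : NNReal)| ≤ 1 * |(a : ℝ) - b| := by
  wlog hab : a ≤ b generalizing a b
  · rw [abs_sub_comm, abs_sub_comm (a : ℝ)]
    exact this b a (le_of_not_ge hab)
  obtain ⟨c, rfl⟩ := Nat.exists_eq_add_of_le hab
  have h2 : ((a : NNReal) ^ α : NNReal) ≤ ((a + c : ℕ) : NNReal) ^ α :=
    NNReal.rpow_le_rpow (by exact_mod_cast hab) h0.le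
  have h3 : ((a + c : ℕ) : NNReal) ^ α ≤ (a : NNReal) ^ α + (c : NNReal) ^ α := by
    push_cast
    exact NNReal.rpow_add_le_add_rpow _ _ h0.le h1
  have h4 : (c : NNReal) ^ α ≤ c := by
    rcases Nat.eq_zero_or_pos c with rfl | hc
    · simp [h0.ne']
    · conv_rhs => rw [← NNReal.rpow_one (c : NNReal)]
      exact NNReal.rpow_le_rpow_of_exponent_le (by exact_mod_cast hc) h1
  have h2' : (((a : NNReal) ^ α : NNReal) : ℝ) ≤ (((a + c : ℕ) : NNReal) ^ α : NNReal) := h2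
  have h3' : ((((a + c : ℕ) : NNReal) ^ α : NNReal) : ℝ) ≤
      ((a : NNReal) ^ α : NNReal) + ((c : NNReal) ^ α : NNReal) := by exact_mod_cast h3
  have h4' : (((c : NNReal) ^ α : NNReal) : ℝ) ≤ c := by exact_mod_cast h4
  rw [abs_sub_comm, abs_of_nonneg (by linarith), one_mul, abs_sub_comm,
    show ((a + c : ℕ) : ℝ) - a = c by push_cast; ring, Nat.abs_cast]
  linarith

theorem exists_forall_lt_rpow {α : ℝ} (h0 : 0 < α) (T : ℝ) :
    ∃ N : ℕ, ∀ a : ℕ, N ≤ a → T < (((a : NNReal) ^ α : NNReal) : ℝ) := by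
  have h := ((tendsto_rpow_atTop h0).comp tendsto_natCast_atTop_atTop).eventually_gt_atTop T
  obtain ⟨N, hN⟩ := Filter.eventually_atTop.mp h
  refine ⟨N, fun a ha => ?_⟩
  rw [NNReal.coe_rpow, NNReal.coe_natCast]
  exact hN a ha

theorem zetaTrace_rpow_lt_top_iff (hn : 1 ≤ n) {α s : ℝ} (hα : 0 < α) (hs : 0 < s) :
    zetaTrace (dirac n fun t => t ^ α) s < ⊤ ↔ (n : ℝ) < α * s := by
  obtain ⟨k, rfl⟩ := Nat.exists_eq_add_of_le' hn
  have h1 : ∀ m : Fin (k + 1) → ℕ, eig (fun t => t ^ α) m ^ (-s) =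
      ((∑ i, m i : ℕ) : ℝ) ^ (-(α * s)) := fun m => by
    rw [eig, NNReal.coe_rpow, NNReal.coe_natCast, ← Real.rpow_mul (Nat.cast_nonneg _), mul_neg]
  rw [zetaTrace_dirac (exists_forall_lt_rpow hα) hs]
  simp only [h1]
  rw [tsum_comp_sum (fun N => 2 * ENNReal.ofReal ((N : ℝ) ^ (-(α * s))))]
  have h2 : ∀ N : ℕ, ((k + 1 + N - 1).choose N : ENNReal) *
      (2 * ENNReal.ofReal ((N : ℝ) ^ (-(α * s)))) =
      2 * ENNReal.ofReal (((k + N).choose N : ℝ) * (N : ℝ) ^ (-(α * s))) := fun N => by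
    rw [ENNReal.ofReal_mul (Nat.cast_nonneg _), ENNReal.ofReal_natCast,
      show k + 1 + N - 1 = k + N by omega, mul_left_comm]
  have hnn : ∀ N : ℕ, 0 ≤ ((k + N).choose N : ℝ) * (N : ℝ) ^ (-(α * s)) := fun N => by positivity
  rw [tsum_congr h2, ENNReal.tsum_mul_left, Nat.cast_add, Nat.cast_one,
    ← summable_choose_mul_rpow_iff k]
  constructor
  · intro h
    have h3 : ∑' N : ℕ, ENNReal.ofReal (((k + N).choose N : ℝ) * (N : ℝ) ^ (-(α * s))) ≠ ⊤ := by
      intro h4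
      rw [h4, ENNReal.mul_top (by norm_num)] at h
      exact lt_irrefl _ h
    refine (ENNReal.summable_toReal h3).congr fun N => ?_
    exact ENNReal.toReal_ofReal (hnn N)
  · intro h
    rw [← ENNReal.ofReal_tsum_of_nonneg hnn h]
    exact ENNReal.mul_lt_top (by norm_num) ENNReal.ofReal_lt_top

/-- The admissible `s` form exactly the open ray above `d`: the series diverges at `s = d` itself.
-/
theorem hasMetricDimension_rpow (hn : 1 ≤ n) {d : ℝ} (hd : 0 < d) :
    HasMetricDimension (dirac n fun t => t ^ ((n : ℝ) / d)) d := by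
  have hn0 : (0 : ℝ) < n := by exact_mod_cast hn
  have h : {s : ℝ | 0 < s ∧ zetaTrace (dirac n fun t => t ^ ((n : ℝ) / d)) s < ⊤} = Set.Ioi d := by
    ext s
    have key : (n : ℝ) < (n : ℝ) / d * s ↔ d < s := by
      rw [div_mul_eq_mul_div, lt_div_iff₀ hd, mul_lt_mul_iff_right₀ hn0]
    constructor
    · rintro ⟨hs, hz⟩
      exact key.mp ((zetaTrace_rpow_lt_top_iff hn (div_pos hn0 hd) hs).mp hz)
    · intro hs
      have hs0 : 0 < s := hd.trans hs
      exact ⟨hs0, (zetaTrace_rpow_lt_top_iff hn (div_pos hn0 hd) hs0).mpr (key.mpr hs)⟩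
  rw [HasMetricDimension, h]
  exact isGLB_Ioi

theorem exists_forall_lt_of_not_bddAbove {lam : NNReal → NNReal} (hmono : Monotone lam)
    (hub : ¬ BddAbove (Set.range lam)) (T : ℝ) :
    ∃ N : ℕ, ∀ a : ℕ, N ≤ a → T < lam a := by
  rw [not_bddAbove_iff] at hub
  obtain ⟨_, ⟨t, rfl⟩, ht⟩ := hub T.toNNReal
  obtain ⟨N, hN⟩ := exists_nat_ge t
  refine ⟨N, fun a ha => ?_⟩
  have h1 : lam t ≤ lam a := hmono (hN.trans (by exact_mod_cast ha))
  exact (Real.le_coe_toNNReal T).trans_lt (by exact_mod_cast ht.trans_le h1)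

theorem abs_sub_le_of_lipschitzWith {lam : NNReal → NNReal} {K : NNReal} (h : LipschitzWith K lam)
    (a b : ℕ) : |(lam a : ℝ) - lam b| ≤ K * |(a : ℝ) - b| := by
  have := h.dist_le_mul (a : NNReal) b
  rwa [NNReal.dist_eq, NNReal.dist_eq, NNReal.coe_natCast, NNReal.coe_natCast] at this

end power

end QWProj

theorem mainTheorem12 (n : ℕ) (hn : 1 ≤ n) (q : ℝ) (hq0 : 0 < q) (hq1 : q < 1)
    (p : Fin (n + 1) → ℕ) (hp : ∀ i, 0 < p i)
    (hcop : Pairwise fun i j => Nat.Coprime (p i) (p j))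
    (r : Fin n → ℕ) (hr : ∀ i : Fin n, r i < p i.castSucc) :
    (∀ lam : NNReal → NNReal, Monotone lam → (∃ K : NNReal, LipschitzWith K lam) →
      ¬ BddAbove (Set.range lam) →
      QWProj.IsEvenSpectralTriple (QWProj.piRep hq0 hq1 hp hcop hr) (QWProj.dirac n lam)
        (QWProj.grading n)) ∧
    ∀ d : ℝ, (n : ℝ) ≤ d →
      QWProj.IsEvenSpectralTriple (QWProj.piRep hq0 hq1 hp hcop hr)
        (QWProj.dirac n fun t => t ^ ((n : ℝ) / d)) (QWProj.grading n) ∧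
      QWProj.HasMetricDimension (QWProj.dirac n fun t => t ^ ((n : ℝ) / d)) d := by
  refine ⟨fun lam hmono ⟨K, hK⟩ hub => ?_, fun d hd => ?_⟩
  · exact QWProj.isEvenSpectralTriple hn hq0 hq1 hp hcop hr
      (QWProj.abs_sub_le_of_lipschitzWith hK) (QWProj.exists_forall_lt_of_not_bddAbove hmono hub)
  · have hn0 : (0 : ℝ) < n := by exact_mod_cast hn
    have hd0 : 0 < d := hn0.trans_le hd
    have hα : 0 < (n : ℝ) / d := div_pos hn0 hd0
    exact ⟨QWProj.isEvenSpectralTriple hn hq0 hq1 hp hcop hr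
      -- The condition `d ≥ n` is what makes the exponent `n/d` at most one, hence `λ` Lipschitz on
      -- the integers.
      (QWProj.abs_rpow_sub_rpow_le hα ((div_le_one hd0).mpr hd)) (QWProj.exists_forall_lt_rpow hα),
      QWProj.hasMetricDimension_rpow hn hd0⟩
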